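/- Let $d\ge 1$, and let $\mathbf A=\mathrm{diag}(A_1,\dots,A_d)$, $\mathbf B=(B_1,\dots,B_d)$, $\mathbf X=(X_1,\dots,X_d)$ be a random real diagonal matrix and two random vectors in $\mathbb R^d$, defined on a common probability space, such that $\mathbf X\overset{d}{=}\mathbf A\mathbf X+\mathbf B$ and $\mathbf A$, $\mathbf X$ are independent. Let $\alpha_1,\dots,\alpha_d>0$. Assume that for every $j$: (i) the law of $\log|A_j|$ conditioned on $A_j\ne0$ is non-arithmetic (not carried by $a\mathbb Z$ for any $a>0$); (ii) $\mathbb E|A_j|^{\alpha_j}=1$ and $\mathbb E\,|A_j|^{\alpha_j}\log^+|A_j|<\infty$; (iii) $\mathbb E|B_j|^{\alpha_j+\sigma}<\infty$ for some $\sigma>0$; if $\mathbf X$ and $\mathbf B$ are independent, it suffices that $\mathbb E|B_j|^{\alpha_j}<\infty$; (iv) (homogeneous case) $|A_j|^{\alpha_j}=|A_1|^{\alpha_1}$ almost surely. Put $|x|_\alpha=\max_j|x_j|^{\alpha_j}$, $\delta_t x=(t^{1/\alpha_1}x_1,\dots,t^{1/\alpha_d}x_d)$ for $t>0$, $B_r(0)=\{x\in\mathbb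 R^d:|x|_\alpha<r\}$, $S_r^{d-1}=\{x\in\mathbb R^d:|x|_\alpha=r\}$ and $S^{d-1}=S_1^{d-1}$. Let $\mathbf C(\mathbb R^d)$ be the set of bounded continuous $f:\mathbb R^d\to\mathbb R$ with $\operatorname{supp}f\subset\mathbb R^d\setminus B_r(0)$ for some $r>0$. For a measure $\Lambda$ on $\mathbb R^d\setminus\{0\}$ write $\langle f,\Lambda\rangle=\int f\,d\Lambda$. Then there are a Radon measure $\Lambda$ on $\mathbb R^d\setminus\{0\}$, a finite Borel measure $\widetilde\nu$ on $S^{d-1}$ and a real number $c_\infty\geq 0$ such that, for all $f\in\mathbf C(\mathbb R^d)$, $t>0$ and $r>0$, $$\lim_{u\to\infty}u\,\mathbb E f(\delta_{u^{-1}}\mathbf X)=\langle f,\Lambda\rangle,\qquad \lim_{u\to\infty}u\,\mathbb P(|\mathbf X|_\alpha>u)=c_\infty,$$ $$\langle f\circ\delta_t,\Lambda\rangle=t\,\langle f,\Lambda\rangle,\qquad \Lambda(\mathbb R^d\setminus B_r(0))<\infty,\qquad \Lambda(S_r^{d-1})=0,$$ $$\langle f,\Lambda\rangle=\int_0^\infty\int_{S^{d-1}}f(\delta_s\omega)\,d\widetilde\nu(\omega)\,\frac{ds}{s^2},\qquad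 \widetilde\nu(S^{d-1})=c_\infty .$$ If moreover $c_\infty>0$, then the probability measures on $S^{d-1}$ $$m_t(U)=\mathbb P\bigl(\delta_{|\mathbf X|_\alpha^{-1}}\mathbf X\in U\,\big|\,|\mathbf X|_\alpha>t\bigr),\qquad t>0,\ U\subset S^{d-1}\text{ Borel},$$ converge weakly, as $t\to\infty$, to the probability measure $\nu=c_\infty^{-1}\widetilde\nu$, and for all $f\in\mathbf C(\mathbb R^d)$ $$\langle f,\Lambda\rangle=c_\infty\int_0^\infty\int_{S^{d-1}}f(\delta_s\omega)\,d\nu(\omega)\,\frac{ds}{s^2}.$$ -/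

import Mathlib

open MeasureTheory ProbabilityTheory Filter Set
open scoped Topology BoundedContinuousFunction

noncomputable section

namespace DiagonalSRE

variable {d : ℕ}

/-- The homogeneous "norm" `|x|_α = max_j |x_j|^{α_j}` on `ℝ^d`. -/
def alphaNorm (α : Fin d → ℝ) (x : Fin d → ℝ) : ℝ :=
  ⨆ j, |x j| ^ α j

/-- The dilation `δ_t x = (t^{1/α_1} x_1, …, t^{1/α_d} x_d)`. -/
def dilation (α : Fin d → ℝ) (t : ℝ) (x : Fin d → ℝ) : Fin d → ℝ :=
  fun j => t ^ (1 / α j) * x j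

/-- The open ball `B_r(0) = {x : |x|_α < r}`. -/
def alphaBall (α : Fin d → ℝ) (r : ℝ) : Set (Fin d → ℝ) :=
  {x | alphaNorm α x < r}

/-- The sphere `S_r^{d-1} = {x : |x|_α = r}`. -/
def alphaSphere (α : Fin d → ℝ) (r : ℝ) : Set (Fin d → ℝ) :=
  {x | alphaNorm α x = r}

/-- The space `ℝ^d ∖ {0}`. -/
abbrev Punctured (d : ℕ) : Type := {x : Fin d → ℝ // x ≠ 0}

/-- The bounded continuous function `f` is supported away from zero. -/
def SupportedAwayFromZero (α : Fin d → ℝ) (f : (Fin d → ℝ) →ᵇ ℝ) : Prop :=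
  ∃ r : ℝ, 0 < r ∧ tsupport f ⊆ (alphaBall α r)ᶜ

/-- A law on `ℝ` is arithmetic if it is carried by `aℤ` for some `a > 0`. -/
def IsArithmetic (μ : Measure ℝ) : Prop :=
  ∃ a : ℝ, 0 < a ∧ μ ((AddSubgroup.zmultiples a : Set ℝ)ᶜ) = 0

variable {Ω : Type*} [MeasurableSpace Ω]

/-- The law of `log |Y|` conditioned on `Y ≠ 0`. -/
def condLogLaw (P : Measure Ω) (Y : Ω → ℝ) : Measure ℝ :=
  (cond P {ω | Y ω ≠ 0}).map (fun ω => Real.log |Y ω|)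

/-- The measure `m_t(U) = P(δ_{|X|_α^{-1}} X ∈ U | |X|_α > t)`, for Borel `U ⊆ S^{d-1}`. -/
def angularLaw (P : Measure Ω) (α : Fin d → ℝ) (X : Ω → Fin d → ℝ) (t : ℝ) :
    Measure (alphaSphere α 1) :=
  ((cond P {ω | t < alphaNorm α (X ω)}).map
    (fun ω => dilation α (alphaNorm α (X ω))⁻¹ (X ω))).comap Subtype.val

end DiagonalSRE

end

/-! Let W be the common value of |A_j|^{α_j}. Multiplication by A is the dilation δ_W composed with
a change of signs, so |Ax|_α = W|x|_α and A acts through the abelian group ℝ × (ℤ/2)^d. For f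
vanishing near 0, conditioning on A shows that G(s,e) = e^s E f(δ_{e^{-s}} eX) solves a renewal
equation G = μ * G + ψ on this group (`HomogeneousSRE.renewal_equation`). Here μ is the law of (log
W, sign A) under W dP, a probability measure because E W = 1, and ψ is the error made by dropping B.
Strict convexity gives positive drift E[W log W] > 0.

The renewal theorem `exists_tendsto_of_renewal` is obtained from asymptotic periods. If a lies in
the support of μ, a maximum principle applied to the increments of G shows G(z + a) - G(z) → 0
(`tendsto_increment_of_mem_support`). The asymptotic periods form a subgroup; non-arithmeticity and
finiteness of the sign group put all of ℝ × {0} into it, so G is slowly varying. On the line,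
integrating the renewal equation then identifies the limit (`exists_tendsto_of_renewal_real`).

Three facts make this applicable. The error ψ is dominated by a summable step function
(`HomogeneousSRE.exists_defect_le`); this rests on the subadditivity of |·|_α^p for small p and on
the finiteness of E|B|_α^p max(W|X|_α, |B|_α)^{1-p}. The solution G is bounded
(`HomogeneousSRE.exists_tail_bound`): the moments of |X|_α of order below 1 give exponential growth
at worst, and a contracting Laplace transform of μ improves this to boundedness. Finally G is
uniformly continuous in s for Lipschitz f of compact support.

Mollification and truncation extend convergence to all admissible f, and the Riesz representation
theorem yields Λ. Scaling u makes Λ homogeneous under dilations, which forces a product structure in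
the coordinates (angle, 1/|x|_α) (`HasScaledLimits.map_polar`). Spheres are therefore Λ-null, so
indicators of {|x|_α > 1} may be used as test functions; this gives the tail constant and the
angular limit law. -/

noncomputable section
namespace DiagonalSRE

/-! ### Asymptotic periods of bounded solutions of renewal equations. -/

section Periods

variable {E : Type*} [AddCommGroup E] [TopologicalSpace E] [IsTopologicalAddGroup E]
  [MeasurableSpace E] [BorelSpace E]

/-- If the increment `g` of a renewal equation is asymptotically maximal along `F'`, it is also
asymptotically maximal along the translate of `F'` by a point of the support. -/
theorem tendsto_shift_of_tendsto_limsup (μ : Measure E) [IsProbabilityMeasure μ] {F F' : Filter E}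
    [F'.IsCountablyGenerated] (hF : ∀ a, Tendsto (fun z => z - a) F F) (hF' : F' ≤ F)
    {g χ : E → ℝ} {C M : ℝ} (hgc : Continuous g) (hgb : ∀ z, |g z| ≤ C)
    (hgu : ∀ ε > 0, ∀ᶠ v in 𝓝 (0 : E), ∀ z, |g (z + v) - g z| ≤ ε)
    (hg : ∀ z, g z = ∫ y, g (z - y) ∂μ + χ z) (hχ : Tendsto χ F (𝓝 0))
    (hM : ∀ ε > 0, ∀ᶠ z in F, g z < M + ε) (hgM : Tendsto g F' (𝓝 M)) {a : E}
    (ha : a ∈ μ.support) : Tendsto (fun z => g (z - a)) F' (𝓝 M) := by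
  have hinteg : ∀ z, Integrable (fun y => g (z - y)) μ := fun z =>
    Integrable.of_bound (Continuous.aestronglyMeasurable (by fun_prop)) C (ae_of_all _ fun y => by simpa using hgb (z - y))
  -- Maximum principle: the average of g(z - y) tends to its asymptotic upper bound M, and the
  -- excess over M disappears by dominated convergence; hence the deficit below M also disappears in
  -- mean.
  have hpos : Tendsto (fun z => ∫ y, max (g (z - y) - M) 0 ∂μ) F' (𝓝 (∫ _, (0 : ℝ) ∂μ)) := by
    refine tendsto_integral_filter_of_dominated_convergence (fun _ => C + |M|)
      (Eventually.of_forall fun z => Continuous.aestronglyMeasurable (by fun_prop)) ?_ (integrable_const _) ?_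
    · refine Eventually.of_forall fun z => ae_of_all _ fun y => ?_
      rw [Real.norm_of_nonneg (le_max_right _ _)]
      have := abs_le.1 (hgb (z - y))
      have hC : 0 ≤ C := (abs_nonneg _).trans (hgb 0)
      refine max_le ?_ (by positivity)
      linarith [neg_abs_le M]
    · refine ae_of_all _ fun y => ?_
      rw [Metric.tendsto_nhds]
      intro ε hε
      filter_upwards [hF' ((hF y).eventually (hM ε hε))] with z hz
      rw [Real.dist_eq, sub_zero, abs_of_nonneg (le_max_right _ _)]
      exact max_lt (by linarith) hε
  have hneg : Tendsto (fun z => ∫ y, max (M - g (z - y)) 0 ∂μ) F' (𝓝 0) := by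
    have h1 : ∀ z, ∫ y, max (M - g (z - y)) 0 ∂μ
        = (M - (g z - χ z)) + ∫ y, max (g (z - y) - M) 0 ∂μ := by
      intro z
      have i1 : Integrable (fun y => M - g (z - y)) μ := (integrable_const _).sub (hinteg z)
      have i2 : Integrable (fun y => max (g (z - y) - M) 0) μ :=
        ((hinteg z).sub (integrable_const _)).sup (integrable_const 0)
      have h2 : M - (g z - χ z) = ∫ y, (M - g (z - y)) ∂μ := by
        rw [integral_sub (integrable_const _) (hinteg z)]
        simp [hg z]
      rw [h2, ← integral_add i1 i2]
      congr 1 with y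
      rcases le_total (g (z - y)) M with h | h
      · rw [max_eq_left (by linarith), max_eq_right (by linarith)]; ring
      · rw [max_eq_right (by linarith), max_eq_left (by linarith)]; ring
    simp_rw [h1]
    have := ((tendsto_const_nhds (x := M)).sub (hgM.sub (hχ.mono_left hF'))).add hpos
    simpa using this
  rw [tendsto_order]
  constructor
  · intro b hb
    obtain ⟨ε, hε, rfl⟩ : ∃ ε, 0 < ε ∧ b = M - ε := ⟨M - b, by linarith, by ring⟩
    -- A deficit ε at z - a would, by uniform continuity, persist as a deficit ε/2 at z - y for all
    -- y near a, a set of positive mass because a is in the support.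
    set B : Set E := {y | ∀ z, |g (z + (a - y)) - g z| ≤ ε / 2} with hB
    have hBn : B ∈ 𝓝 a := by
      have : Tendsto (fun y => a - y) (𝓝 a) (𝓝 0) := by
        have h : Continuous fun y : E => a - y := by fun_prop
        simpa using h.tendsto a
      exact this.eventually (hgu (ε / 2) (by positivity))
    obtain ⟨B', hB'B, hB'o, haB'⟩ := mem_nhds_iff.1 hBn
    have hμB : 0 < μ.real B' := by
      rw [Measure.real, ENNReal.toReal_pos_iff]
      exact ⟨(Measure.mem_support_iff_forall a).1 ha B' (hB'o.mem_nhds haB'), measure_lt_top _ _⟩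
    filter_upwards [hneg.eventually (gt_mem_nhds (show 0 < ε / 2 * μ.real B' by positivity))]
      with z hz
    by_contra! hcon
    have i2 : Integrable (fun y => max (M - g (z - y)) 0) μ :=
        ((integrable_const _).sub (hinteg z)).sup (integrable_const 0)
    have : ε / 2 * μ.real B' ≤ ∫ y, max (M - g (z - y)) 0 ∂μ := by
      calc ε / 2 * μ.real B' = ∫ y in B', ε / 2 ∂μ := by
            rw [setIntegral_const, smul_eq_mul, mul_comm]
        _ ≤ ∫ y in B', max (M - g (z - y)) 0 ∂μ := by
            refine setIntegral_mono_on (integrable_const _).integrableOn i2.integrableOn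
              hB'o.measurableSet fun y hy => le_max_of_le_left ?_
            have := abs_le.1 (hB'B hy (z - a))
            rw [show z - a + (a - y) = z - y by abel] at this
            linarith
        _ ≤ _ := setIntegral_le_integral i2 (ae_of_all _ fun y => le_max_right _ _)
    linarith
  · intro b hb
    filter_upwards [hF' ((hF a).eventually (hM (b - M) (by linarith)))] with z hz
    linarith

/-- One-sided asymptotic periodicity of bounded solutions of renewal equations. -/
theorem eventually_increment_lt (μ : Measure E) [IsProbabilityMeasure μ] {F : Filter E}
    [F.NeBot] [F.IsCountablyGenerated] (hF : ∀ a, Tendsto (fun z => z - a) F F)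
    {G ψ : E → ℝ} {C : ℝ} (hGc : Continuous G) (hGb : ∀ z, |G z| ≤ C)
    (hGu : ∀ ε > 0, ∀ᶠ v in 𝓝 (0 : E), ∀ z, |G (z + v) - G z| ≤ ε)
    (hG : ∀ z, G z = ∫ y, G (z - y) ∂μ + ψ z) (hψ : Tendsto ψ F (𝓝 0)) {a : E}
    (ha : a ∈ μ.support) {ε : ℝ} (hε : 0 < ε) : ∀ᶠ z in F, G (z + a) - G z < ε := by
  set g : E → ℝ := fun z => G (z + a) - G z with hgdef
  have hgb : ∀ z, |g z| ≤ 2 * C := fun z => by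
    have := abs_le.1 (hGb (z + a)); have := abs_le.1 (hGb z)
    simp only [hgdef]; exact abs_le.2 ⟨by linarith, by linarith⟩
  have hgc : Continuous g := by fun_prop
  have hgu : ∀ ε > 0, ∀ᶠ v in 𝓝 (0 : E), ∀ z, |g (z + v) - g z| ≤ ε := by
    intro ε hε
    filter_upwards [hGu (ε / 2) (by positivity)] with v hv z
    have h1 := abs_le.1 (hv (z + a)); have h2 := abs_le.1 (hv z)
    rw [show z + a + v = z + v + a by abel] at h1
    exact abs_le.2 ⟨by simp only [hgdef]; linarith, by simp only [hgdef]; linarith⟩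
  have hinteg : ∀ z, Integrable (fun y => G (z - y)) μ := fun z =>
    Integrable.of_bound (Continuous.aestronglyMeasurable (by fun_prop)) C (ae_of_all _ fun y => by simpa using hGb (z - y))
  have hg : ∀ z, g z = ∫ y, g (z - y) ∂μ + (ψ (z + a) - ψ z) := by
    intro z
    have : ∫ y, g (z - y) ∂μ = ∫ y, G (z + a - y) ∂μ - ∫ y, G (z - y) ∂μ := by
      rw [← integral_sub (hinteg _) (hinteg _)]
      congr 1 with y
      simp only [hgdef, show z - y + a = z + a - y by abel]
    rw [this]
    simp only [hgdef]
    rw [hG (z + a), hG z]; ring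
  have hχ : Tendsto (fun z => ψ (z + a) - ψ z) F (𝓝 0) := by
    have h1 : Tendsto (fun z => ψ (z + a)) F (𝓝 0) := by
      have := hψ.comp (hF (-a))
      simpa [Function.comp_def] using this
    simpa using h1.sub hψ
  have hbdd : F.IsBoundedUnder (· ≤ ·) g := isBoundedUnder_of ⟨2 * C, fun z => (abs_le.1 (hgb z)).2⟩
  have hbdd' : F.IsBoundedUnder (· ≥ ·) g :=
    isBoundedUnder_of ⟨-(2 * C), fun z => (abs_le.1 (hgb z)).1⟩
  set M := limsup g F with hM
  have hMub : ∀ ε > 0, ∀ᶠ z in F, g z < M + ε := fun ε hε =>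
    eventually_lt_of_limsup_lt (by linarith) hbdd
  suffices hM0 : M ≤ 0 by
    filter_upwards [hMub ε hε] with z hz
    linarith
  have hfreq : ∀ ε > 0, ∃ᶠ z in F, M - ε < g z := fun ε hε =>
    frequently_lt_of_lt_limsup hbdd'.isCoboundedUnder_le (by linarith)
  -- The limsup is a cluster value, so the part of F along which g tends to M is a proper filter.
  have hne : (F ⊓ comap g (𝓝 M)).NeBot := by
    rw [inf_neBot_iff_frequently_right]
    intro p hp
    obtain ⟨t, ht, htp⟩ := mem_comap.1 hp
    obtain ⟨ε, hε, hεt⟩ := Metric.mem_nhds_iff.1 ht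
    refine ((hfreq ε hε).and_eventually (hMub ε hε)).mono fun z hz => htp (hεt ?_)
    rw [Metric.mem_ball, Real.dist_eq, abs_lt]
    constructor <;> linarith [hz.1, hz.2]
  set F' := F ⊓ comap g (𝓝 M) with hF'def
  have hkey : ∀ k : ℕ, Tendsto (fun z => g (z - k • a)) F' (𝓝 M) := by
    intro k
    induction k with
    | zero => simpa using tendsto_comap.mono_left (inf_le_right : F' ≤ _)
    | succ k ih =>
      -- The shift lemma is applied to the translated filter, which still refines F and along which
      -- g still tends to M.
      have h1 : map (fun z => z - k • a) F' ≤ F := (hF (k • a)).mono_left inf_le_left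
      have := tendsto_shift_of_tendsto_limsup μ hF h1 hgc hgb hgu hg hχ hMub
        (tendsto_map'_iff.2 ih) ha
      rw [tendsto_map'_iff] at this
      refine this.congr fun z => ?_
      simp only [Function.comp_apply]
      rw [succ_nsmul]
      congr 1; abel
  -- If M > 0, then K consecutive increments of G, each close to M, telescope to more than the total
  -- oscillation 2C.
  by_contra! hMpos
  obtain ⟨K, hK⟩ := exists_nat_gt (2 * C / M)
  rw [div_lt_iff₀ hMpos] at hK
  have hsum : Tendsto (fun z => ∑ k ∈ Finset.range K, g (z - k • a)) F' (𝓝 (K * M)) := by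
    have := tendsto_finsetSum (Finset.range K) fun k _ => hkey k
    simpa using this
  have htel : ∀ z, ∑ k ∈ Finset.range K, g (z - k • a) ≤ 2 * C := by
    intro z
    have : ∀ k : ℕ, g (z - k • a) = (fun k : ℕ => -G (z + a - k • a)) (k + 1)
        - (fun k : ℕ => -G (z + a - k • a)) k := by
      intro k
      simp only [hgdef, succ_nsmul]
      rw [show z + a - (k • a + a) = z - k • a by abel,
        show z - k • a + a = z + a - k • a by abel]
      ring
    simp_rw [this]
    rw [Finset.sum_range_sub (fun k : ℕ => -G (z + a - k • a))]
    have h1 := abs_le.1 (hGb (z + a - K • a)); have h2 := abs_le.1 (hGb (z + a - 0 • a))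
    linarith
  have := le_of_tendsto hsum (Eventually.of_forall htel)
  linarith

/-- **Asymptotic periodicity** of bounded uniformly continuous solutions of the renewal equation
`G = μ * G + ψ`: the points of the support of `μ` are asymptotic periods of `G`. -/
theorem tendsto_increment_of_mem_support (μ : Measure E) [IsProbabilityMeasure μ] {F : Filter E}
    [F.NeBot] [F.IsCountablyGenerated] (hF : ∀ a, Tendsto (fun z => z - a) F F)
    {G ψ : E → ℝ} {C : ℝ} (hGc : Continuous G) (hGb : ∀ z, |G z| ≤ C)
    (hGu : ∀ ε > 0, ∀ᶠ v in 𝓝 (0 : E), ∀ z, |G (z + v) - G z| ≤ ε)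
    (hG : ∀ z, G z = ∫ y, G (z - y) ∂μ + ψ z) (hψ : Tendsto ψ F (𝓝 0)) {a : E}
    (ha : a ∈ μ.support) : Tendsto (fun z => G (z + a) - G z) F (𝓝 0) := by
  rw [tendsto_order]
  constructor
  · intro b hb
    have := eventually_increment_lt μ hF (G := fun z => -G z) (ψ := fun z => -ψ z) (C := C)
      hGc.neg (fun z => by simpa using hGb z)
      (fun ε hε => (hGu ε hε).mono fun v hv z => by
        have := hv z
        rwa [show -G (z + v) - -G z = -(G (z + v) - G z) by ring, abs_neg])
      (fun z => by rw [integral_neg, hG z]; ring) (by simpa using hψ.neg) ha (neg_pos.2 hb)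
    filter_upwards [this] with z hz
    linarith
  · intro b hb
    exact eventually_increment_lt μ hF hGc hGb hGu hG hψ ha hb

end Periods

/-! ### The renewal theorem on the line for slowly varying solutions. -/

section Scalar

/-- A slowly varying bounded solution of the renewal equation on the line converges. -/
theorem exists_tendsto_of_renewal_real (μ : Measure ℝ) [IsProbabilityMeasure μ]
    (hinteg : Integrable (fun y : ℝ => y) μ) (hm : ∫ y, y ∂μ ≠ 0) {G ψ : ℝ → ℝ} {C : ℝ}
    (hGc : Continuous G) (hGb : ∀ s, |G s| ≤ C) (hG : ∀ s, G s = ∫ y, G (s - y) ∂μ + ψ s)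
    (hψ : IntegrableOn ψ (Ioi 0))
    (hslow : ∀ y, Tendsto (fun s => G (s - y) - G s) atTop (𝓝 0)) :
    ∃ l, Tendsto G atTop (𝓝 l) := by
  have hii : ∀ a b, IntervalIntegrable G volume a b := fun a b => hGc.intervalIntegrable a b
  have hbound : ∀ s y, |∫ v in (s - y)..s, G v| ≤ C * |y| := by
    intro s y
    have := intervalIntegral.norm_integral_le_of_norm_le_const (a := s - y) (b := s) (f := G)
      (C := C) fun x _ => by simpa using hGb x
    simpa using this
  have hmeasI : ∀ s, Continuous fun y => ∫ v in (s - y)..s, G v := by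
    intro s
    have h1 : Continuous fun b => ∫ v in s..b, G v := intervalIntegral.continuous_primitive hii s
    have h2 : (fun y => ∫ v in (s - y)..s, G v) = fun y => -∫ v in s..(s - y), G v := by
      ext y; rw [intervalIntegral.integral_symm]
    rw [h2]
    exact (h1.comp (by fun_prop : Continuous fun y => s - y)).neg
  have hIint : ∀ s, Integrable (fun y => ∫ v in (s - y)..s, G v) μ := fun s =>
    (hinteg.norm.const_mul C).mono' (hmeasI s).aestronglyMeasurable
      (ae_of_all _ fun y => by simpa using hbound s y)
  -- Formally H' = G - μ * G = ψ, so H converges because ψ is integrable. Slow variation lets G(s)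
  -- replace G on [s - y, s], so H(s) is asymptotically G(s) times the drift.
  set H : ℝ → ℝ := fun s => ∫ y, (∫ v in (s - y)..s, G v) ∂μ with hH
  have hHdiff : ∀ s, 0 ≤ s → H s = H 0 + ∫ v in (0 : ℝ)..s, ψ v := by
    intro s hs
    have e1 : ∀ v, ψ v = G v - ∫ y, G (v - y) ∂μ := fun v => by rw [hG v]; ring
    have c2 : Continuous fun v => ∫ y, G (v - y) ∂μ := by
      refine continuous_of_dominated (bound := fun _ => C) (fun v => by fun_prop)
        (fun v => ae_of_all _ fun y => by simpa using hGb (v - y)) (integrable_const _)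
        (ae_of_all _ fun y => by fun_prop)
    have e2 : ∫ v in (0 : ℝ)..s, ψ v
        = (∫ v in (0 : ℝ)..s, G v) - ∫ v in (0 : ℝ)..s, ∫ y, G (v - y) ∂μ := by
      simp_rw [e1]
      exact intervalIntegral.integral_sub (hii _ _) (c2.intervalIntegrable _ _)
    have e3 : ∫ v in (0 : ℝ)..s, ∫ y, G (v - y) ∂μ
        = ∫ y, (∫ v in (0 : ℝ)..s, G (v - y)) ∂μ := by
      simp only [intervalIntegral.integral_of_le hs]
      refine integral_integral_swap ?_
      refine Integrable.of_bound (by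
        apply Continuous.aestronglyMeasurable; simp only [Function.uncurry_def]; fun_prop) C
        (ae_of_all _ fun z => by simpa [Function.uncurry_def] using hGb (z.1 - z.2))
    have e4 : ∀ y, ∫ v in (0 : ℝ)..s, G (v - y) = (∫ v in (0 : ℝ)..s, G v)
        - (∫ v in (s - y)..s, G v) + ∫ v in (0 - y)..0, G v := by
      intro y
      rw [intervalIntegral.integral_comp_sub_right (fun v => G v) y]
      have h1 := intervalIntegral.integral_add_adjacent_intervals (hii (0 - y) 0) (hii 0 s)
      have h2 := intervalIntegral.integral_add_adjacent_intervals (hii (0 - y) (s - y))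
        (hii (s - y) s)
      linarith
    rw [e2, e3]
    simp_rw [e4]
    have i1 : Integrable (fun y => (∫ v in (0 : ℝ)..s, G v) - ∫ v in (s - y)..s, G v) μ :=
      (integrable_const _).sub (hIint s)
    rw [integral_add i1 (hIint 0), integral_sub (integrable_const _) (hIint s)]
    simp only [hH, integral_const, probReal_univ, one_smul]
    ring
  have hHlim : Tendsto H atTop (𝓝 (H 0 + ∫ v in Ioi (0 : ℝ), ψ v)) := by
    have h1 := (intervalIntegral_tendsto_integral_Ioi 0 hψ tendsto_id).const_add (H 0)
    refine h1.congr' ?_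
    filter_upwards [eventually_ge_atTop 0] with s hs using (hHdiff s hs).symm
  have hdiff : Tendsto (fun s => H s - (∫ y, y ∂μ) * G s) atTop (𝓝 0) := by
    have e : ∀ s, H s - (∫ y, y ∂μ) * G s = ∫ y, ((∫ v in (s - y)..s, G v) - y * G s) ∂μ := by
      intro s
      rw [integral_sub (hIint s) (hinteg.mul_const _), integral_mul_const]
    simp_rw [e]
    rw [← integral_zero ℝ ℝ (μ := μ)]
    refine tendsto_integral_filter_of_dominated_convergence (fun y => C * |y| + |y| * C)
      (Eventually.of_forall fun s => ?_) (Eventually.of_forall fun s => ae_of_all _ fun y => ?_)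
      ((hinteg.norm.const_mul C).add (hinteg.norm.mul_const C)) (ae_of_all _ fun y => ?_)
    · exact ((hmeasI s).sub (by fun_prop)).aestronglyMeasurable
    · refine (norm_sub_le _ _).trans (add_le_add (hbound s y) ?_)
      rw [norm_mul]
      exact mul_le_mul_of_nonneg_left (hGb s) (norm_nonneg _)
    · have e' : ∀ s, (∫ v in (s - y)..s, G v) - y * G s
          = ∫ v in (0 : ℝ)..y, (G (s - v) - G s) := by
        intro s
        have c1 : Continuous fun v => G (s - v) := by fun_prop
        rw [intervalIntegral.integral_sub (c1.intervalIntegrable _ _) (by simp),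
          intervalIntegral.integral_comp_sub_left (fun v => G v) s]
        simp
      simp_rw [e']
      have := intervalIntegral.tendsto_integral_filter_of_dominated_convergence
        (μ := volume) (a := 0) (b := y) (l := atTop)
        (F := fun s v => G (s - v) - G s) (f := fun _ => 0) (fun _ => 2 * C)
        (Eventually.of_forall fun s => by
          apply Continuous.aestronglyMeasurable; fun_prop)
        (Eventually.of_forall fun s => ae_of_all _ fun v _ => by
          have h1 := abs_le.1 (hGb (s - v)); have h2 := abs_le.1 (hGb s)
          exact abs_le.2 ⟨by linarith, by linarith⟩)
        (by simp) (ae_of_all _ fun v _ => hslow v)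
      simpa using this
  refine ⟨(H 0 + ∫ v in Ioi (0 : ℝ), ψ v) / ∫ y, y ∂μ, ?_⟩
  have h := (hHlim.sub hdiff).div_const (∫ y, y ∂μ)
  refine (h.congr fun s => ?_).trans (by simp)
  field_simp
  ring

end Scalar

/-! ### The renewal theorem on the product of the line and a finite group. -/

section Product

variable {Γ : Type*} [AddCommGroup Γ]

theorem tendsto_sub_comap_fst (a : ℝ × Γ) :
    Tendsto (fun z => z - a) (comap Prod.fst atTop) (comap Prod.fst (atTop : Filter ℝ)) := by
  rw [tendsto_comap_iff]
  have : Tendsto (fun z : ℝ × Γ => z.1 + -a.1) (comap Prod.fst atTop) atTop :=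
    tendsto_atTop_add_const_right _ _ tendsto_comap
  exact this.congr fun z => by simp [sub_eq_add_neg]

/-- The subgroup of asymptotic periods of a function on `ℝ × Γ`. -/
def asymptoticPeriods (G : ℝ × Γ → ℝ) : AddSubgroup (ℝ × Γ) where
  carrier := {a | Tendsto (fun z => G (z + a) - G z) (comap Prod.fst atTop) (𝓝 0)}
  zero_mem' := by simp
  add_mem' := by
    intro a b ha hb
    have h1 := ha.comp (tendsto_sub_comap_fst (-b))
    have h2 := h1.add hb
    simp only [add_zero] at h2
    refine h2.congr fun z => ?_
    simp only [Function.comp_apply, sub_neg_eq_add]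
    rw [show z + b + a = z + (a + b) by abel]
    ring
  neg_mem' := by
    intro a ha
    have h1 := (ha.comp (tendsto_sub_comap_fst a)).neg
    simp only [neg_zero] at h1
    refine h1.congr fun z => ?_
    simp only [Function.comp_apply, sub_add_cancel]
    rw [sub_eq_add_neg z a]
    ring

theorem mem_asymptoticPeriods {G : ℝ × Γ → ℝ} {a : ℝ × Γ} : a ∈ asymptoticPeriods G ↔
    Tendsto (fun z => G (z + a) - G z) (comap Prod.fst atTop) (𝓝 0) := Iff.rfl

variable [Finite Γ] [TopologicalSpace Γ] [IsTopologicalAddGroup Γ] [DiscreteTopology Γ]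
  [MeasurableSpace Γ] [BorelSpace Γ]

/-- **Renewal theorem** on `ℝ × Γ` for a finite group `Γ`: bounded solutions of the renewal
equation `G = μ * G + ψ` which are uniformly continuous in the first variable converge. -/
theorem exists_tendsto_of_renewal (μ : Measure (ℝ × Γ)) [IsProbabilityMeasure μ]
    (hinteg : Integrable (fun z : ℝ × Γ => z.1) μ) (hm : ∫ z, z.1 ∂μ ≠ 0)
    (hdense : ∀ a : ℝ, ¬ ∀ᵐ z ∂μ, z.1 ∈ AddSubgroup.zmultiples a)
    {G ψ : ℝ × Γ → ℝ} {C : ℝ} (hGb : ∀ z, |G z| ≤ C)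
    (hGu : ∀ ε > 0, ∀ᶠ v in 𝓝 (0 : ℝ), ∀ z : ℝ × Γ, |G (z.1 + v, z.2) - G z| ≤ ε)
    (hG : ∀ z, G z = ∫ y, G (z - y) ∂μ + ψ z)
    (hψ : Tendsto ψ (comap Prod.fst atTop) (𝓝 0))
    (hψi : ∀ e, IntegrableOn (fun s => ψ (s, e)) (Ioi 0)) (e : Γ) :
    ∃ l, Tendsto (fun s => G (s, e)) atTop (𝓝 l) := by
  have hGu' : ∀ ε > 0, ∀ᶠ v in 𝓝 (0 : ℝ × Γ), ∀ z, |G (z + v) - G z| ≤ ε := by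
    intro ε hε
    have h1 : ∀ᶠ v : ℝ × Γ in 𝓝 0, v.2 = 0 :=
      (continuous_snd.tendsto (0 : ℝ × Γ)).eventually ((isOpen_discrete {0}).mem_nhds rfl)
    have h2 : ∀ᶠ v : ℝ × Γ in 𝓝 0, ∀ z : ℝ × Γ, |G (z.1 + v.1, z.2) - G z| ≤ ε :=
      (continuous_fst.tendsto (0 : ℝ × Γ)).eventually (hGu ε hε)
    filter_upwards [h1, h2] with v hv1 hv2 z
    have : z + v = (z.1 + v.1, z.2) := by ext <;> simp [hv1]
    rw [this]
    exact hv2 z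
  have hGc : Continuous G := by
    rw [continuous_iff_continuousAt]
    intro z
    rw [ContinuousAt, Metric.tendsto_nhds]
    intro ε hε
    have h0 : Tendsto (fun x : ℝ × Γ => x - z) (𝓝 z) (𝓝 0) := by
      have h : Continuous fun x : ℝ × Γ => x - z := by fun_prop
      simpa using h.tendsto z
    filter_upwards [h0.eventually (hGu' (ε / 2) (by positivity))] with x hx
    have := hx z
    rw [add_sub_cancel] at this
    rw [Real.dist_eq]
    linarith
  have : (comap Prod.fst (atTop : Filter ℝ) : Filter (ℝ × Γ)).NeBot :=
    Filter.NeBot.comap_of_surj inferInstance Prod.fst_surjective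
  have hper : ∀ a ∈ μ.support, a ∈ asymptoticPeriods G := fun a ha =>
    tendsto_increment_of_mem_support μ tendsto_sub_comap_fst hGc hGb hGu' hG hψ ha
  have hsupp : ∀ᵐ a ∂μ, a ∈ asymptoticPeriods G := by
    filter_upwards [Measure.support_mem_ae (μ := μ)] with a ha using hper a ha
  set n := Nat.card Γ with hn
  have hnpos : 0 < n := Nat.card_pos
  set S : AddSubgroup ℝ := (asymptoticPeriods G).comap (AddMonoidHom.inl ℝ Γ) with hS
  -- Multiplication by the order of Γ kills the finite component of a period.
  have hnS : ∀ a ∈ asymptoticPeriods G, (n : ℝ) * a.1 ∈ S := by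
    intro a ha
    have h1 : n • a ∈ asymptoticPeriods G := (asymptoticPeriods G).nsmul_mem ha n
    have h2 : n • a = AddMonoidHom.inl ℝ Γ ((n : ℝ) * a.1) := by
      ext
      · simp
      · simp [hn]
    rw [h2] at h1
    exact h1
  -- A cyclic S with generator b would confine the first coordinate to (b/n)ℤ almost surely; the
  -- case b = 0 is included in `hdense`.
  have hSdense : Dense (S : Set ℝ) := by
    rcases S.dense_or_cyclic with h | ⟨b, hb⟩
    · exact h
    exfalso
    refine hdense (b / n) ?_
    filter_upwards [hsupp] with a ha
    have := hnS a ha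
    rw [hb, ← AddSubgroup.zmultiples_eq_closure, AddSubgroup.mem_zmultiples_iff] at this
    obtain ⟨k, hk⟩ := this
    rw [AddSubgroup.mem_zmultiples_iff]
    refine ⟨k, ?_⟩
    simp only [zsmul_eq_mul] at hk ⊢
    field_simp
    linarith
  have hSall : ∀ y : ℝ, ((y, 0) : ℝ × Γ) ∈ asymptoticPeriods G := by
    intro y
    rw [mem_asymptoticPeriods, Metric.tendsto_nhds]
    intro ε hε
    have h0 : Tendsto (fun x : ℝ => y - x) (𝓝 y) (𝓝 0) := by
      have h : Continuous fun x : ℝ => y - x := by fun_prop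
      simpa using h.tendsto y
    obtain ⟨y', hy'1, hy'2⟩ := hSdense.exists_mem_open isOpen_interior
      ⟨y, mem_interior_iff_mem_nhds.2 (h0.eventually (hGu (ε / 3) (by positivity)))⟩
    have hy'3 := interior_subset hy'2
    simp only [mem_ofPred_eq] at hy'3
    have hy'S : Tendsto (fun z => G (z + (y', 0)) - G z) (comap Prod.fst atTop) (𝓝 0) := hy'1
    filter_upwards [(Metric.tendsto_nhds.1 hy'S) (ε / 3) (by positivity)] with z hz
    have h3 := hy'3 (z + (y', 0))
    have h4 : ((z + (y', 0)).1 + (y - y'), (z + (y', 0)).2) = z + ((y, 0) : ℝ × Γ) := by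
      ext <;> simp
    rw [h4] at h3
    rw [Real.dist_eq, sub_zero] at hz ⊢
    have h5 := abs_le.1 h3
    have h6 := abs_lt.1 hz
    exact abs_lt.2 ⟨by linarith, by linarith⟩
  -- The second coordinates charged by μ may generate a proper subgroup only. They lie in Γ', so
  -- summing G over a coset of Γ' removes them from the equation and leaves a renewal equation on
  -- the line.
  set Γ' : AddSubgroup Γ := (asymptoticPeriods G).comap (AddMonoidHom.inr ℝ Γ) with hΓ'
  have hsnd : ∀ᵐ a ∂μ, a.2 ∈ Γ' := by
    filter_upwards [hsupp] with a ha
    have h1 := (asymptoticPeriods G).sub_mem ha (hSall a.1)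
    have h2 : a - (a.1, 0) = AddMonoidHom.inr ℝ Γ a.2 := by ext <;> simp
    rw [h2] at h1
    exact h1
  have hline : ∀ e', Tendsto (fun s : ℝ => ((s, e') : ℝ × Γ)) atTop (comap Prod.fst atTop) :=
    fun e' => tendsto_comap_iff.2 tendsto_id
  have := Fintype.ofFinite Γ'
  set Gb : ℝ → ℝ := fun s => ∑ γ : Γ', G (s, e + γ) with hGbdef
  have hGi : ∀ z, Integrable (fun y => G (z - y)) μ := fun z =>
    Integrable.of_bound (Continuous.aestronglyMeasurable (by fun_prop)) C
      (ae_of_all _ fun y => by simpa using hGb (z - y))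
  have hGbc : Continuous Gb := by fun_prop
  have : IsProbabilityMeasure (μ.map Prod.fst) := Measure.isProbabilityMeasure_map (by fun_prop)
  have hconv : ∃ l, Tendsto Gb atTop (𝓝 l) := by
    refine exists_tendsto_of_renewal_real (μ.map Prod.fst)
      (ψ := fun s => ∑ γ : Γ', ψ (s, e + γ)) (C := ∑ γ : Γ', C) ?_ ?_ hGbc ?_ ?_ ?_ ?_
    · rwa [integrable_map_measure (by fun_prop) (by fun_prop)]
    · rwa [integral_map (by fun_prop) (by fun_prop)]
    · intro s
      exact (Finset.abs_sum_le_sum_abs _ _).trans (Finset.sum_le_sum fun γ _ => hGb _)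
    · intro s
      rw [integral_map (by fun_prop) (Continuous.aestronglyMeasurable (by fun_prop))]
      simp only [hGbdef]
      have h1 : ∫ z, ∑ γ : Γ', G (s - z.1, e + γ) ∂μ
          = ∫ z, ∑ γ : Γ', G ((s, e + γ) - z) ∂μ := by
        refine integral_congr_ae ?_
        filter_upwards [hsnd] with z hz
        refine Fintype.sum_equiv (Equiv.addRight ⟨z.2, hz⟩) _ _ fun γ => ?_
        congr 1
        ext
        · simp
        · simp only [Equiv.coe_addRight, AddSubgroup.coe_add, Prod.snd_sub]
          abel
      rw [h1, integral_finsetSum _ fun γ _ => hGi _, ← Finset.sum_add_distrib]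
      exact Finset.sum_congr rfl fun γ _ => hG _
    · exact integrable_finsetSum _ fun γ _ => hψi _
    · intro y
      have h1 : ∀ γ : Γ', Tendsto (fun s => G (s - y, e + γ) - G (s, e + γ)) atTop (𝓝 0) := by
        intro γ
        have := (mem_asymptoticPeriods.1 (hSall (-y))).comp (hline (e + γ))
        refine this.congr fun s => ?_
        simp [sub_eq_add_neg]
      have h2 := tendsto_finsetSum Finset.univ fun γ _ => h1 γ
      simpa [hGbdef] using h2
  obtain ⟨l, hl⟩ := hconv
  have hdiff : Tendsto (fun s => Gb s - Fintype.card Γ' * G (s, e)) atTop (𝓝 0) := by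
    have h1 : ∀ γ : Γ', Tendsto (fun s => G (s, e + γ) - G (s, e)) atTop (𝓝 0) := by
      intro γ
      have h := mem_asymptoticPeriods.1 (AddSubgroup.mem_comap.1 γ.2)
      refine (h.comp (hline e)).congr fun s => ?_
      simp
    have h2 := tendsto_finsetSum Finset.univ fun γ _ => h1 γ
    simpa [hGbdef] using h2
  refine ⟨l / Fintype.card Γ', ?_⟩
  have hc : (Fintype.card Γ' : ℝ) ≠ 0 := by exact_mod_cast Fintype.card_ne_zero
  have h := (hl.sub hdiff).div_const (Fintype.card Γ' : ℝ)
  rw [sub_zero] at h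
  refine h.congr fun s => ?_
  field_simp
  ring

end Product

end DiagonalSRE
end

noncomputable section
namespace DiagonalSRE

/-! ### Boundedness of subsolutions of renewal equations. -/

section APriori

open scoped ENNReal

/-- The partial sums `∑_{k < n} μ^{*k} * g` of the renewal series. -/
def renewalSum (μ : Measure ℝ) (g : ℝ → ℝ≥0∞) : ℕ → ℝ → ℝ≥0∞
  | 0 => 0
  | n + 1 => fun s => g s + ∫⁻ y, renewalSum μ g n (s - y) ∂μ

variable {μ : Measure ℝ}

theorem measurable_renewalSum [SFinite μ] {g : ℝ → ℝ≥0∞} (hg : Measurable g) (n : ℕ) :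
    Measurable (renewalSum μ g n) := by
  induction n with
  | zero => exact measurable_const
  | succ n ih =>
    refine hg.add ?_
    exact Measurable.lintegral_prod_right' (f := fun z : ℝ × ℝ => renewalSum μ g n (z.1 - z.2))
      (ih.comp (by fun_prop))

theorem lintegral_exp_sub (μ : Measure ℝ) (η a s : ℝ) :
    ∫⁻ y, ENNReal.ofReal (Real.exp (η * (s - y - a))) ∂μ
      = (∫⁻ y, ENNReal.ofReal (Real.exp (-η * y)) ∂μ) * ENNReal.ofReal (Real.exp (η * (s - a))) := by
  rw [← lintegral_mul_const _ (by fun_prop)]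
  congr 1 with y
  rw [← ENNReal.ofReal_mul (Real.exp_pos _).le, ← Real.exp_add]
  ring_nf

/-- The exponential on the right is a supersolution: averaging over the shift by y multiplies it by
ρ < 1, and (1 - ρ)⁻¹ = 1 + ρ(1 - ρ)⁻¹ leaves room for the indicator, which is below e^{η(s-a)} since
s ≥ a on the interval. -/
theorem renewalSum_indicator_le_exp {η : ℝ} (hη : 0 ≤ η)
    (hρ : ∫⁻ y, ENNReal.ofReal (Real.exp (-η * y)) ∂μ < 1) (a : ℝ) (n : ℕ) (s : ℝ) :
    renewalSum μ ((Ico a (a + 1)).indicator 1) n s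
      ≤ (1 - ∫⁻ y, ENNReal.ofReal (Real.exp (-η * y)) ∂μ)⁻¹
        * ENNReal.ofReal (Real.exp (η * (s - a))) := by
  set ρ := ∫⁻ y, ENNReal.ofReal (Real.exp (-η * y)) ∂μ with hρdef
  have hc : (1 : ℝ≥0∞) + ρ * (1 - ρ)⁻¹ = (1 - ρ)⁻¹ := by
    have h1 : (1 - ρ) * (1 - ρ)⁻¹ = 1 := ENNReal.mul_inv_cancel (tsub_pos_of_lt hρ).ne'
      (ne_top_of_le_ne_top ENNReal.one_ne_top tsub_le_self)
    nth_rewrite 1 [← h1]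
    rw [← add_mul, tsub_add_cancel_of_le hρ.le, one_mul]
  induction n generalizing s with
  | zero => simp [renewalSum]
  | succ n ih =>
    have h1 : (Ico a (a + 1)).indicator (1 : ℝ → ℝ≥0∞) s
        ≤ ENNReal.ofReal (Real.exp (η * (s - a))) := by
      by_cases hs : s ∈ Ico a (a + 1)
      · rw [indicator_of_mem hs, Pi.one_apply, ENNReal.one_le_ofReal]
        exact Real.one_le_exp (mul_nonneg hη (by linarith [hs.1]))
      · rw [indicator_of_notMem hs]; exact zero_le
    calc renewalSum μ ((Ico a (a + 1)).indicator 1) (n + 1) s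
        ≤ ENNReal.ofReal (Real.exp (η * (s - a)))
          + ∫⁻ y, (1 - ρ)⁻¹ * ENNReal.ofReal (Real.exp (η * (s - y - a))) ∂μ :=
          add_le_add h1 (lintegral_mono fun y => ih _)
      _ = (1 + ρ * (1 - ρ)⁻¹) * ENNReal.ofReal (Real.exp (η * (s - a))) := by
          rw [lintegral_const_mul _ (by fun_prop), lintegral_exp_sub]
          ring
      _ = _ := by rw [hc]

/-- Maximum principle for the renewal function: inside the interval the exponential bound is at most
its value at the right end, and outside it the sum is an average of earlier sums. The bound is
uniform in `a`, which allows summation over unit intervals. -/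
theorem renewalSum_indicator_le [IsProbabilityMeasure μ] {η : ℝ} (hη : 0 ≤ η)
    (hρ : ∫⁻ y, ENNReal.ofReal (Real.exp (-η * y)) ∂μ < 1) (a : ℝ) (n : ℕ) (s : ℝ) :
    renewalSum μ ((Ico a (a + 1)).indicator 1) n s
      ≤ (1 - ∫⁻ y, ENNReal.ofReal (Real.exp (-η * y)) ∂μ)⁻¹ * ENNReal.ofReal (Real.exp η) := by
  induction n generalizing s with
  | zero => simp [renewalSum]
  | succ n ih =>
    by_cases hs : s ∈ Ico a (a + 1)
    · refine (renewalSum_indicator_le_exp hη hρ a (n + 1) s).trans ?_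
      gcongr
      nlinarith [hs.2]
    · simp only [renewalSum, indicator_of_notMem hs, zero_add]
      calc _ ≤ ∫⁻ _, (1 - ∫⁻ y, ENNReal.ofReal (Real.exp (-η * y)) ∂μ)⁻¹
            * ENNReal.ofReal (Real.exp η) ∂μ := lintegral_mono fun y => ih _
        _ = _ := by simp

theorem renewalSum_tsum [SFinite μ] {ι : Type*} [Countable ι] {b : ι → ℝ≥0∞}
    {h : ι → ℝ → ℝ≥0∞} (hh : ∀ i, Measurable (h i)) (n : ℕ) (s : ℝ) :
    renewalSum μ (fun s => ∑' i, b i * h i s) n s = ∑' i, b i * renewalSum μ (h i) n s := by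
  induction n generalizing s with
  | zero => simp [renewalSum]
  | succ n ih =>
    simp only [renewalSum, ih, mul_add]
    have hm : ∀ i, Measurable fun y => renewalSum μ (h i) n (s - y) := fun i =>
      (measurable_renewalSum (hh i) n).comp (by fun_prop)
    rw [lintegral_tsum fun i => ((hm i).const_mul _).aemeasurable, ENNReal.tsum_add]
    congr 2 with i
    rw [lintegral_const_mul _ (hm i)]

/-- Iteration of the inequality; the growth condition makes the remainder decay like the n-th power
of the Laplace transform. -/
theorem le_renewalSum_add [SFinite μ] {η : ℝ} {G ψ : ℝ → ℝ≥0∞} {K : ℝ≥0∞}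
    (hK : ∀ s, G s ≤ K * ENNReal.ofReal (Real.exp (η * s)))
    (hG : ∀ s, G s ≤ ∫⁻ y, G (s - y) ∂μ + ψ s) (n : ℕ) (s : ℝ) :
    G s ≤ renewalSum μ ψ n s + K * (∫⁻ y, ENNReal.ofReal (Real.exp (-η * y)) ∂μ) ^ n
      * ENNReal.ofReal (Real.exp (η * s)) := by
  induction n generalizing s with
  | zero => simpa [renewalSum] using hK s
  | succ n ih =>
    calc G s ≤ ∫⁻ y, G (s - y) ∂μ + ψ s := hG s
      _ ≤ ∫⁻ y, (renewalSum μ ψ n (s - y)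
          + K * (∫⁻ y, ENNReal.ofReal (Real.exp (-η * y)) ∂μ) ^ n
            * ENNReal.ofReal (Real.exp (η * (s - y)))) ∂μ + ψ s := by
          gcongr with y; exact ih _
      _ = _ := by
          have := lintegral_exp_sub μ η 0 s
          simp only [sub_zero] at this
          rw [lintegral_add_right _ (by fun_prop), lintegral_const_mul _ (by fun_prop), this,
            renewalSum]
          ring

theorem apply_floor_eq_tsum (b : ℤ → ℝ≥0∞) (s : ℝ) :
    b ⌊s⌋ = ∑' i : ℤ, b i * (Ico (i : ℝ) (i + 1)).indicator 1 s := by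
  rw [tsum_eq_single ⌊s⌋]
  · have hs : s ∈ Ico (⌊s⌋ : ℝ) (⌊s⌋ + 1) := ⟨Int.floor_le s, Int.lt_floor_add_one s⟩
    rw [indicator_of_mem hs, Pi.one_apply, mul_one]
  · intro i hi
    rw [indicator_of_notMem, mul_zero]
    rintro ⟨h1, h2⟩
    exact hi (Int.floor_eq_iff.2 ⟨h1, h2⟩).symm

theorem lintegral_apply_floor (b : ℤ → ℝ≥0∞) : ∫⁻ s : ℝ, b ⌊s⌋ = ∑' i, b i := by
  simp_rw [apply_floor_eq_tsum b]
  rw [lintegral_tsum fun i =>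
    ((measurable_one.indicator measurableSet_Ico).const_mul _).aemeasurable]
  congr 1 with i
  rw [lintegral_const_mul _ (measurable_one.indicator measurableSet_Ico),
    lintegral_indicator_one measurableSet_Ico, Real.volume_Ico]
  simp

/-- A subsolution of a renewal equation of exponential growth is bounded, if the right-hand side
is dominated by a summable step function and the increments have a contracting Laplace transform. -/
theorem exists_forall_le_of_renewal [IsProbabilityMeasure μ] {η : ℝ} (hη : 0 ≤ η)
    (hρ : ∫⁻ y, ENNReal.ofReal (Real.exp (-η * y)) ∂μ < 1) {G : ℝ → ℝ≥0∞} {b : ℤ → ℝ≥0∞}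
    (hb : ∑' i, b i ≠ ∞) {K : ℝ≥0∞} (hKt : K ≠ ∞)
    (hK : ∀ s, G s ≤ K * ENNReal.ofReal (Real.exp (η * s)))
    (hG : ∀ s, G s ≤ ∫⁻ y, G (s - y) ∂μ + b ⌊s⌋) : ∃ C ≠ ∞, ∀ s, G s ≤ C := by
  set ρ := ∫⁻ y, ENNReal.ofReal (Real.exp (-η * y)) ∂μ with hρdef
  simp_rw [apply_floor_eq_tsum b] at hG
  refine ⟨(∑' i, b i) * ((1 - ρ)⁻¹ * ENNReal.ofReal (Real.exp η)), ?_, fun s => ?_⟩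
  · exact ENNReal.mul_ne_top hb (ENNReal.mul_ne_top
      (ENNReal.inv_ne_top.2 (tsub_pos_of_lt hρ).ne') ENNReal.ofReal_ne_top)
  have h1 : ∀ n, G s ≤ (∑' i, b i) * ((1 - ρ)⁻¹ * ENNReal.ofReal (Real.exp η))
      + K * ρ ^ n * ENNReal.ofReal (Real.exp (η * s)) := by
    intro n
    refine (le_renewalSum_add hK hG n s).trans (add_le_add ?_ le_rfl)
    rw [renewalSum_tsum (fun i => measurable_one.indicator measurableSet_Ico),
      ← ENNReal.tsum_mul_right]
    gcongr with i
    exact renewalSum_indicator_le hη hρ _ n s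
  have h2 : Tendsto (fun n : ℕ => (∑' i, b i) * ((1 - ρ)⁻¹ * ENNReal.ofReal (Real.exp η))
      + K * ρ ^ n * ENNReal.ofReal (Real.exp (η * s))) atTop
      (𝓝 ((∑' i, b i) * ((1 - ρ)⁻¹ * ENNReal.ofReal (Real.exp η))
      + K * 0 * ENNReal.ofReal (Real.exp (η * s)))) := by
    refine Tendsto.const_add _ (ENNReal.Tendsto.mul_const ?_ (Or.inr ENNReal.ofReal_ne_top))
    exact ENNReal.Tendsto.const_mul (ENNReal.tendsto_pow_atTop_nhds_zero_of_lt_one hρ)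
      (Or.inr hKt)
  simpa using ge_of_tendsto' h2 h1

end APriori

end DiagonalSRE
end

noncomputable section
namespace DiagonalSRE

/-! ### Moments of order below one of a stationary solution. -/

section Moments

variable {Ω : Type*} [MeasurableSpace Ω] {P : Measure Ω}

theorem integrable_of_tendsto_of_integral_le {f : ℕ → Ω → ℝ} {g : Ω → ℝ} {C : ℝ}
    (hf : ∀ n, Integrable (f n) P) (hf0 : ∀ n ω, 0 ≤ f n ω) (hC : ∀ n, ∫ ω, f n ω ∂P ≤ C)
    (hlim : ∀ ω, Tendsto (fun n => f n ω) atTop (𝓝 (g ω))) : Integrable g P := by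
  refine ⟨aestronglyMeasurable_of_tendsto_ae atTop (fun n => (hf n).aestronglyMeasurable)
    (ae_of_all _ hlim), ?_⟩
  have h1 : ∫⁻ ω, ‖g ω‖ₑ ∂P ≤ liminf (fun n => ∫⁻ ω, ‖f n ω‖ₑ ∂P) atTop := by
    refine le_trans (le_of_eq ?_) (lintegral_liminf_le' fun n => (hf n).1.enorm)
    congr 1 with ω
    exact ((hlim ω).enorm).liminf_eq.symm
  refine lt_of_le_of_lt h1 (lt_of_le_of_lt (b := ENNReal.ofReal C) ?_ ENNReal.ofReal_lt_top)
  refine liminf_le_of_le (by isBoundedDefault) fun b hb => ?_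
  obtain ⟨n, hn⟩ := hb.exists
  refine hn.trans ?_
  rw [← ofReal_integral_norm_eq_lintegral_enorm (hf n)]
  refine ENNReal.ofReal_le_ofReal (le_trans (le_of_eq ?_) (hC n))
  congr 1 with ω
  exact Real.norm_of_nonneg (hf0 n ω)

/-- Either b is negligible against a, and the sum costs only the factor l, or a is controlled by b.
A maximum, unlike the sum, can be raised to any power without losing the near-optimal factor in
front of a. -/
theorem le_max_of_rpow_le_add_rpow {p l : ℝ} (hp : 0 < p) (hl : 1 < l) :
    ∃ C : ℝ, 0 ≤ C ∧ ∀ a b c : ℝ, 0 ≤ a → 0 ≤ b → 0 ≤ c → c ^ p ≤ a ^ p + b ^ p →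
      c ≤ max (l * a) (C * b) := by
  obtain ⟨δ, hδ, hlδ⟩ : ∃ δ : ℝ, 0 < δ ∧ l ^ p = 1 + δ :=
    ⟨l ^ p - 1, by linarith [Real.one_lt_rpow hl hp], by ring⟩
  refine ⟨(1 + 1 / δ) ^ (1 / p), by positivity, fun a b c ha hb hc h => ?_⟩
  have hl0 : 0 ≤ l := by linarith
  by_cases hab : b ^ p ≤ δ * a ^ p
  · refine le_max_of_le_left ?_
    rw [← Real.rpow_le_rpow_iff hc (by positivity) hp, Real.mul_rpow hl0 ha, hlδ]
    linarith
  · refine le_max_of_le_right ?_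
    rw [← Real.rpow_le_rpow_iff hc (by positivity) hp, Real.mul_rpow (by positivity) hb,
      ← Real.rpow_mul (by positivity), one_div_mul_cancel hp.ne', Real.rpow_one]
    have : a ^ p ≤ 1 / δ * b ^ p := by
      rw [one_div, inv_mul_eq_div, le_div_iff₀ hδ]
      linarith
    linarith

variable {U U' V W : Ω → ℝ}

theorem integrable_rpow_mul_comp
    (hind : IndepFun W U P) {y : ℝ} (hWy : Integrable (fun ω => W ω ^ y) P) {q : ℝ → ℝ}
    (hq : Measurable q) (hqi : Integrable (fun ω => q (U ω)) P) :
    Integrable (fun ω => W ω ^ y * q (U ω)) P ∧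
      ∫ ω, W ω ^ y * q (U ω) ∂P = (∫ ω, W ω ^ y ∂P) * ∫ ω, q (U ω) ∂P := by
  have h : IndepFun (fun ω => W ω ^ y) (fun ω => q (U ω)) P :=
    hind.comp (φ := fun x : ℝ => x ^ y) (by fun_prop) hq
  exact ⟨h.integrable_mul hWy hqi, h.integral_mul_eq_mul_integral hWy.1 hqi.1⟩

variable [IsProbabilityMeasure P]

/-- For γ ≤ p the inequality survives with exponent γ. Stationarity formally gives E U^γ ≤ E W^γ E
U^γ + E V^γ; truncation makes this rigorous without assuming that E U^γ is finite. -/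
theorem integrable_rpow_of_small (hUm : Measurable U)
    (hW0 : ∀ ω, 0 ≤ W ω) (hU0 : ∀ ω, 0 ≤ U ω) (hV0 : ∀ ω, 0 ≤ V ω) (hU'0 : ∀ ω, 0 ≤ U' ω)
    (hind : IndepFun W U P) (hid : IdentDistrib U U' P P) {p : ℝ} (hp : 0 < p)
    (hsub : ∀ᵐ ω ∂P, U' ω ^ p ≤ (W ω * U ω) ^ p + V ω ^ p) {γ : ℝ} (hγ : 0 < γ) (hγp : γ ≤ p)
    (hWi : Integrable (fun ω => W ω ^ γ) P) (hW1 : ∫ ω, W ω ^ γ ∂P < 1)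
    (hVi : Integrable (fun ω => V ω ^ γ) P) : Integrable (fun ω => U ω ^ γ) P := by
  have hsubγ : ∀ᵐ ω ∂P, U' ω ^ γ ≤ (W ω * U ω) ^ γ + V ω ^ γ := by
    filter_upwards [hsub] with ω h
    have hWU : 0 ≤ W ω * U ω := mul_nonneg (hW0 ω) (hU0 ω)
    have e : ∀ x : ℝ, 0 ≤ x → x ^ γ = (x ^ p) ^ (γ / p) := fun x hx => by
      rw [← Real.rpow_mul hx, mul_div_cancel₀ _ hp.ne']
    rw [e _ (hU'0 ω), e _ hWU, e _ (hV0 ω)]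
    refine (Real.rpow_le_rpow (Real.rpow_nonneg (hU'0 ω) _) h (by positivity)).trans ?_
    exact Real.rpow_add_le_add_rpow (Real.rpow_nonneg hWU _) (Real.rpow_nonneg (hV0 ω) _)
      (by positivity) ((div_le_one hp).2 hγp)
  -- The truncation min(u^γ, n) is q + r. After taking expectations the part r occurs on both sides
  -- and cancels, leaving a bound for E q(U) that does not depend on n.
  set q : ℕ → ℝ → ℝ := fun n u => if u ^ γ ≤ n then u ^ γ else 0 with hq
  set r : ℕ → ℝ → ℝ := fun n u => if u ^ γ ≤ n then 0 else n with hr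
  have hset : ∀ n : ℕ, MeasurableSet {u : ℝ | u ^ γ ≤ n} := fun n =>
    measurableSet_le (by fun_prop) (by fun_prop)
  have hqm : ∀ n, Measurable (q n) := fun n => Measurable.ite (hset n) (by fun_prop) (by fun_prop)
  have hrm : ∀ n, Measurable (r n) := fun n => Measurable.ite (hset n) (by fun_prop) (by fun_prop)
  have hUγ : ∀ ω, 0 ≤ U ω ^ γ := fun ω => Real.rpow_nonneg (hU0 ω) _
  have hq0 : ∀ n ω, 0 ≤ q n (U ω) := fun n ω => by
    simp only [hq]; split_ifs; exacts [hUγ ω, le_rfl]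
  have hqi : ∀ n, Integrable (fun ω => q n (U ω)) P := fun n =>
    Integrable.of_bound ((hqm n).comp hUm).aestronglyMeasurable n (ae_of_all _ fun ω => by
      rw [Real.norm_of_nonneg (hq0 n ω)]
      simp only [hq]; split_ifs with h; exacts [h, by positivity])
  have hri : ∀ n, Integrable (fun ω => r n (U ω)) P := fun n =>
    Integrable.of_bound ((hrm n).comp hUm).aestronglyMeasurable n (ae_of_all _ fun ω => by
      simp only [hr]; split_ifs <;> simp)
  refine integrable_of_tendsto_of_integral_le (f := fun n ω => q n (U ω))
    (C := (∫ ω, V ω ^ γ ∂P) / (1 - ∫ ω, W ω ^ γ ∂P)) hqi hq0 (fun n => ?_) fun ω => ?_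
  · have hprod := integrable_rpow_mul_comp hind hWi (hqm n) (hqi n)
    have hmin : ∀ ω, min (U ω ^ γ) n = q n (U ω) + r n (U ω) := fun ω => by
      simp only [hq, hr]; split_ifs with h
      · simp [h]
      · simp [le_of_not_ge h]
    have hid' : IdentDistrib (fun ω => min (U ω ^ γ) (n : ℝ)) (fun ω => min (U' ω ^ γ) (n : ℝ)) P P :=
      hid.comp (u := fun x => min (x ^ γ) (n : ℝ)) (by fun_prop)
    have hi1 : Integrable (fun ω => min (U ω ^ γ) (n : ℝ)) P := by
      simp_rw [hmin]; exact (hqi n).add (hri n)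
    have hle : ∀ᵐ ω ∂P, min (U' ω ^ γ) (n : ℝ)
        ≤ W ω ^ γ * q n (U ω) + r n (U ω) + V ω ^ γ := by
      filter_upwards [hsubγ] with ω h
      rw [Real.mul_rpow (hW0 ω) (hU0 ω)] at h
      have hVγ := Real.rpow_nonneg (hV0 ω) γ
      simp only [hq, hr]; split_ifs with h'
      · rw [add_zero]; exact (min_le_left _ _).trans h
      · rw [mul_zero, zero_add]; exact (min_le_right _ _).trans (by linarith)
    have i1 : Integrable (fun ω => W ω ^ γ * q n (U ω) + r n (U ω)) P := hprod.1.add (hri n)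
    have h1 := integral_mono_ae (hid'.integrable_iff.1 hi1) (i1.add hVi) hle
    simp only [Pi.add_apply] at h1
    rw [← hid'.integral_eq, integral_add i1 hVi, integral_add hprod.1 (hri n), hprod.2] at h1
    simp_rw [hmin] at h1
    rw [integral_add (hqi n) (hri n)] at h1
    rw [le_div_iff₀ (by linarith)]
    linarith
  · refine tendsto_const_nhds.congr' ?_
    obtain ⟨N, hN⟩ := exists_nat_ge (U ω ^ γ)
    filter_upwards [eventually_ge_atTop N] with n hn
    have : U ω ^ γ ≤ n := hN.trans (by exact_mod_cast hn)
    simp [hq, this]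

/-- Moments of a stationary solution: if `U' =ᵈ U`, `W` and `U` are independent,
`U'^p ≤ (W U)^p + V^p` and `E W^y < 1` for `0 < y < 1`, then `E U^y < ∞` for `0 < y < 1`. -/
theorem integrable_rpow_of_subadditive (hUm : Measurable U)
    (hW0 : ∀ ω, 0 ≤ W ω) (hU0 : ∀ ω, 0 ≤ U ω) (hV0 : ∀ ω, 0 ≤ V ω) (hU'0 : ∀ ω, 0 ≤ U' ω)
    (hind : IndepFun W U P) (hid : IdentDistrib U U' P P) {p : ℝ} (hp : 0 < p)
    (hsub : ∀ᵐ ω ∂P, U' ω ^ p ≤ (W ω * U ω) ^ p + V ω ^ p)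
    (hW : ∀ y : ℝ, 0 < y → y < 1 → Integrable (fun ω => W ω ^ y) P ∧ ∫ ω, W ω ^ y ∂P < 1)
    (hV : ∀ y : ℝ, 0 < y → y < 1 → Integrable (fun ω => V ω ^ y) P) {y : ℝ} (hy : 0 < y)
    (hy1 : y < 1) : Integrable (fun ω => U ω ^ y) P := by
  rcases le_or_gt y p with hyp | hyp
  · exact integrable_rpow_of_small hUm hW0 hU0 hV0 hU'0 hind hid hp hsub hy hyp
      (hW y hy hy1).1 (hW y hy hy1).2 (hV y hy hy1)
  set γ := p with hγ
  have hp1 : p < 1 := hyp.trans hy1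
  have hUγ : Integrable (fun ω => U ω ^ γ) P :=
    integrable_rpow_of_small hUm hW0 hU0 hV0 hU'0 hind hid hp hsub hp le_rfl
      (hW p hp hp1).1 (hW p hp hp1).2 (hV p hp hp1)
  set ρ := max (∫ ω, W ω ^ y ∂P) (∫ ω, W ω ^ γ ∂P) with hρ
  have hρ1 : ρ < 1 := max_lt (hW y hy hy1).2 (hW p hp hp1).2
  have hρ0 : 0 ≤ ρ := le_max_of_le_left (integral_nonneg fun ω => Real.rpow_nonneg (hW0 ω) _)
  -- Chosen so that l > 1 while lρ < 1: the loss in passing from sums to maxima is absorbed by the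
  -- contraction.
  set l := 2 / (1 + ρ) with hl
  have hl1 : 1 < l := by rw [hl, lt_div_iff₀ (by linarith)]; linarith
  have hlρ : l * ρ < 1 := by rw [hl, div_mul_eq_mul_div, div_lt_one (by linarith)]; linarith
  obtain ⟨C, hC0, hC⟩ := le_max_of_rpow_le_add_rpow hp hl1
  -- Truncating by n u^γ instead of n keeps φ integrable, since E U^γ is already finite, and makes
  -- both pieces contract under W. A constant truncation would not compensate the factor l > 1.
  set φ : ℕ → ℝ → ℝ := fun n u => min (u ^ y) (n * u ^ γ) with hφ
  set q : ℕ → ℝ → ℝ := fun n u => if u ^ y ≤ n * u ^ γ then u ^ y else 0 with hq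
  set r : ℕ → ℝ → ℝ := fun n u => if u ^ y ≤ n * u ^ γ then 0 else n * u ^ γ with hr
  have hset : ∀ n : ℕ, MeasurableSet {u : ℝ | u ^ y ≤ n * u ^ γ} := fun n =>
    measurableSet_le (by fun_prop) (by fun_prop)
  have hqm : ∀ n, Measurable (q n) := fun n => Measurable.ite (hset n) (by fun_prop) (by fun_prop)
  have hrm : ∀ n, Measurable (r n) := fun n => Measurable.ite (hset n) (by fun_prop) (by fun_prop)
  have hU1 : ∀ ω, 0 ≤ U ω ^ γ := fun ω => Real.rpow_nonneg (hU0 ω) _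
  have hU2 : ∀ ω, 0 ≤ U ω ^ y := fun ω => Real.rpow_nonneg (hU0 ω) _
  have hq0 : ∀ n ω, 0 ≤ q n (U ω) := fun n ω => by
    simp only [hq]; split_ifs; exacts [hU2 ω, le_rfl]
  have hr0 : ∀ n ω, 0 ≤ r n (U ω) := fun n ω => by
    have := hU1 ω
    simp only [hr]; split_ifs <;> positivity
  have hmin : ∀ n ω, φ n (U ω) = q n (U ω) + r n (U ω) := fun n ω => by
    simp only [hφ, hq, hr]; split_ifs with h
    · simp [h]
    · simp [le_of_not_ge h]
  have hφ0 : ∀ n ω, 0 ≤ φ n (U ω) := fun n ω => by rw [hmin]; exact add_nonneg (hq0 n ω) (hr0 n ω)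
  have hqi : ∀ n, Integrable (fun ω => q n (U ω)) P := fun n =>
    (hUγ.const_mul (n : ℝ)).mono' ((hqm n).comp hUm).aestronglyMeasurable (ae_of_all _ fun ω => by
      rw [Real.norm_of_nonneg (hq0 n ω)]
      have := hU1 ω
      simp only [hq]; split_ifs with h; exacts [h, by positivity])
  have hri : ∀ n, Integrable (fun ω => r n (U ω)) P := fun n =>
    (hUγ.const_mul (n : ℝ)).mono' ((hrm n).comp hUm).aestronglyMeasurable (ae_of_all _ fun ω => by
      rw [Real.norm_of_nonneg (hr0 n ω)]
      have := hU1 ω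
      simp only [hr]; split_ifs with h; exacts [by positivity, le_rfl])
  have hφi : ∀ n, Integrable (fun ω => φ n (U ω)) P := fun n => by
    simp_rw [hmin]; exact (hqi n).add (hri n)
  refine integrable_of_tendsto_of_integral_le (f := fun n ω => φ n (U ω))
    (C := (C ^ y * ∫ ω, V ω ^ y ∂P) / (1 - l * ρ)) hφi hφ0 (fun n => ?_) fun ω => ?_
  · have hprod1 := integrable_rpow_mul_comp hind (hW y hy hy1).1 (hqm n) (hqi n)
    have hprod2 := integrable_rpow_mul_comp hind (hW p hp hp1).1 (hrm n) (hri n)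
    have hid' : IdentDistrib (fun ω => φ n (U ω)) (fun ω => φ n (U' ω)) P P :=
      hid.comp (u := φ n) (by fun_prop)
    have hle : ∀ᵐ ω ∂P, φ n (U' ω)
        ≤ l * (W ω ^ y * q n (U ω) + W ω ^ γ * r n (U ω)) + C ^ y * V ω ^ y := by
      filter_upwards [hsub] with ω h
      have hWU : 0 ≤ W ω * U ω := mul_nonneg (hW0 ω) (hU0 ω)
      have hm := hC _ _ _ hWU (hV0 ω) (hU'0 ω) h
      have hVy : 0 ≤ C ^ y * V ω ^ y := by
        have := Real.rpow_nonneg (hV0 ω) y; positivity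
      have hWq : 0 ≤ W ω ^ y * q n (U ω) := mul_nonneg (Real.rpow_nonneg (hW0 ω) _) (hq0 n ω)
      have hWr : 0 ≤ W ω ^ γ * r n (U ω) := mul_nonneg (Real.rpow_nonneg (hW0 ω) _) (hr0 n ω)
      have hlpow : ∀ z : ℝ, 0 < z → z < 1 → (l * (W ω * U ω)) ^ z ≤ l * (W ω ^ z * U ω ^ z) := by
        intro z hz hz1
        have hl' : l ^ z ≤ l := by
          simpa using Real.rpow_le_rpow_of_exponent_le hl1.le hz1.le
        rw [Real.mul_rpow (by linarith) hWU, Real.mul_rpow (hW0 ω) (hU0 ω)]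
        exact mul_le_mul_of_nonneg_right hl' (mul_nonneg (Real.rpow_nonneg (hW0 ω) _)
          (Real.rpow_nonneg (hU0 ω) _))
      rcases le_max_iff.1 hm with h1 | h1
      · have hφle : φ n (U' ω) ≤ l * (W ω ^ y * q n (U ω) + W ω ^ γ * r n (U ω)) := by
          simp only [hφ, hq, hr]
          split_ifs with h'
          · rw [mul_zero, add_zero]
            exact (min_le_left _ _).trans
              ((Real.rpow_le_rpow (hU'0 ω) h1 hy.le).trans (hlpow y hy hy1))
          · rw [mul_zero, zero_add]
            refine (min_le_right _ _).trans ?_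
            have := (Real.rpow_le_rpow (hU'0 ω) h1 hp.le).trans (hlpow p hp hp1)
            calc (n : ℝ) * U' ω ^ p ≤ n * (l * (W ω ^ p * U ω ^ p)) := by gcongr
              _ = _ := by ring
        linarith
      · have : φ n (U' ω) ≤ C ^ y * V ω ^ y := by
          rw [← Real.mul_rpow hC0 (hV0 ω)]
          exact (min_le_left _ _).trans (Real.rpow_le_rpow (hU'0 ω) h1 hy.le)
        have : 0 ≤ l * (W ω ^ y * q n (U ω) + W ω ^ γ * r n (U ω)) :=
          mul_nonneg (by linarith) (add_nonneg hWq hWr)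
        linarith
    have i1 : Integrable (fun ω => l * (W ω ^ y * q n (U ω) + W ω ^ γ * r n (U ω))) P :=
      (hprod1.1.add hprod2.1).const_mul l
    have i2 : Integrable (fun ω => C ^ y * V ω ^ y) P := (hV y hy hy1).const_mul _
    have h1 := integral_mono_ae (hid'.integrable_iff.1 (hφi n)) (i1.add i2) hle
    simp only [Pi.add_apply] at h1
    rw [← hid'.integral_eq, integral_add i1 i2, integral_const_mul, integral_const_mul,
      integral_add hprod1.1 hprod2.1, hprod1.2, hprod2.2] at h1
    have hsplit : ∫ ω, φ n (U ω) ∂P = ∫ ω, q n (U ω) ∂P + ∫ ω, r n (U ω) ∂P := by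
      simp_rw [hmin]; exact integral_add (hqi n) (hri n)
    have a1 : (∫ ω, W ω ^ y ∂P) * ∫ ω, q n (U ω) ∂P ≤ ρ * ∫ ω, q n (U ω) ∂P :=
      mul_le_mul_of_nonneg_right (le_max_left _ _) (integral_nonneg fun ω => hq0 n ω)
    have a2 : (∫ ω, W ω ^ γ ∂P) * ∫ ω, r n (U ω) ∂P ≤ ρ * ∫ ω, r n (U ω) ∂P :=
      mul_le_mul_of_nonneg_right (le_max_right _ _) (integral_nonneg fun ω => hr0 n ω)
    have a3 := mul_le_mul_of_nonneg_left (add_le_add a1 a2) (by linarith : (0 : ℝ) ≤ l)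
    rw [← mul_add, ← hsplit] at a3
    rw [le_div_iff₀ (by linarith)]
    linarith
  · rcases (hU1 ω).eq_or_lt with h0 | h0
    · have hz : U ω = 0 := by
        rw [eq_comm, Real.rpow_eq_zero (hU0 ω) hp.ne'] at h0; exact h0
      simp [hφ, hz, Real.zero_rpow hy.ne', Real.zero_rpow hp.ne']
    · refine tendsto_const_nhds.congr' ?_
      obtain ⟨N, hN⟩ := exists_nat_ge (U ω ^ y / U ω ^ γ)
      filter_upwards [eventually_ge_atTop N] with n hn
      have : U ω ^ y ≤ n * U ω ^ γ := by
        rw [← div_le_iff₀ h0]; exact hN.trans (by exact_mod_cast hn)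
      simp [hφ, this]

end Moments

end DiagonalSRE
end

noncomputable section
namespace DiagonalSRE

/-! ### The homogeneous norm and dilations. -/

section AlphaNorm

variable {d : ℕ} {α : Fin d → ℝ} {x y : Fin d → ℝ}

theorem le_alphaNorm (j : Fin d) : |x j| ^ α j ≤ alphaNorm α x :=
  le_ciSup (f := fun j => |x j| ^ α j) (Finite.bddAbove_range _) j

theorem alphaNorm_nonneg : 0 ≤ alphaNorm α x :=
  Real.iSup_nonneg fun _ => Real.rpow_nonneg (abs_nonneg _) _

theorem alphaNorm_le {c : ℝ} (hc : 0 ≤ c) (h : ∀ j, |x j| ^ α j ≤ c) : alphaNorm α x ≤ c :=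
  Real.iSup_le h hc

theorem alphaNorm_le_sum : alphaNorm α x ≤ ∑ j, |x j| ^ α j :=
  alphaNorm_le (Finset.sum_nonneg fun _ _ => Real.rpow_nonneg (abs_nonneg _) _) fun j =>
    Finset.single_le_sum (f := fun j => |x j| ^ α j)
      (fun _ _ => Real.rpow_nonneg (abs_nonneg _) _) (Finset.mem_univ j)

theorem abs_le_rpow_alphaNorm (hα : ∀ j, 0 < α j) (j : Fin d) :
    |x j| ≤ alphaNorm α x ^ (1 / α j) := by
  rw [← Real.rpow_le_rpow_iff (abs_nonneg _) (Real.rpow_nonneg alphaNorm_nonneg _) (hα j),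
    ← Real.rpow_mul alphaNorm_nonneg, one_div_mul_cancel (hα j).ne', Real.rpow_one]
  exact le_alphaNorm j

theorem alphaNorm_zero (hα : ∀ j, 0 < α j) : alphaNorm α 0 = 0 :=
  le_antisymm (alphaNorm_le le_rfl fun j => by simp [Real.zero_rpow (hα j).ne']) alphaNorm_nonneg

theorem alphaNorm_eq_zero (hα : ∀ j, 0 < α j) : alphaNorm α x = 0 ↔ x = 0 := by
  refine ⟨fun h => funext fun j => ?_, fun h => h ▸ alphaNorm_zero hα⟩
  have := abs_le_rpow_alphaNorm (x := x) hα j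
  rw [h, Real.zero_rpow (by have := hα j; positivity)] at this
  simpa using abs_nonpos_iff.1 this

theorem alphaNorm_pos (hα : ∀ j, 0 < α j) : 0 < alphaNorm α x ↔ x ≠ 0 := by
  rw [alphaNorm_nonneg.lt_iff_ne, ne_comm, Ne, alphaNorm_eq_zero hα]

theorem alphaNorm_congr (h : ∀ j, |x j| = |y j|) : alphaNorm α x = alphaNorm α y := by
  simp only [alphaNorm, h]

theorem alphaNorm_mul {w : ℝ} (hw : 0 ≤ w) {a : Fin d → ℝ} (h : ∀ j, |a j| ^ α j = w) :
    alphaNorm α (fun j => a j * x j) = w * alphaNorm α x := by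
  simp only [alphaNorm, abs_mul, Real.mul_rpow (abs_nonneg _) (abs_nonneg _), h]
  exact (Real.mul_iSup_of_nonneg hw _).symm

theorem alphaNorm_dilation (hα : ∀ j, 0 < α j) {t : ℝ} (ht : 0 ≤ t) :
    alphaNorm α (dilation α t x) = t * alphaNorm α x := by
  refine alphaNorm_mul ht fun j => ?_
  rw [abs_of_nonneg (Real.rpow_nonneg ht _), ← Real.rpow_mul ht,
    one_div_mul_cancel (hα j).ne', Real.rpow_one]

theorem dilation_dilation {s t : ℝ} (hs : 0 ≤ s) (ht : 0 ≤ t) :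
    dilation α s (dilation α t x) = dilation α (s * t) x := by
  ext j
  simp only [dilation, Real.mul_rpow hs ht]
  ring

theorem dilation_one : dilation α 1 x = x := by
  ext j; simp [dilation]

theorem alphaNorm_rpow_le {p c : ℝ} (hp : 0 < p) (hc : 0 ≤ c) (h : ∀ j, |x j| ^ (α j * p) ≤ c) :
    alphaNorm α x ^ p ≤ c := by
  have h1 : alphaNorm α x ≤ c ^ (1 / p) := by
    refine alphaNorm_le (by positivity) fun j => ?_
    rw [← Real.rpow_le_rpow_iff (by positivity) (by positivity) hp, ← Real.rpow_mul hc,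
      one_div_mul_cancel hp.ne', Real.rpow_one, ← Real.rpow_mul (abs_nonneg _)]
    exact h j
  calc alphaNorm α x ^ p ≤ (c ^ (1 / p)) ^ p := Real.rpow_le_rpow alphaNorm_nonneg h1 hp.le
    _ = c := by rw [← Real.rpow_mul hc, one_div_mul_cancel hp.ne', Real.rpow_one]

theorem rpow_le_alphaNorm_rpow {p : ℝ} (hp : 0 < p) (j : Fin d) :
    |x j| ^ (α j * p) ≤ alphaNorm α x ^ p := by
  rw [Real.rpow_mul (abs_nonneg _)]
  exact Real.rpow_le_rpow (Real.rpow_nonneg (abs_nonneg _) _) (le_alphaNorm j) hp.le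

/-- In each coordinate t ↦ t^{α_j p} is concave, hence subadditive, because the exponent is at most
1. -/
theorem alphaNorm_add_rpow_le (hα : ∀ j, 0 < α j) {p : ℝ} (hp : 0 < p) (hαp : ∀ j, α j * p ≤ 1) :
    alphaNorm α (x + y) ^ p ≤ alphaNorm α x ^ p + alphaNorm α y ^ p := by
  refine alphaNorm_rpow_le hp (add_nonneg (Real.rpow_nonneg alphaNorm_nonneg _)
    (Real.rpow_nonneg alphaNorm_nonneg _)) fun j => ?_
  have h0 : 0 ≤ α j * p := mul_nonneg (hα j).le hp.le
  calc |(x + y) j| ^ (α j * p) ≤ (|x j| + |y j|) ^ (α j * p) :=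
        Real.rpow_le_rpow (abs_nonneg _) (abs_add_le _ _) h0
    _ ≤ |x j| ^ (α j * p) + |y j| ^ (α j * p) :=
        Real.rpow_add_le_add_rpow (abs_nonneg _) (abs_nonneg _) h0 (hαp j)
    _ ≤ _ := add_le_add (rpow_le_alphaNorm_rpow hp j) (rpow_le_alphaNorm_rpow hp j)

theorem abs_alphaNorm_rpow_sub_le (hα : ∀ j, 0 < α j) {p : ℝ} (hp : 0 < p)
    (hαp : ∀ j, α j * p ≤ 1) :
    |alphaNorm α x ^ p - alphaNorm α y ^ p| ≤ alphaNorm α (x - y) ^ p := by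
  have h1 := alphaNorm_add_rpow_le (x := x - y) (y := y) hα hp hαp
  have h2 := alphaNorm_add_rpow_le (x := y - x) (y := x) hα hp hαp
  rw [alphaNorm_congr (x := y - x) (y := x - y) fun j => abs_sub_comm _ _] at h2
  rw [sub_add_cancel] at h1 h2
  exact abs_le.2 ⟨by linarith, by linarith⟩

/-- The exponent `p` for which `|·|_α ^ p` is subadditive. -/
theorem exists_exponent (hα : ∀ j, 0 < α j) [NeZero d] :
    ∃ p : ℝ, 0 < p ∧ p < 1 ∧ ∀ j, α j * p ≤ 1 := by
  have hs : 0 < ∑ j, α j := Finset.sum_pos (fun j _ => hα j) ⟨0, Finset.mem_univ _⟩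
  refine ⟨(1 + ∑ j, α j)⁻¹, by positivity, inv_lt_one_of_one_lt₀ (by linarith), fun j => ?_⟩
  rw [← div_eq_mul_inv, div_le_one (by positivity)]
  have := Finset.single_le_sum (f := α) (fun j _ => (hα j).le) (Finset.mem_univ j)
  linarith

theorem continuous_alphaNorm (hα : ∀ j, 0 < α j) : Continuous (alphaNorm α) := by
  rcases isEmpty_or_nonempty (Fin d) with h | h
  · have : alphaNorm α = fun _ => (0 : ℝ) := by ext x; simp [alphaNorm]
    rw [this]; exact continuous_const
  · have : alphaNorm α = fun x : Fin d → ℝ =>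
        Finset.univ.sup' Finset.univ_nonempty fun j => |x j| ^ α j := by
      ext x; rw [Finset.sup'_univ_eq_ciSup]; rfl
    rw [this]
    refine Continuous.finset_sup'_apply _ fun j _ => ?_
    exact ((continuous_apply j).abs).rpow_const fun x => Or.inr (hα j).le

theorem measurable_alphaNorm (hα : ∀ j, 0 < α j) : Measurable (alphaNorm α) :=
  (continuous_alphaNorm hα).measurable

theorem continuous_dilation (t : ℝ) : Continuous (dilation α t) := by
  unfold dilation; fun_prop

theorem continuousOn_dilation :
    ContinuousOn (fun z : ℝ × (Fin d → ℝ) => dilation α z.1 z.2) (Ioi 0 ×ˢ univ) := by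
  refine continuousOn_pi.2 fun j => ContinuousOn.mul ?_ (by fun_prop)
  exact ContinuousOn.rpow_const (by fun_prop) fun z hz => Or.inl (ne_of_gt hz.1)

theorem measurable_dilation : Measurable (fun z : ℝ × (Fin d → ℝ) => dilation α z.1 z.2) := by
  refine measurable_pi_lambda _ fun j => ?_
  simp only [dilation]
  fun_prop

theorem isCompact_alphaNorm_le (hα : ∀ j, 0 < α j) (R : ℝ) :
    IsCompact {x : Fin d → ℝ | alphaNorm α x ≤ R} := by
  have hsub : {x : Fin d → ℝ | alphaNorm α x ≤ R}
      ⊆ Set.pi univ fun j => Icc (-(R ^ (1 / α j))) (R ^ (1 / α j)) := by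
    intro x hx j _
    have h1 := abs_le_rpow_alphaNorm (x := x) hα j
    have h2 : alphaNorm α x ^ (1 / α j) ≤ R ^ (1 / α j) :=
      Real.rpow_le_rpow alphaNorm_nonneg hx (by have := hα j; positivity)
    exact abs_le.1 (h1.trans h2)
  exact (isCompact_univ_pi fun j => isCompact_Icc).of_isClosed_subset
    (isClosed_le (continuous_alphaNorm hα) continuous_const) hsub

/-- This makes bounded functions that are Lipschitz in the usual sense also Lipschitz for the metric
|x - y|_α^p. -/
theorem min_norm_le_alphaNorm_rpow (hα : ∀ j, 0 < α j) {p : ℝ} (hp : 0 < p) (hαp : ∀ j, α j * p ≤ 1) :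
    min 1 ‖x‖ ≤ alphaNorm α x ^ p := by
  by_contra! hcon
  have h1 : ‖x‖ ≤ alphaNorm α x ^ p := by
    refine (pi_norm_le_iff_of_nonneg (Real.rpow_nonneg alphaNorm_nonneg _)).2 fun j => ?_
    have h2 := rpow_le_alphaNorm_rpow (α := α) (x := x) hp j
    rw [Real.norm_eq_abs]
    rcases (abs_nonneg (x j)).eq_or_lt with h0 | h0
    · rw [← h0]; exact Real.rpow_nonneg alphaNorm_nonneg _
    · rcases le_total |x j| 1 with h3 | h3
      · refine le_trans ?_ h2
        simpa using Real.rpow_le_rpow_of_exponent_ge h0 h3 (hαp j)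
      · have h4 : 1 ≤ |x j| ^ (α j * p) := Real.one_le_rpow h3 (mul_nonneg (hα j).le hp.le)
        linarith [min_le_left 1 ‖x‖]
  exact absurd (hcon.trans_le (min_le_right _ _)) (not_lt.2 h1)

end AlphaNorm

end DiagonalSRE
end

noncomputable section
namespace DiagonalSRE

/-! ### Convexity of the moments of W. -/

section WeightMoments

variable {Ω : Type*} [MeasurableSpace Ω] {P : Measure Ω} [IsProbabilityMeasure P] {W : Ω → ℝ}

/-- Bernoulli's inequality W^y ≤ 1 + y(W - 1) integrates to at most 1 and is strict wherever W ≠ 1.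
-/
theorem integrable_rpow_and_integral_lt_one (hWm : Measurable W) (hW0 : ∀ ω, 0 ≤ W ω)
    (hWi : Integrable W P) (hW1 : ∫ ω, W ω ∂P = 1) (hne : ¬ ∀ᵐ ω ∂P, W ω = 1) {y : ℝ}
    (hy : 0 < y) (hy1 : y < 1) :
    Integrable (fun ω => W ω ^ y) P ∧ ∫ ω, W ω ^ y ∂P < 1 := by
  have hle : ∀ ω, W ω ^ y ≤ 1 + y * (W ω - 1) := fun ω => by
    have := rpow_one_add_le_one_add_mul_self (s := W ω - 1) (by linarith [hW0 ω]) hy.le hy1.le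
    rwa [add_sub_cancel] at this
  have hi2 : Integrable (fun ω => 1 + y * (W ω - 1)) P :=
    (integrable_const _).add ((hWi.sub (integrable_const _)).const_mul _)
  have hi : Integrable (fun ω => W ω ^ y) P := by
    refine hi2.mono' (hWm.pow_const _).aestronglyMeasurable (ae_of_all _ fun ω => ?_)
    rw [Real.norm_of_nonneg (Real.rpow_nonneg (hW0 ω) _)]
    exact hle ω
  have hI2 : ∫ ω, (1 + y * (W ω - 1)) ∂P = 1 := by
    have hi3 : Integrable (fun ω => y * (W ω - 1)) P :=
      (hWi.sub (integrable_const _)).const_mul _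
    rw [integral_add (integrable_const _) hi3, integral_const_mul, integral_sub hWi (integrable_const _), hW1]
    simp
  refine ⟨hi, lt_of_le_of_ne (hI2 ▸ integral_mono hi hi2 hle) fun heq => hne ?_⟩
  have h0 : ∫ ω, (1 + y * (W ω - 1) - W ω ^ y) ∂P = 0 := by
    rw [integral_sub hi2 hi, hI2, heq, sub_self]
  have := (integral_eq_zero_iff_of_nonneg (fun ω => sub_nonneg.2 (hle ω)) (hi2.sub hi)).1 h0
  filter_upwards [this] with ω hω
  by_contra hcon
  have := rpow_one_add_lt_one_add_mul_self (s := W ω - 1) (by linarith [hW0 ω])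
    (sub_ne_zero.2 hcon) hy hy1
  rw [add_sub_cancel] at this
  simp only [Pi.zero_apply] at hω
  linarith

/-- The inequality w log w ≥ w - 1 is an equality only at w = 1, and the right-hand side has mean
zero. The result is the positivity of the drift under the tilted law. -/
theorem integrable_mul_log_and_integral_pos (hWm : Measurable W) (hW0 : ∀ ω, 0 ≤ W ω)
    (hWi : Integrable W P) (hW1 : ∫ ω, W ω ∂P = 1) (hne : ¬ ∀ᵐ ω ∂P, W ω = 1)
    (hlog : Integrable (fun ω => W ω * Real.posLog (W ω)) P) :
    Integrable (fun ω => W ω * Real.log (W ω)) P ∧ 0 < ∫ ω, W ω * Real.log (W ω) ∂P := by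
  have hi : Integrable (fun ω => W ω * Real.log (W ω)) P := by
    refine ((integrable_const (1 : ℝ)).add hlog).mono'
      (hWm.mul hWm.log).aestronglyMeasurable (ae_of_all _ fun ω => ?_)
    rw [Pi.add_apply, Real.norm_eq_abs]
    have hp : 0 ≤ W ω * Real.posLog (W ω) := mul_nonneg (hW0 ω) Real.posLog_nonneg
    rcases (hW0 ω).eq_or_lt with h0 | h0
    · rw [← h0]; simp
    rcases le_total (W ω) 1 with h1 | h1
    · have := Real.abs_log_mul_self_lt (W ω) h0 h1
      rw [mul_comm]; linarith
    · rw [Real.posLog_eq_log (by rwa [abs_of_nonneg (hW0 ω)]) ,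
        abs_of_nonneg (mul_nonneg (hW0 ω) (Real.log_nonneg h1))]
      linarith
  have key : ∀ w : ℝ, 0 ≤ w → 0 ≤ w * Real.log w - (w - 1) ∧
      (w * Real.log w - (w - 1) = 0 → w = 1) := by
    intro w hw
    rcases hw.eq_or_lt with h0 | h0
    · rw [← h0]; simp
    have h1 := Real.log_le_sub_one_of_pos (inv_pos.2 h0)
    rw [Real.log_inv] at h1
    have h2 := mul_le_mul_of_nonneg_left h1 hw
    have h3 : w * (w⁻¹ - 1) = 1 - w := by field_simp
    rw [h3] at h2
    refine ⟨by linarith, fun h => ?_⟩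
    by_contra hcon
    have h4 := Real.log_lt_sub_one_of_pos (inv_pos.2 h0) (by simpa using hcon)
    rw [Real.log_inv] at h4
    have h5 := mul_lt_mul_of_pos_left h4 h0
    rw [h3] at h5
    linarith
  have hi2 : Integrable (fun ω => W ω - 1) P := hWi.sub (integrable_const _)
  have hI2 : ∫ ω, (W ω - 1) ∂P = 0 := by
    rw [integral_sub hWi (integrable_const _), hW1]; simp
  refine ⟨hi, ?_⟩
  have h0 : ∫ ω, (W ω * Real.log (W ω) - (W ω - 1)) ∂P = ∫ ω, W ω * Real.log (W ω) ∂P := by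
    rw [integral_sub hi hi2, hI2, sub_zero]
  rw [← h0]
  refine lt_of_le_of_ne (integral_nonneg fun ω => (key _ (hW0 ω)).1) fun heq => hne ?_
  have := (integral_eq_zero_iff_of_nonneg (fun ω => (key _ (hW0 ω)).1) (hi.sub hi2)).1 heq.symm
  filter_upwards [this] with ω hω
  exact (key _ (hW0 ω)).2 hω

end WeightMoments

/-! ### Mixed moments of the stationary solution and the inhomogeneous term. -/

/-- The standing assumptions on a stationary solution of a homogeneous diagonal affine recursion:
`W` is the common value of `|A_j|^{α_j}`, and `|·|_α ^ p` is subadditive. -/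
structure HomogeneousSRE {d : ℕ} {Ω : Type*} [MeasurableSpace Ω] (P : Measure Ω)
    (A B X : Ω → Fin d → ℝ) (α : Fin d → ℝ) (W : Ω → ℝ) (p : ℝ) : Prop where
  measurable_A : Measurable A
  measurable_B : Measurable B
  measurable_X : Measurable X
  α_pos : ∀ j, 0 < α j
  p_pos : 0 < p
  p_lt_one : p < 1
  α_mul_p_le : ∀ j, α j * p ≤ 1
  indep : IndepFun A X P
  ident : IdentDistrib X (fun ω => A ω * X ω + B ω) P P
  measurable_W : Measurable W
  W_nonneg : ∀ ω, 0 ≤ W ω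
  W_eq : ∀ᵐ ω ∂P, ∀ j, |A ω j| ^ α j = W ω
  indep_W : IndepFun W X P
  integrable_W : Integrable W P
  integral_W : ∫ ω, W ω ∂P = 1
  integrable_log : Integrable (fun ω => W ω * Real.posLog (W ω)) P
  nonarithmetic : ∀ a : ℝ, ¬ ∀ᵐ ω ∂P, W ω ≠ 0 → Real.log (W ω) ∈ AddSubgroup.zmultiples a
  moment : (∀ j, ∃ σ : ℝ, 0 < σ ∧ Integrable (fun ω => |B ω j| ^ (α j + σ)) P) ∨
      (IndepFun X B P ∧ ∀ j, Integrable (fun ω => |B ω j| ^ α j) P)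

/-- A substitute for Hölder when B and X are dependent: the surplus σ in the moment of B pays for a
small power of |X|_α. -/
theorem rpow_mul_rpow_le_add {b u a σ x : ℝ} (hb : 0 ≤ b) (hu : 0 ≤ u) (ha : 0 < a) (hσ : 0 < σ)
    (hx : 0 < x) : b ^ a * u ^ x ≤ b ^ (a + σ) + u ^ (x * ((a + σ) / σ)) := by
  have h1 : 0 ≤ b ^ (a + σ) := Real.rpow_nonneg hb _
  have h2 : 0 ≤ u ^ (x * ((a + σ) / σ)) := Real.rpow_nonneg hu _
  by_cases h : u ^ x ≤ b ^ σ
  · rw [Real.rpow_add_of_nonneg hb ha.le hσ.le] at h1 ⊢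
    have := mul_le_mul_of_nonneg_left h (Real.rpow_nonneg hb a)
    linarith
  · push Not at h
    have h3 : b ≤ u ^ (x / σ) := by
      rw [← Real.rpow_le_rpow_iff hb (Real.rpow_nonneg hu _) hσ, ← Real.rpow_mul hu,
        div_mul_cancel₀ _ hσ.ne']
      exact h.le
    have h4 : b ^ a ≤ u ^ (x / σ * a) := by
      rw [Real.rpow_mul hu]; exact Real.rpow_le_rpow hb h3 ha.le
    have h5 : u ^ (x * ((a + σ) / σ)) = u ^ (x / σ * a) * u ^ x := by
      rw [← Real.rpow_add_of_nonneg hu (by positivity) hx.le]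
      congr 1; field_simp
    have := mul_le_mul_of_nonneg_right h4 (Real.rpow_nonneg hu x)
    linarith

/-- Weighted arithmetic-geometric mean with weights p and 1 - p. The second exponent of u is forced
by matching powers, and it is below 1, so that only moments of |X|_α of order below 1 are needed
there. -/
theorem rpow_mul_rpow_le_cross {v w u p x : ℝ} (hv : 0 ≤ v) (hw : 0 ≤ w) (hu : 0 ≤ u)
    (hp : 0 < p) (hp1 : p < 1) (hx : 0 < x) (hxp : x ≤ 1 - p) :
    v ^ p * (w * u) ^ (1 - p) ≤ v * u ^ x + w * u ^ (1 - x * p / (1 - p)) := by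
  have h1p : 0 < 1 - p := by linarith
  have hy : 0 ≤ 1 - x * p / (1 - p) := by
    rw [sub_nonneg, div_le_one h1p]; nlinarith
  set y := 1 - x * p / (1 - p) with hydef
  have ha : 0 ≤ v * u ^ x := mul_nonneg hv (Real.rpow_nonneg hu _)
  have hb : 0 ≤ w * u ^ y := mul_nonneg hw (Real.rpow_nonneg hu _)
  have h := Real.geom_mean_le_arith_mean2_weighted hp.le h1p.le ha hb (by ring)
  have e : (v * u ^ x) ^ p * (w * u ^ y) ^ (1 - p) = v ^ p * (w * u) ^ (1 - p) := by
    have e1 : u ^ (1 - p) = u ^ (x * p) * u ^ (y * (1 - p)) := by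
      rw [← Real.rpow_add_of_nonneg hu (by positivity) (by positivity)]
      congr 1
      rw [hydef]; field_simp; ring
    rw [Real.mul_rpow hv (Real.rpow_nonneg hu _), Real.mul_rpow hw (Real.rpow_nonneg hu _),
      Real.mul_rpow hw hu, ← Real.rpow_mul hu, ← Real.rpow_mul hu, e1]
    ring
  rw [e] at h
  nlinarith

namespace HomogeneousSRE

variable {d : ℕ} {Ω : Type*} [MeasurableSpace Ω] {P : Measure Ω}
  {A B X : Ω → Fin d → ℝ} {α : Fin d → ℝ} {W : Ω → ℝ} {p : ℝ}

theorem not_ae_eq_one (h : HomogeneousSRE P A B X α W p) : ¬ ∀ᵐ ω ∂P, W ω = 1 := fun hW =>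
  h.nonarithmetic 0 (hW.mono fun ω hω _ => by simp [hω])

theorem measurable_U (h : HomogeneousSRE P A B X α W p) :
    Measurable (fun ω => alphaNorm α (X ω)) := (measurable_alphaNorm h.α_pos).comp h.measurable_X

theorem measurable_V (h : HomogeneousSRE P A B X α W p) :
    Measurable (fun ω => alphaNorm α (B ω)) := (measurable_alphaNorm h.α_pos).comp h.measurable_B

theorem indep_W_U (h : HomogeneousSRE P A B X α W p) :
    IndepFun W (fun ω => alphaNorm α (X ω)) P :=
  h.indep_W.comp measurable_id (measurable_alphaNorm h.α_pos)

theorem alphaNorm_mul_ae (h : HomogeneousSRE P A B X α W p) :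
    ∀ᵐ ω ∂P, ∀ x : Fin d → ℝ, alphaNorm α (A ω * x) = W ω * alphaNorm α x := by
  filter_upwards [h.W_eq] with ω hω x
  exact alphaNorm_mul (h.W_nonneg ω) hω

variable [IsProbabilityMeasure P]

theorem integrable_V (h : HomogeneousSRE P A B X α W p) :
    Integrable (fun ω => alphaNorm α (B ω)) P := by
  have hB : ∀ j, Integrable (fun ω => |B ω j| ^ α j) P := by
    rcases h.moment with hm | hm
    · intro j
      obtain ⟨σ, hσ, hi⟩ := hm j
      have hmeas : Measurable fun ω => |B ω j| := ((measurable_pi_apply j).comp h.measurable_B).abs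
      refine ((integrable_const (1 : ℝ)).add hi).mono' (hmeas.pow_const _).aestronglyMeasurable
        (ae_of_all _ fun ω => ?_)
      have hb := abs_nonneg (B ω j)
      rw [Real.norm_of_nonneg (Real.rpow_nonneg hb _), Pi.add_apply]
      have h0 : 0 ≤ |B ω j| ^ (α j + σ) := Real.rpow_nonneg hb _
      rcases le_total |B ω j| 1 with h1 | h1
      · have := Real.rpow_le_one hb h1 (h.α_pos j).le
        linarith
      · have := Real.rpow_le_rpow_of_exponent_le h1 (by linarith : α j ≤ α j + σ)
        linarith
    · exact hm.2
  refine (integrable_finsetSum Finset.univ fun j _ => hB j).mono'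
    h.measurable_V.aestronglyMeasurable (ae_of_all _ fun ω => ?_)
  rw [Real.norm_of_nonneg alphaNorm_nonneg]
  exact alphaNorm_le_sum

theorem integrable_U_rpow (h : HomogeneousSRE P A B X α W p) {y : ℝ} (hy : 0 < y) (hy1 : y < 1) :
    Integrable (fun ω => alphaNorm α (X ω) ^ y) P := by
  refine integrable_rpow_of_subadditive (U' := fun ω => alphaNorm α (A ω * X ω + B ω))
    (V := fun ω => alphaNorm α (B ω)) (W := W) (p := p) h.measurable_U h.W_nonneg
    (fun _ => alphaNorm_nonneg) (fun _ => alphaNorm_nonneg) (fun _ => alphaNorm_nonneg)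
    h.indep_W_U (h.ident.comp (measurable_alphaNorm h.α_pos)) h.p_pos ?_
    (fun y hy hy1 => integrable_rpow_and_integral_lt_one h.measurable_W h.W_nonneg h.integrable_W
      h.integral_W h.not_ae_eq_one hy hy1) (fun y hy hy1 => ?_) hy hy1
  · filter_upwards [h.alphaNorm_mul_ae] with ω hω
    rw [← hω]
    exact alphaNorm_add_rpow_le h.α_pos h.p_pos h.α_mul_p_le
  · refine ((integrable_const (1 : ℝ)).add h.integrable_V).mono'
      (h.measurable_V.pow_const _).aestronglyMeasurable (ae_of_all _ fun ω => ?_)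
    have hb : 0 ≤ alphaNorm α (B ω) := alphaNorm_nonneg
    rw [Real.norm_of_nonneg (Real.rpow_nonneg hb _), Pi.add_apply]
    rcases le_total (alphaNorm α (B ω)) 1 with h1 | h1
    · have := Real.rpow_le_one hb h1 hy.le
      linarith
    · have := Real.rpow_le_rpow_of_exponent_le h1 hy1.le
      rw [Real.rpow_one] at this
      linarith

/-- The two moment conditions meet here. With extra moments of B, x is taken so small that every
x(α_j + σ_j)/σ_j is below 1; if X and B are independent, the expectation factorizes and x = 1 - p
serves. -/
theorem exists_integrable_V_mul_U (h : HomogeneousSRE P A B X α W p) :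
    ∃ x : ℝ, 0 < x ∧ x ≤ 1 - p ∧
      Integrable (fun ω => alphaNorm α (B ω) * alphaNorm α (X ω) ^ x) P := by
  have hp1 := h.p_lt_one
  have hp0 := h.p_pos
  rcases h.moment with hm | hm
  · choose σ hσ hi using hm
    have hpos : ∀ j, 0 < (α j + σ j) / σ j := fun j => by
      have := h.α_pos j; have := hσ j; positivity
    have hs0 : 0 ≤ ∑ j, (α j + σ j) / σ j := Finset.sum_nonneg fun j _ => (hpos j).le
    set x : ℝ := (1 - p) / (1 + ∑ j, (α j + σ j) / σ j) with hx
    have hx0 : 0 < x := div_pos (by linarith) (by linarith)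
    have hxj : ∀ j, x * ((α j + σ j) / σ j) < 1 := by
      intro j
      have := Finset.single_le_sum (f := fun j => (α j + σ j) / σ j) (fun j _ => (hpos j).le)
        (Finset.mem_univ j)
      rw [hx, div_mul_eq_mul_div, div_lt_one (by linarith)]
      nlinarith [hpos j]
    refine ⟨x, hx0, div_le_self (by linarith) (by linarith), ?_⟩
    refine (integrable_finsetSum Finset.univ fun j _ => (hi j).add
      (h.integrable_U_rpow (mul_pos hx0 (hpos j)) (hxj j))).mono'
      (h.measurable_V.mul (h.measurable_U.pow_const _)).aestronglyMeasurable
      (ae_of_all _ fun ω => ?_)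
    have hU0 : 0 ≤ alphaNorm α (X ω) := alphaNorm_nonneg
    rw [Real.norm_of_nonneg (mul_nonneg alphaNorm_nonneg (Real.rpow_nonneg hU0 _))]
    refine (mul_le_mul_of_nonneg_right alphaNorm_le_sum (Real.rpow_nonneg hU0 _)).trans ?_
    rw [Finset.sum_mul]
    exact Finset.sum_le_sum fun j _ =>
      rpow_mul_rpow_le_add (abs_nonneg _) hU0 (h.α_pos j) (hσ j) hx0
  · refine ⟨1 - p, by linarith, le_rfl, ?_⟩
    have hind : IndepFun (fun ω => alphaNorm α (X ω) ^ (1 - p)) (fun ω => alphaNorm α (B ω)) P :=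
      hm.1.comp ((measurable_alphaNorm h.α_pos).pow_const (1 - p)) (measurable_alphaNorm h.α_pos)
    exact hind.symm.integrable_mul h.integrable_V (h.integrable_U_rpow (by linarith) (by linarith))

/-- This is the quantity that controls the inhomogeneity of the renewal equation, summed over all
scales. -/
theorem integrable_V_mul_max (h : HomogeneousSRE P A B X α W p) :
    Integrable (fun ω => alphaNorm α (B ω) ^ p
      * max (W ω * alphaNorm α (X ω)) (alphaNorm α (B ω)) ^ (1 - p)) P := by
  have hp1 := h.p_lt_one
  have hp0 := h.p_pos
  obtain ⟨x, hx0, hxp, hxi⟩ := h.exists_integrable_V_mul_U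
  have hy0 : 0 < 1 - x * p / (1 - p) := by
    rw [sub_pos, div_lt_one (by linarith)]; nlinarith
  have hy1 : 1 - x * p / (1 - p) < 1 := by
    have : 0 < x * p / (1 - p) := div_pos (by positivity) (by linarith)
    linarith
  have hWU : Integrable (fun ω => W ω * alphaNorm α (X ω) ^ (1 - x * p / (1 - p))) P := by
    have := integrable_rpow_mul_comp (y := 1) (q := fun u => u ^ (1 - x * p / (1 - p))) h.indep_W_U
      (by simpa using h.integrable_W) (by fun_prop) (h.integrable_U_rpow hy0 hy1)
    simpa using this.1
  refine ((hxi.add hWU).add h.integrable_V).mono' ?_ (ae_of_all _ fun ω => ?_)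
  · exact ((h.measurable_V.pow_const _).mul
      (((h.measurable_W.mul h.measurable_U).max h.measurable_V).pow_const _)).aestronglyMeasurable
  · have hV0 : 0 ≤ alphaNorm α (B ω) := alphaNorm_nonneg
    have hU0 : 0 ≤ alphaNorm α (X ω) := alphaNorm_nonneg
    have hW0 := h.W_nonneg ω
    have hm0 : 0 ≤ max (W ω * alphaNorm α (X ω)) (alphaNorm α (B ω)) := le_max_of_le_right hV0
    rw [Real.norm_of_nonneg (mul_nonneg (Real.rpow_nonneg hV0 _) (Real.rpow_nonneg hm0 _))]
    have h1 := rpow_mul_rpow_le_cross hV0 hW0 hU0 hp0 hp1 hx0 hxp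
    have h2 : 0 ≤ alphaNorm α (B ω) * alphaNorm α (X ω) ^ x := by positivity
    have h3 : 0 ≤ W ω * alphaNorm α (X ω) ^ (1 - x * p / (1 - p)) := by positivity
    simp only [Pi.add_apply]
    rcases max_cases (W ω * alphaNorm α (X ω)) (alphaNorm α (B ω)) with hc | hc
    · rw [hc.1]; linarith
    · rw [hc.1, ← Real.rpow_add_of_nonneg hV0 hp0.le (by linarith), add_sub_cancel, Real.rpow_one]
      linarith

end HomogeneousSRE

end DiagonalSRE
end

noncomputable section
namespace DiagonalSRE

/-! ### Changes of sign as a group action. -/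

section Signs

variable {d : ℕ} {α : Fin d → ℝ} {x y : Fin d → ℝ}

/-- The sign `(-1)^e`. -/
def signOf (e : ZMod 2) : ℝ := if e = 0 then 1 else -1

/-- Change the signs of the coordinates. -/
def flipSigns (e : Fin d → ZMod 2) (x : Fin d → ℝ) : Fin d → ℝ := fun j => signOf (e j) * x j

/-- The signs of the coordinates of a vector. -/
def signVec (a : Fin d → ℝ) : Fin d → ZMod 2 := fun j => if a j < 0 then 1 else 0

theorem signOf_sub (a b : ZMod 2) : signOf (a - b) = signOf a * signOf b := by
  have h : ∀ a b : ZMod 2, a - b = 0 ↔ (a = 0 ↔ b = 0) := by decide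
  unfold signOf
  by_cases ha : a = 0 <;> by_cases hb : b = 0 <;> simp [h, ha, hb]

theorem abs_signOf (a : ZMod 2) : |signOf a| = 1 := by
  unfold signOf; split_ifs <;> simp

theorem alphaNorm_flipSigns (e : Fin d → ZMod 2) :
    alphaNorm α (flipSigns e x) = alphaNorm α x :=
  alphaNorm_congr fun j => by rw [flipSigns, abs_mul, abs_signOf, one_mul]

theorem flipSigns_zero : flipSigns 0 x = x := by
  ext j; simp [flipSigns, signOf]

theorem flipSigns_add (e : Fin d → ZMod 2) : flipSigns e (x + y) = flipSigns e x + flipSigns e y := by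
  ext j; simp [flipSigns, mul_add]

theorem dilation_add (t : ℝ) : dilation α t (x + y) = dilation α t x + dilation α t y := by
  ext j; simp [dilation, mul_add]

/-- Multiplication by `a` splits into its modulus, a dilation, and its signs. Subtraction in (ℤ/2)^d
equals addition and is used so that the renewal equation takes the form of a convolution. -/
theorem dilation_flipSigns_sub (hα : ∀ j, 0 < α j) {w : ℝ} {a : Fin d → ℝ}
    (h : ∀ j, |a j| ^ α j = w) (e : Fin d → ZMod 2) :
    dilation α w (flipSigns (e - signVec a) x) = flipSigns e (a * x) := by
  ext j
  have h1 : w ^ (1 / α j) = |a j| := by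
    rw [← h j, ← Real.rpow_mul (abs_nonneg _), mul_one_div_cancel (hα j).ne', Real.rpow_one]
  have h2 : |a j| * signOf (signVec a j) = a j := by
    unfold signOf signVec
    by_cases ha : a j < 0
    · simp [ha, abs_of_neg ha]
    · simp [ha, abs_of_nonneg (not_lt.1 ha)]
  simp only [dilation, flipSigns, h1, Pi.sub_apply, signOf_sub, Pi.mul_apply]
  calc _ = signOf (e j) * ((|a j| * signOf (signVec a j)) * x j) := by ring
    _ = _ := by rw [h2]

theorem measurable_signVec : Measurable (signVec : (Fin d → ℝ) → Fin d → ZMod 2) := by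
  refine measurable_pi_lambda _ fun j => ?_
  exact Measurable.ite (measurableSet_lt (by fun_prop) measurable_const) measurable_const
    measurable_const

theorem measurable_flipSigns :
    Measurable fun z : (Fin d → ZMod 2) × (Fin d → ℝ) => flipSigns z.1 z.2 := by
  refine measurable_pi_lambda _ fun j => ?_
  have : Measurable signOf := measurable_of_finite _
  simp only [flipSigns]
  fun_prop

end Signs

/-! ### Scaled means and their renewal equation. -/

section ScaledMean

variable {d : ℕ} {Ω : Type*} [MeasurableSpace Ω] {P : Measure Ω} {α : Fin d → ℝ}

/-- The function `(s, e) ↦ e^s E f(δ_{e^{-s}} (e X))`. -/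
def scaledMean (P : Measure Ω) (X : Ω → Fin d → ℝ) (α : Fin d → ℝ) (f : (Fin d → ℝ) → ℝ)
    (z : ℝ × (Fin d → ZMod 2)) : ℝ :=
  Real.exp z.1 * ∫ ω, f (dilation α (Real.exp (-z.1)) (flipSigns z.2 (X ω))) ∂P

/-- The law of `(log W, sign A)` under the tilted measure `W dP`. -/
def tiltedLaw (P : Measure Ω) (A : Ω → Fin d → ℝ) (W : Ω → ℝ) : Measure (ℝ × (Fin d → ZMod 2)) :=
  (P.withDensity fun ω => ENNReal.ofReal (W ω)).map fun ω => (Real.log (W ω), signVec (A ω))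

theorem measurable_scaledArg {X : Ω → Fin d → ℝ} (hX : Measurable X) :
    Measurable fun z : (ℝ × (Fin d → ZMod 2)) × Ω =>
      dilation α (Real.exp (-z.1.1)) (flipSigns z.1.2 (X z.2)) := by
  have h1 : Measurable fun z : (ℝ × (Fin d → ZMod 2)) × Ω => flipSigns z.1.2 (X z.2) :=
    measurable_flipSigns.comp (f := fun z : (ℝ × (Fin d → ZMod 2)) × Ω => (z.1.2, X z.2))
      (by fun_prop)
  exact measurable_dilation.comp (f := fun z : (ℝ × (Fin d → ZMod 2)) × Ω =>
    (Real.exp (-z.1.1), flipSigns z.1.2 (X z.2))) (by fun_prop)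

theorem measurable_scaledMean [SFinite P] {X : Ω → Fin d → ℝ} (hX : Measurable X)
    {f : (Fin d → ℝ) → ℝ} (hf : Measurable f) : Measurable (scaledMean P X α f) := by
  have h1 : StronglyMeasurable fun z : (ℝ × (Fin d → ZMod 2)) × Ω =>
      f (dilation α (Real.exp (-z.1.1)) (flipSigns z.1.2 (X z.2))) :=
    (hf.comp (measurable_scaledArg hX)).stronglyMeasurable
  have h2 := h1.integral_prod_right' (ν := P)
  unfold scaledMean
  exact (by fun_prop : Measurable fun z : ℝ × (Fin d → ZMod 2) => Real.exp z.1).mul h2.measurable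

theorem measurable_scaledArg_right {X : Ω → Fin d → ℝ} (hX : Measurable X)
    (z : ℝ × (Fin d → ZMod 2)) :
    Measurable fun ω => dilation α (Real.exp (-z.1)) (flipSigns z.2 (X ω)) :=
  (measurable_scaledArg (α := α) hX).comp (f := fun ω => (z, ω)) (by fun_prop)

theorem isProbabilityMeasure_tiltedLaw {A : Ω → Fin d → ℝ} {W : Ω → ℝ} (hA : Measurable A)
    (hW : Measurable W) (hW0 : ∀ ω, 0 ≤ W ω) (hWi : Integrable W P) (hW1 : ∫ ω, W ω ∂P = 1) :
    IsProbabilityMeasure (tiltedLaw P A W) := by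
  have : IsProbabilityMeasure (P.withDensity fun ω => ENNReal.ofReal (W ω)) := by
    constructor
    rw [withDensity_apply _ MeasurableSet.univ, Measure.restrict_univ,
      ← ofReal_integral_eq_lintegral_ofReal hWi (ae_of_all _ hW0), hW1, ENNReal.ofReal_one]
  exact Measure.isProbabilityMeasure_map
    (hW.log.prodMk (measurable_signVec.comp hA)).aemeasurable

theorem integral_tiltedLaw {A : Ω → Fin d → ℝ} {W : Ω → ℝ} (hA : Measurable A)
    (hW : Measurable W) (hW0 : ∀ ω, 0 ≤ W ω) {g : ℝ × (Fin d → ZMod 2) → ℝ} (hg : Measurable g) :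
    ∫ y, g y ∂tiltedLaw P A W = ∫ ω, W ω * g (Real.log (W ω), signVec (A ω)) ∂P := by
  have hm : Measurable fun ω => (Real.log (W ω), signVec (A ω)) :=
    hW.log.prodMk (measurable_signVec.comp hA)
  rw [tiltedLaw, integral_map hm.aemeasurable
    hg.aestronglyMeasurable, integral_withDensity_eq_integral_toReal_smul (by fun_prop)
    (ae_of_all _ fun _ => ENNReal.ofReal_lt_top)]
  congr 1 with ω
  rw [ENNReal.toReal_ofReal (hW0 ω), smul_eq_mul]

theorem integrable_tiltedLaw {A : Ω → Fin d → ℝ} {W : Ω → ℝ} (hA : Measurable A)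
    (hW : Measurable W) (hW0 : ∀ ω, 0 ≤ W ω) {g : ℝ × (Fin d → ZMod 2) → ℝ} (hg : Measurable g) :
    Integrable g (tiltedLaw P A W) ↔
      Integrable (fun ω => W ω * g (Real.log (W ω), signVec (A ω))) P := by
  have hm : Measurable fun ω => (Real.log (W ω), signVec (A ω)) :=
    hW.log.prodMk (measurable_signVec.comp hA)
  rw [tiltedLaw, integrable_map_measure hg.aestronglyMeasurable
    hm.aemeasurable,
    integrable_withDensity_iff_integrable_smul' (by fun_prop)
    (ae_of_all _ fun _ => ENNReal.ofReal_lt_top)]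
  refine integrable_congr (ae_of_all _ fun ω => ?_)
  simp only [ENNReal.toReal_ofReal (hW0 ω), smul_eq_mul, Function.comp_apply]

theorem ae_tiltedLaw {A : Ω → Fin d → ℝ} {W : Ω → ℝ} (hA : Measurable A)
    (hW : Measurable W) (hW0 : ∀ ω, 0 ≤ W ω) {q : ℝ → Prop} (hq : MeasurableSet {s | q s})
    (h : ∀ᵐ y ∂tiltedLaw P A W, q y.1) : ∀ᵐ ω ∂P, W ω ≠ 0 → q (Real.log (W ω)) := by
  have hm : Measurable fun ω => (Real.log (W ω), signVec (A ω)) :=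
    hW.log.prodMk (measurable_signVec.comp hA)
  rw [tiltedLaw, ae_map_iff (p := fun y => q y.1) hm.aemeasurable (measurable_fst hq),
    ae_withDensity_iff (by fun_prop)] at h
  filter_upwards [h] with ω hω hne
  exact hω (by simpa using lt_of_le_of_ne (hW0 ω) (Ne.symm hne))

end ScaledMean

namespace HomogeneousSRE

variable {d : ℕ} {Ω : Type*} [MeasurableSpace Ω] {P : Measure Ω} [IsProbabilityMeasure P]
  {A B X : Ω → Fin d → ℝ} {α : Fin d → ℝ} {W : Ω → ℝ} {p : ℝ}

/-- Condition on A, which is independent of X: A shifts (s, e) by (log W, sign A), and rewriting e^s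
as W e^{s - log W} produces the tilting density W. -/
theorem scaledMean_mul_eq (h : HomogeneousSRE P A B X α W p) {f : (Fin d → ℝ) → ℝ}
    (hf : Measurable f) {M : ℝ} (hM : ∀ x, |f x| ≤ M) (hf0 : f 0 = 0)
    (z : ℝ × (Fin d → ZMod 2)) :
    scaledMean P (fun ω => A ω * X ω) α f z
      = ∫ y, scaledMean P X α f (z - y) ∂tiltedLaw P A W := by
  have hGm : Measurable fun y => scaledMean P X α f (z - y) :=
    (measurable_scaledMean h.measurable_X hf).comp (by fun_prop)
  rw [integral_tiltedLaw h.measurable_A h.measurable_W h.W_nonneg hGm]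
  set F : (Fin d → ℝ) × (Fin d → ℝ) → ℝ := fun q =>
    f (dilation α (Real.exp (-z.1)) (flipSigns z.2 (q.1 * q.2))) with hF
  have hFm : Measurable F := by
    have h1 : Measurable fun q : (Fin d → ℝ) × (Fin d → ℝ) => flipSigns z.2 (q.1 * q.2) :=
      measurable_flipSigns.comp (f := fun q : (Fin d → ℝ) × (Fin d → ℝ) => (z.2, q.1 * q.2))
        (by fun_prop)
    exact hf.comp ((continuous_dilation _).measurable.comp h1)
  have hprod : ∫ ω, F (A ω, X ω) ∂P = ∫ ω, ∫ ω', F (A ω, X ω') ∂P ∂P := by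
    have : IsProbabilityMeasure (P.map A) :=
      Measure.isProbabilityMeasure_map h.measurable_A.aemeasurable
    have : IsProbabilityMeasure (P.map X) :=
      Measure.isProbabilityMeasure_map h.measurable_X.aemeasurable
    have h1 := (indepFun_iff_map_prod_eq_prod_map_map h.measurable_A.aemeasurable
      h.measurable_X.aemeasurable).1 h.indep
    have h2 : ∫ ω, F (A ω, X ω) ∂P = ∫ q, F q ∂(P.map fun ω => (A ω, X ω)) :=
      (integral_map (h.measurable_A.prodMk h.measurable_X).aemeasurable
        hFm.aestronglyMeasurable).symm
    have hi : Integrable F ((P.map A).prod (P.map X)) :=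
      Integrable.of_bound hFm.aestronglyMeasurable M (ae_of_all _ fun q => by simpa using hM _)
    rw [h2, h1, integral_prod _ hi, integral_map h.measurable_A.aemeasurable
      hi.integral_prod_left.aestronglyMeasurable]
    · congr 1 with ω
      have hm : Measurable fun y => F (A ω, y) := hFm.comp measurable_prodMk_left
      rw [integral_map h.measurable_X.aemeasurable hm.aestronglyMeasurable]
  have e1 : scaledMean P (fun ω => A ω * X ω) α f z
      = ∫ ω, Real.exp z.1 * ∫ ω', F (A ω, X ω') ∂P ∂P := by
    rw [integral_const_mul, ← hprod]; rfl
  rw [e1]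
  refine integral_congr_ae ?_
  filter_upwards [h.W_eq] with ω hω
  rcases (h.W_nonneg ω).eq_or_lt with h0 | h0
  -- Where W = 0 the value of log W is meaningless, but the weight W removes the right-hand side,
  -- and A = 0 together with f(0) = 0 removes the left.
  · have hA0 : A ω = 0 := by
      ext j
      have := hω j
      rw [← h0, Real.rpow_eq_zero (abs_nonneg _) (h.α_pos j).ne'] at this
      simpa using this
    have : ∀ ω', F (A ω, X ω') = 0 := fun ω' => by
      simp only [hF, hA0, zero_mul]
      convert hf0
      ext j; simp [dilation, flipSigns]
    simp [this, ← h0]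
  · have e2 : ∀ ω', F (A ω, X ω') = f (dilation α (Real.exp (-(z - (Real.log (W ω),
        signVec (A ω))).1)) (flipSigns (z - (Real.log (W ω), signVec (A ω))).2 (X ω'))) := by
      intro ω'
      simp only [hF, Prod.fst_sub, Prod.snd_sub]
      rw [← dilation_flipSigns_sub h.α_pos hω, dilation_dilation (Real.exp_pos _).le h0.le,
        show -(z.1 - Real.log (W ω)) = -z.1 + Real.log (W ω) by ring, Real.exp_add,
        Real.exp_log h0]
    simp only [e2, scaledMean]
    rw [← mul_assoc, Prod.fst_sub, Real.exp_sub, Real.exp_log h0, mul_div_cancel₀ _ h0.ne']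

/-- The renewal equation for scaled means. -/
theorem renewal_equation (h : HomogeneousSRE P A B X α W p) {f : (Fin d → ℝ) → ℝ}
    (hf : Measurable f) {M : ℝ} (hM : ∀ x, |f x| ≤ M) (hf0 : f 0 = 0)
    (z : ℝ × (Fin d → ZMod 2)) :
    scaledMean P X α f z = ∫ y, scaledMean P X α f (z - y) ∂tiltedLaw P A W
      + (scaledMean P (fun ω => A ω * X ω + B ω) α f z
        - scaledMean P (fun ω => A ω * X ω) α f z) := by
  rw [← h.scaledMean_mul_eq hf hM hf0 z, add_sub_cancel]
  have hm : Measurable fun x : Fin d → ℝ =>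
      f (dilation α (Real.exp (-z.1)) (flipSigns z.2 x)) :=
    hf.comp (measurable_scaledArg_right measurable_id z)
  simp only [scaledMean]
  congr 1
  exact (h.ident.comp hm).integral_eq

end HomogeneousSRE

end DiagonalSRE
end

/-! ### Verification of the hypotheses of the renewal theorem for test functions. -/

noncomputable section
namespace DiagonalSRE

-- A geometric series running downwards from the largest integer below log T is comparable to its
-- top term.
open scoped ENNReal in
theorem tsum_exp_le {κ T : ℝ} (hκ : 0 < κ) (hT : 0 < T) :
    ∑' i : ℤ, (if Real.exp i ≤ T then ENNReal.ofReal (Real.exp (κ * i)) else 0)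
      ≤ ENNReal.ofReal (T ^ κ) * (1 - ENNReal.ofReal (Real.exp (-κ)))⁻¹ := by
  set n : ℤ := ⌊Real.log T⌋ with hn
  calc ∑' i : ℤ, (if Real.exp i ≤ T then ENNReal.ofReal (Real.exp (κ * i)) else 0)
      ≤ ∑' i : ℤ, ∑' k : ℕ, if i = n - k then ENNReal.ofReal (Real.exp (κ * i)) else 0 := by
        gcongr with i
        split_ifs with hi
        · have hin : i ≤ n := by
            rw [hn, Int.le_floor, Real.le_log_iff_exp_le hT]; exact hi
          refine le_trans ?_ (ENNReal.le_tsum (n - i).toNat)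
          rw [if_pos]
          rw [Int.toNat_of_nonneg (by linarith)]; ring
        · exact zero_le
    _ = ∑' k : ℕ, ENNReal.ofReal (Real.exp (κ * ((n - k : ℤ) : ℝ))) := by
        rw [ENNReal.tsum_comm]
        congr 1 with k
        rw [tsum_ite_eq (n - (k : ℤ)) fun i : ℤ => ENNReal.ofReal (Real.exp (κ * i))]
    _ = ∑' k : ℕ, ENNReal.ofReal (Real.exp (κ * n)) * ENNReal.ofReal (Real.exp (-κ)) ^ k := by
        congr 1 with k
        rw [← ENNReal.ofReal_pow (Real.exp_pos _).le, ← ENNReal.ofReal_mul (Real.exp_pos _).le,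
          ← Real.exp_nat_mul, ← Real.exp_add]
        push_cast
        ring_nf
    _ = ENNReal.ofReal (Real.exp (κ * n)) * (1 - ENNReal.ofReal (Real.exp (-κ)))⁻¹ := by
        rw [ENNReal.tsum_mul_left, ENNReal.tsum_geometric]
    _ ≤ _ := by
        gcongr
        rw [Real.rpow_def_of_pos hT, mul_comm]
        gcongr
        exact Int.floor_le _

/-- A bounded test function which is Lipschitz for the metric `|x - y|_α ^ p` and vanishes on a
ball around the origin. -/
structure IsTestFunction {d : ℕ} (α : Fin d → ℝ) (p : ℝ) (f : (Fin d → ℝ) → ℝ) (L M r : ℝ) :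
    Prop where
  L_nonneg : 0 ≤ L
  r_pos : 0 < r
  lipschitz : ∀ x y, |f x - f y| ≤ L * alphaNorm α (x - y) ^ p
  bounded : ∀ x, |f x| ≤ M
  vanish : ∀ x, alphaNorm α x < r → f x = 0

namespace IsTestFunction

variable {d : ℕ} {α : Fin d → ℝ} {p : ℝ} {f : (Fin d → ℝ) → ℝ} {L M r : ℝ}

theorem continuous (hf : IsTestFunction α p f L M r) (hα : ∀ j, 0 < α j) (hp : 0 < p) :
    Continuous f := by
  rw [continuous_iff_continuousAt]
  intro x
  rw [ContinuousAt, tendsto_iff_dist_tendsto_zero]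
  have h1 : Tendsto (fun y => L * alphaNorm α (y - x) ^ p) (𝓝 x) (𝓝 0) := by
    have hc : Continuous fun y => L * alphaNorm α (y - x) ^ p :=
      continuous_const.mul (((continuous_alphaNorm hα).comp (by fun_prop)).rpow_const
        fun y => Or.inr hp.le)
    have := hc.tendsto x
    rwa [sub_self, alphaNorm_zero hα, Real.zero_rpow hp.ne', mul_zero] at this
  exact squeeze_zero (fun _ => dist_nonneg) (fun y => hf.lipschitz y x) h1

theorem map_zero (hf : IsTestFunction α p f L M r) (hα : ∀ j, 0 < α j) : f 0 = 0 :=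
  hf.vanish 0 (by rw [alphaNorm_zero hα]; exact hf.r_pos)

theorem M_nonneg (hf : IsTestFunction α p f L M r) : 0 ≤ M := (abs_nonneg _).trans (hf.bounded 0)

/-- Increments of a test function vanish when both arguments are small. -/
theorem abs_add_sub_le (hf : IsTestFunction α p f L M r) (hα : ∀ j, 0 < α j) (hp : 0 < p)
    (hαp : ∀ j, α j * p ≤ 1) (x b : Fin d → ℝ) :
    |f (x + b) - f x| ≤ if r * (1 / 2) ^ (1 / p) ≤ max (alphaNorm α x) (alphaNorm α b)
      then L * alphaNorm α b ^ p else 0 := by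
  split_ifs with h
  · simpa using hf.lipschitz (x + b) x
  · push Not at h
    have hr := hf.r_pos
    -- The threshold is chosen so that x and b each contribute less than r^p/2, whence both x and x
    -- + b lie in the ball where f vanishes.
    have e : (r * (1 / 2) ^ (1 / p)) ^ p = r ^ p / 2 := by
      rw [Real.mul_rpow hr.le (by positivity), ← Real.rpow_mul (by norm_num),
        one_div_mul_cancel hp.ne', Real.rpow_one]
      ring
    have hx := Real.rpow_lt_rpow alphaNorm_nonneg ((le_max_left _ _).trans_lt h) hp
    have hb := Real.rpow_lt_rpow alphaNorm_nonneg ((le_max_right _ _).trans_lt h) hp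
    rw [e] at hx hb
    have hxb := alphaNorm_add_rpow_le (x := x) (y := b) hα hp hαp
    have hrp : 0 < r ^ p := Real.rpow_pos_of_pos hr p
    have h1 : alphaNorm α (x + b) < r :=
      (Real.rpow_lt_rpow_iff alphaNorm_nonneg hr.le hp).1 (by linarith)
    have h2 : alphaNorm α x < r :=
      (Real.rpow_lt_rpow_iff alphaNorm_nonneg hr.le hp).1 (by linarith)
    simp [hf.vanish _ h1, hf.vanish _ h2]

end IsTestFunction

namespace HomogeneousSRE

variable {d : ℕ} {Ω : Type*} [MeasurableSpace Ω] {P : Measure Ω}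
  {A B X : Ω → Fin d → ℝ} {α : Fin d → ℝ} {W : Ω → ℝ} {p : ℝ} {f : (Fin d → ℝ) → ℝ} {L M r : ℝ}

/-- The inhomogeneity of the renewal equation. -/
def defect (P : Measure Ω) (A B X : Ω → Fin d → ℝ) (α : Fin d → ℝ) (f : (Fin d → ℝ) → ℝ)
    (z : ℝ × (Fin d → ZMod 2)) : ℝ :=
  scaledMean P (fun ω => A ω * X ω + B ω) α f z - scaledMean P (fun ω => A ω * X ω) α f z

theorem isProbabilityMeasure_tilted (h : HomogeneousSRE P A B X α W p) :
    IsProbabilityMeasure (tiltedLaw P A W) :=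
  isProbabilityMeasure_tiltedLaw h.measurable_A h.measurable_W h.W_nonneg h.integrable_W
    h.integral_W

theorem isTestFunction_tail (h : HomogeneousSRE P A B X α W p) :
    IsTestFunction α p (fun x => min 1 (max 0 (2 * alphaNorm α x ^ p - 1))) 2 1
      ((1 / 2) ^ (1 / p)) where
  L_nonneg := by norm_num
  r_pos := by positivity
  lipschitz x y := by
    refine (abs_min_sub_min_le_max _ _ _ _).trans ?_
    have h1 := abs_alphaNorm_rpow_sub_le (x := x) (y := y) h.α_pos h.p_pos h.α_mul_p_le
    have h0 : 0 ≤ alphaNorm α (x - y) ^ p := Real.rpow_nonneg alphaNorm_nonneg _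
    refine max_le (by simpa using h0) ((abs_max_sub_max_le_max _ _ _ _).trans
      (max_le (by simpa using h0) ?_))
    rw [show 2 * alphaNorm α x ^ p - 1 - (2 * alphaNorm α y ^ p - 1)
      = 2 * (alphaNorm α x ^ p - alphaNorm α y ^ p) by ring, abs_mul, abs_two]
    linarith
  bounded x := by
    rw [abs_of_nonneg (le_min (by norm_num) (le_max_left _ _))]
    exact min_le_left _ _
  vanish x hx := by
    have h1 := Real.rpow_lt_rpow alphaNorm_nonneg hx h.p_pos
    rw [← Real.rpow_mul (by norm_num), one_div_mul_cancel h.p_pos.ne', Real.rpow_one] at h1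
    rw [max_eq_left (by linarith), min_eq_right (by norm_num)]

theorem tilted_nonarithmetic (h : HomogeneousSRE P A B X α W p) (a : ℝ) :
    ¬ ∀ᵐ y ∂tiltedLaw P A W, y.1 ∈ AddSubgroup.zmultiples a := fun hcon => by
  refine h.nonarithmetic a (ae_tiltedLaw h.measurable_A h.measurable_W h.W_nonneg ?_ hcon)
  have : {s : ℝ | s ∈ AddSubgroup.zmultiples a} = Set.range fun k : ℤ => k • a := by
    ext s; simp [AddSubgroup.mem_zmultiples_iff]
  rw [this]
  exact (countable_range _).measurableSet

variable [IsProbabilityMeasure P]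

open scoped ENNReal in
/-- The inhomogeneity is dominated by a summable step function. -/
theorem exists_defect_le (h : HomogeneousSRE P A B X α W p) (hf : IsTestFunction α p f L M r) :
    ∃ b : ℤ → ℝ≥0∞, ∑' i, b i ≠ ∞ ∧ ∀ z, ‖defect P A B X α f z‖ₑ ≤ b ⌊z.1⌋ := by
  have hp0 := h.p_pos
  have hp1 := h.p_lt_one
  have hL := hf.L_nonneg
  set r' : ℝ := r * (1 / 2) ^ (1 / p) with hr'
  have hr'0 : 0 < r' := mul_pos hf.r_pos (by positivity)
  set V : Ω → ℝ := fun ω => alphaNorm α (B ω) with hV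
  have hV0 : ∀ ω, 0 ≤ V ω := fun ω => alphaNorm_nonneg
  set Y : Ω → ℝ := fun ω => max (W ω * alphaNorm α (X ω)) (V ω) with hY
  have hY0 : ∀ ω, 0 ≤ Y ω := fun ω => le_max_of_le_right (hV0 ω)
  have hVm : Measurable V := h.measurable_V
  have hYm : Measurable Y := (h.measurable_W.mul h.measurable_U).max h.measurable_V
  -- This dominates e^s times the increment of f for all s in [i, i + 1): the Lipschitz bound gives
  -- L e^{(1-p)s} V^p, estimated at the right end, and the condition for a nonzero increment is
  -- relaxed to the left end.
  set β : ℤ → Ω → ℝ≥0∞ := fun i ω => if r' * Real.exp i ≤ Y ω then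
    ENNReal.ofReal (L * Real.exp ((1 - p) * (i + 1)) * V ω ^ p) else 0 with hβ
  have hβm : ∀ i, Measurable (β i) := fun i =>
    Measurable.ite (measurableSet_le measurable_const hYm)
      ((hVm.pow_const p).const_mul _).ennreal_ofReal measurable_const
  refine ⟨fun i => ∫⁻ ω, β i ω ∂P, ?_, fun z => ?_⟩
  · rw [← lintegral_tsum fun i => (hβm i).aemeasurable]
    set K : ℝ≥0∞ := ENNReal.ofReal (L * Real.exp (1 - p) * (r' ^ (1 - p))⁻¹)
      * (1 - ENNReal.ofReal (Real.exp (-(1 - p))))⁻¹ with hK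
    have hKt : K ≠ ∞ := by
      refine ENNReal.mul_ne_top ENNReal.ofReal_ne_top (ENNReal.inv_ne_top.2 (tsub_pos_of_lt ?_).ne')
      rw [ENNReal.ofReal_lt_one, Real.exp_lt_one_iff]
      linarith
    -- For fixed ω only levels with e^i ≤ Y/r' contribute, and the sum of e^{(1-p)i} over them is of
    -- order Y^{1-p}; it converges because p < 1.
    have hle : ∀ ω, ∑' i, β i ω ≤ K * ENNReal.ofReal (V ω ^ p * Y ω ^ (1 - p)) := by
      intro ω
      rcases (hY0 ω).eq_or_lt with h0 | h0
      · have : ∀ i, β i ω = 0 := fun i => by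
          simp only [hβ]
          rw [if_neg]
          rw [← h0, not_le]; positivity
        simp [this]
      · have hVp : 0 ≤ V ω ^ p := Real.rpow_nonneg (hV0 ω) p
        have e : ∀ i : ℤ, β i ω = ENNReal.ofReal (L * Real.exp (1 - p) * V ω ^ p)
            * (if Real.exp i ≤ Y ω / r' then ENNReal.ofReal (Real.exp ((1 - p) * i)) else 0) := by
          intro i
          simp only [hβ, le_div_iff₀ hr'0, mul_comm r']
          split_ifs
          · rw [← ENNReal.ofReal_mul (by positivity), mul_add, mul_one, Real.exp_add]
            congr 1; ring
          · simp
        simp_rw [e]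
        rw [ENNReal.tsum_mul_left]
        calc _ ≤ ENNReal.ofReal (L * Real.exp (1 - p) * V ω ^ p)
              * (ENNReal.ofReal ((Y ω / r') ^ (1 - p))
                * (1 - ENNReal.ofReal (Real.exp (-(1 - p))))⁻¹) := by
              gcongr
              exact tsum_exp_le (by linarith) (by positivity)
          _ = (ENNReal.ofReal (L * Real.exp (1 - p) * V ω ^ p)
              * ENNReal.ofReal ((Y ω / r') ^ (1 - p)))
                * (1 - ENNReal.ofReal (Real.exp (-(1 - p))))⁻¹ := by ring
          _ = (ENNReal.ofReal (L * Real.exp (1 - p) * (r' ^ (1 - p))⁻¹)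
              * ENNReal.ofReal (V ω ^ p * Y ω ^ (1 - p)))
                * (1 - ENNReal.ofReal (Real.exp (-(1 - p))))⁻¹ := by
              rw [← ENNReal.ofReal_mul (by positivity), ← ENNReal.ofReal_mul (by positivity),
                Real.div_rpow h0.le hr'0.le]
              congr 2
              field_simp
          _ = _ := by rw [hK]; ring
    refine ne_top_of_le_ne_top ?_ (lintegral_mono hle)
    rw [lintegral_const_mul _ (by fun_prop)]
    refine ENNReal.mul_ne_top hKt ?_
    rw [← ofReal_integral_eq_lintegral_ofReal h.integrable_V_mul_max (ae_of_all _ fun ω =>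
      mul_nonneg (Real.rpow_nonneg (hV0 ω) _) (Real.rpow_nonneg (hY0 ω) _))]
    exact ENNReal.ofReal_ne_top
  · have hfm : Measurable f := (hf.continuous h.α_pos hp0).measurable
    have hi : ∀ {Z : Ω → Fin d → ℝ}, Measurable Z → Integrable (fun ω =>
        f (dilation α (Real.exp (-z.1)) (flipSigns z.2 (Z ω)))) P := fun hZ =>
      Integrable.of_bound (hfm.comp (measurable_scaledArg_right hZ z)).aestronglyMeasurable M
        (ae_of_all _ fun ω => hf.bounded _)
    have hAX : Measurable fun ω => A ω * X ω := h.measurable_A.mul h.measurable_X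
    have hAXB : Measurable fun ω => A ω * X ω + B ω := hAX.add h.measurable_B
    have e1 : defect P A B X α f z = ∫ ω, Real.exp z.1 *
        (f (dilation α (Real.exp (-z.1)) (flipSigns z.2 (A ω * X ω + B ω)))
          - f (dilation α (Real.exp (-z.1)) (flipSigns z.2 (A ω * X ω)))) ∂P := by
      rw [integral_const_mul, integral_sub (hi hAXB) (hi hAX), defect,
        scaledMean, scaledMean, mul_sub]
    rw [e1]
    refine (enorm_integral_le_lintegral_enorm _).trans (lintegral_mono_ae ?_)
    filter_upwards [h.alphaNorm_mul_ae] with ω hω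
    rw [flipSigns_add, dilation_add, Real.enorm_eq_ofReal_abs, abs_mul, Real.abs_exp]
    have h1 := hf.abs_add_sub_le h.α_pos hp0 h.α_mul_p_le
      (dilation α (Real.exp (-z.1)) (flipSigns z.2 (A ω * X ω)))
      (dilation α (Real.exp (-z.1)) (flipSigns z.2 (B ω)))
    simp only [alphaNorm_dilation h.α_pos (Real.exp_pos _).le, alphaNorm_flipSigns, hω] at h1
    rw [← mul_max_of_nonneg _ _ (Real.exp_pos _).le] at h1
    change _ ≤ if r' ≤ Real.exp (-z.1) * Y ω then L * (Real.exp (-z.1) * V ω) ^ p else 0 at h1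
    have hfl := Int.floor_le z.1
    have hfl' := (Int.lt_floor_add_one z.1).le
    split_ifs at h1 with hc
    · have hc' : r' * Real.exp ⌊z.1⌋ ≤ Y ω := by
        rw [Real.exp_neg, inv_mul_eq_div, le_div_iff₀ (Real.exp_pos _)] at hc
        refine le_trans ?_ hc
        gcongr
      simp only [hβ]
      rw [if_pos hc']
      refine ENNReal.ofReal_le_ofReal ?_
      have hVp : 0 ≤ V ω ^ p := Real.rpow_nonneg (hV0 ω) p
      calc _ ≤ Real.exp z.1 * (L * (Real.exp (-z.1) * V ω) ^ p) := by gcongr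
        _ = L * Real.exp ((1 - p) * z.1) * V ω ^ p := by
            rw [Real.mul_rpow (Real.exp_pos _).le (hV0 ω), ← Real.exp_mul,
              show (1 - p) * z.1 = z.1 + -z.1 * p by ring, Real.exp_add]
            ring
        _ ≤ _ := by
            have : 0 ≤ 1 - p := by linarith
            gcongr
    · rw [le_antisymm h1 (abs_nonneg _)]
      simp

/-- Undoing the tilt turns this into E[W · W^{-1/2}] = E W^{1/2} < 1. -/
theorem lintegral_exp_tilted_lt_one (h : HomogeneousSRE P A B X α W p) :
    ∫⁻ s, ENNReal.ofReal (Real.exp (-(1 / 2) * s)) ∂((tiltedLaw P A W).map Prod.fst) < 1 := by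
  have hm : Measurable fun y : ℝ × (Fin d → ZMod 2) => Real.exp (-(1 / 2) * y.1) := by fun_prop
  have hW := integrable_rpow_and_integral_lt_one h.measurable_W h.W_nonneg h.integrable_W
      h.integral_W h.not_ae_eq_one (y := 1 / 2) (by norm_num) (by norm_num)
  have e : ∀ ω, W ω * Real.exp (-(1 / 2) * Real.log (W ω)) = W ω ^ (1 / 2 : ℝ) := by
    intro ω
    rcases (h.W_nonneg ω).eq_or_lt with h0 | h0
    · rw [← h0]; simp
    · rw [mul_comm (-(1 / 2) : ℝ), ← Real.rpow_def_of_pos h0]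
      nth_rewrite 1 [← Real.rpow_one (W ω)]
      rw [← Real.rpow_add h0]; norm_num
  have hi : Integrable (fun y : ℝ × (Fin d → ZMod 2) => Real.exp (-(1 / 2) * y.1))
      (tiltedLaw P A W) := by
    rw [integrable_tiltedLaw h.measurable_A h.measurable_W h.W_nonneg hm]
    simp only [e]
    exact hW.1
  rw [lintegral_map (by fun_prop) measurable_fst, ← ofReal_integral_eq_lintegral_ofReal hi
    (ae_of_all _ fun _ => (Real.exp_pos _).le), ENNReal.ofReal_lt_one,
    integral_tiltedLaw h.measurable_A h.measurable_W h.W_nonneg hm]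
  simp only [e]
  exact hW.2

/-- The a priori tail bound. -/
theorem exists_tail_bound (h : HomogeneousSRE P A B X α W p) :
    ∃ C : ℝ, 0 ≤ C ∧ ∀ u : ℝ, 0 < u → u * P.real {ω | u ≤ alphaNorm α (X ω)} ≤ C := by
  have hp0 := h.p_pos
  set f : (Fin d → ℝ) → ℝ := fun x => min 1 (max 0 (2 * alphaNorm α x ^ p - 1)) with hfdef
  have hf := h.isTestFunction_tail
  rw [← hfdef] at hf
  have hfm : Measurable f := (hf.continuous h.α_pos hp0).measurable
  have hf0 : ∀ x, 0 ≤ f x := fun x => le_min (by norm_num) (le_max_left _ _)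
  -- This f depends on |x|_α only, so the signs drop out and the renewal equation descends to the
  -- line.
  have hflip : ∀ e x, f (flipSigns e x) = f x := fun e x => by
    simp only [hfdef, alphaNorm_flipSigns]
  have hfdil : ∀ t e x, f (dilation α t (flipSigns e x)) = f (dilation α t x) := fun t e x => by
    rw [← hflip e (dilation α t x)]
    congr 1; ext j; simp only [dilation, flipSigns]; ring
  have hi : ∀ s : ℝ, Integrable (fun ω => f (dilation α (Real.exp (-s)) (X ω))) P := fun s =>
    Integrable.of_bound (hfm.comp
      ((continuous_dilation _).measurable.comp h.measurable_X)).aestronglyMeasurable 1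
        (ae_of_all _ fun ω => hf.bounded _)
  set G : ℝ → ℝ := fun s => scaledMean P X α f (s, 0) with hG
  have hGdef : ∀ s, G s = Real.exp s * ∫ ω, f (dilation α (Real.exp (-s)) (X ω)) ∂P := fun s => by
    simp only [hG, scaledMean, flipSigns_zero]
  have hGe : ∀ z : ℝ × (Fin d → ZMod 2), scaledMean P X α f z = G z.1 := fun z => by
    simp only [hGdef, scaledMean, hfdil]
  have hG0 : ∀ s, 0 ≤ G s := fun s => by
    rw [hGdef]; exact mul_nonneg (Real.exp_pos _).le (integral_nonneg fun ω => hf0 _)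
  obtain ⟨b, hb, hbd⟩ := h.exists_defect_le hf
  have := h.isProbabilityMeasure_tilted
  have : IsProbabilityMeasure ((tiltedLaw P A W).map Prod.fst) :=
    Measure.isProbabilityMeasure_map (by fun_prop)
  have hGm : Measurable G := (measurable_scaledMean h.measurable_X hfm).comp (by fun_prop)
  set r : ℝ := (1 / 2) ^ (1 / p) with hr
  have hr0 : 0 < r := hf.r_pos
  have hbdd : ∃ C ≠ ⊤, ∀ s, ENNReal.ofReal (G s) ≤ C := by
    refine exists_forall_le_of_renewal (μ := (tiltedLaw P A W).map Prod.fst) (η := 1 / 2)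
      (by norm_num) h.lintegral_exp_tilted_lt_one hb
      (K := ENNReal.ofReal (∫ ω, r⁻¹ ^ (1 / 2 : ℝ) * alphaNorm α (X ω) ^ (1 / 2 : ℝ) ∂P))
      ENNReal.ofReal_ne_top (fun s => ?_) (fun s => ?_)
    · rw [← ENNReal.ofReal_mul (integral_nonneg fun ω => mul_nonneg (by positivity)
        (Real.rpow_nonneg alphaNorm_nonneg _))]
      refine ENNReal.ofReal_le_ofReal ?_
      rw [hGdef]
      -- Markov's inequality in disguise: f is below (|x|_α/r)^{1/2}, so the finite moment of order
      -- 1/2 gives G(s) ≤ K e^{s/2}, the growth allowed by the a priori bound.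
      have hbd' : ∀ ω, f (dilation α (Real.exp (-s)) (X ω))
          ≤ Real.exp (-(1 / 2) * s) * (r⁻¹ ^ (1 / 2 : ℝ) * alphaNorm α (X ω) ^ (1 / 2 : ℝ)) := by
        intro ω
        have e : Real.exp (-(1 / 2) * s) * (r⁻¹ ^ (1 / 2 : ℝ) * alphaNorm α (X ω) ^ (1 / 2 : ℝ))
            = (alphaNorm α (dilation α (Real.exp (-s)) (X ω)) / r) ^ (1 / 2 : ℝ) := by
          rw [alphaNorm_dilation h.α_pos (Real.exp_pos _).le, div_eq_mul_inv _ r,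
            Real.mul_rpow (mul_nonneg (Real.exp_pos _).le alphaNorm_nonneg) (by positivity),
            Real.mul_rpow (Real.exp_pos _).le alphaNorm_nonneg, ← Real.exp_mul]
          ring_nf
        rw [e]
        by_cases hx : alphaNorm α (dilation α (Real.exp (-s)) (X ω)) < r
        · rw [hf.vanish _ hx]
          exact Real.rpow_nonneg (div_nonneg alphaNorm_nonneg hr0.le) _
        · exact ((le_abs_self _).trans (hf.bounded _)).trans
            (Real.one_le_rpow ((one_le_div hr0).2 (not_lt.1 hx)) (by norm_num))
      have h1 := integral_mono (hi s) (((h.integrable_U_rpow (y := 1 / 2) (by norm_num)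
        (by norm_num)).const_mul _).const_mul _) hbd'
      rw [integral_const_mul] at h1
      calc _ ≤ Real.exp s * _ := mul_le_mul_of_nonneg_left h1 (Real.exp_pos _).le
        _ = _ := by
          rw [← mul_assoc, ← Real.exp_add, mul_comm]
          ring_nf
    · have hre := h.renewal_equation hfm hf.bounded (hf.map_zero h.α_pos) (s, 0)
      have e1 : ∫ y, scaledMean P X α f ((s, 0) - y) ∂tiltedLaw P A W
          = ∫ y, G (s - y) ∂((tiltedLaw P A W).map Prod.fst) := by
        have hGm' : Measurable fun y => G (s - y) := hGm.comp (by fun_prop)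
        rw [integral_map (by fun_prop) hGm'.aestronglyMeasurable]
        congr 1 with y
        rw [hGe]; rfl
      rw [hGe, e1] at hre
      have h1 : ENNReal.ofReal (∫ y, G (s - y) ∂((tiltedLaw P A W).map Prod.fst))
          ≤ ∫⁻ y, ENNReal.ofReal (G (s - y)) ∂((tiltedLaw P A W).map Prod.fst) := by
        by_cases hinteg : Integrable (fun y => G (s - y)) ((tiltedLaw P A W).map Prod.fst)
        · exact (ofReal_integral_eq_lintegral_ofReal hinteg (ae_of_all _ fun y => hG0 _)).le
        · rw [integral_undef hinteg]; simp
      have h2 := hbd (s, 0)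
      calc ENNReal.ofReal (G s) = ENNReal.ofReal (_ + defect P A B X α f (s, 0)) := by
            rw [show G s = _ from hre]; rfl
        _ ≤ _ := ENNReal.ofReal_add_le
        _ ≤ _ := add_le_add h1 ((ENNReal.ofReal_le_ofReal (le_abs_self _)).trans
            (by rwa [← Real.enorm_eq_ofReal_abs]))
  obtain ⟨C, hCt, hC⟩ := hbdd
  refine ⟨C.toReal, ENNReal.toReal_nonneg, fun u hu => ?_⟩
  have h1 := (ENNReal.ofReal_le_iff_le_toReal hCt).1 (hC (Real.log u))
  refine le_trans ?_ h1
  rw [hGdef, Real.exp_log hu]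
  gcongr
  have hset : MeasurableSet {ω | u ≤ alphaNorm α (X ω)} :=
    measurableSet_le measurable_const h.measurable_U
  rw [← integral_indicator_one hset]
  refine integral_mono_of_nonneg (ae_of_all _ fun ω => indicator_nonneg (by simp) _) (hi _)
    (ae_of_all _ fun ω => ?_)
  by_cases hω : ω ∈ {ω | u ≤ alphaNorm α (X ω)}
  · simp only [indicator_of_mem hω, Pi.one_apply, hfdef]
    rw [alphaNorm_dilation h.α_pos (Real.exp_pos _).le, Real.exp_neg, Real.exp_log hu]
    have h2 : 1 ≤ u⁻¹ * alphaNorm α (X ω) := by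
      rw [inv_mul_eq_div, one_le_div hu]; exact hω
    have h3 := Real.one_le_rpow h2 hp0.le
    exact le_min le_rfl (le_max_of_le_right (by linarith))
  · rw [indicator_of_notMem hω]; exact hf0 _

theorem abs_scaledMean_le (h : HomogeneousSRE P A B X α W p) {C : ℝ}
    (hC : ∀ u : ℝ, 0 < u → u * P.real {ω | u ≤ alphaNorm α (X ω)} ≤ C) {g : (Fin d → ℝ) → ℝ}
    {M r : ℝ} (hM : 0 ≤ M) (hr : 0 < r) (hg : ∀ x, |g x| ≤ M)
    (hg0 : ∀ x, alphaNorm α x < r → g x = 0) (z : ℝ × (Fin d → ZMod 2)) :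
    |scaledMean P X α g z| ≤ M * (C / r) := by
  have hset : MeasurableSet {ω | r * Real.exp z.1 ≤ alphaNorm α (X ω)} :=
    measurableSet_le measurable_const h.measurable_U
  have h1 : |∫ ω, g (dilation α (Real.exp (-z.1)) (flipSigns z.2 (X ω))) ∂P|
      ≤ M * P.real {ω | r * Real.exp z.1 ≤ alphaNorm α (X ω)} := by
    rw [← integral_indicator_one hset, ← integral_const_mul, ← Real.norm_eq_abs]
    have hind : Integrable (fun ω => M *
        {ω | r * Real.exp z.1 ≤ alphaNorm α (X ω)}.indicator (1 : Ω → ℝ) ω) P :=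
      ((integrable_const (1 : ℝ)).indicator hset).const_mul M
    refine norm_integral_le_of_norm_le hind (ae_of_all _ fun ω => ?_)
    by_cases hω : ω ∈ {ω | r * Real.exp z.1 ≤ alphaNorm α (X ω)}
    · rw [indicator_of_mem hω, Pi.one_apply, mul_one]; exact hg _
    · rw [indicator_of_notMem hω, mul_zero, hg0, norm_zero]
      rw [alphaNorm_dilation h.α_pos (Real.exp_pos _).le, alphaNorm_flipSigns, Real.exp_neg,
        inv_mul_eq_div, div_lt_iff₀ (Real.exp_pos _)]
      exact not_le.1 hω
  have h2 := hC (r * Real.exp z.1) (by positivity)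
  rw [scaledMean, abs_mul, Real.abs_exp]
  calc _ ≤ Real.exp z.1 * (M * P.real {ω | r * Real.exp z.1 ≤ alphaNorm α (X ω)}) := by gcongr
    _ = M * (r * Real.exp z.1 * P.real {ω | r * Real.exp z.1 ≤ alphaNorm α (X ω)} / r) := by
        field_simp
    _ ≤ _ := by gcongr

/-- Scaled means of compactly supported test functions are uniformly continuous. -/
theorem scaledMean_uniformContinuous (h : HomogeneousSRE P A B X α W p)
    (hf : IsTestFunction α p f L M r) {R : ℝ} (hR0 : 0 < R)
    (hR : ∀ x, R < alphaNorm α x → f x = 0) {ε : ℝ} (hε : 0 < ε) :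
    ∀ᶠ v in 𝓝 (0 : ℝ), ∀ z : ℝ × (Fin d → ZMod 2),
      |scaledMean P X α f (z.1 + v, z.2) - scaledMean P X α f z| ≤ ε := by
  obtain ⟨C, hC0, hC⟩ := h.exists_tail_bound
  have hp0 := h.p_pos
  have hM := hf.M_nonneg
  have hr := hf.r_pos
  have hL := hf.L_nonneg
  have hfm : Measurable f := (hf.continuous h.α_pos hp0).measurable
  set q : ℝ → Fin d → ℝ := fun v j => Real.exp (-v) ^ (1 / α j) - 1 with hq
  have hqc : Continuous q := by
    refine continuous_pi fun j => Continuous.sub ?_ continuous_const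
    exact (by fun_prop : Continuous fun v => Real.exp (-v)).rpow_const
      fun v => Or.inl (Real.exp_pos _).ne'
  set D : ℝ → ℝ := fun v => |1 - Real.exp (-v)| * (M * (C / r))
    + L * (alphaNorm α (q v) ^ p * (2 * R) ^ p) * (C / (r / 2)) with hD
  have hDc : Continuous D := by
    have : Continuous fun v => alphaNorm α (q v) ^ p :=
      ((continuous_alphaNorm h.α_pos).comp hqc).rpow_const fun v => Or.inr hp0.le
    fun_prop
  have hD0 : D 0 = 0 := by
    have : q 0 = 0 := by ext j; simp [hq]
    simp [hD, this, alphaNorm_zero h.α_pos, Real.zero_rpow hp0.ne']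
  have ev1 : ∀ᶠ v in 𝓝 (0 : ℝ), D v < ε := (hDc.tendsto 0).eventually (gt_mem_nhds (by rwa [hD0]))
  have hexp : Tendsto (fun v : ℝ => Real.exp (-v)) (𝓝 0) (𝓝 1) := by
    have : Continuous fun v : ℝ => Real.exp (-v) := by fun_prop
    simpa using this.tendsto 0
  have ev2 : ∀ᶠ v in 𝓝 (0 : ℝ), Real.exp (-v) < 2 :=
    hexp.eventually (gt_mem_nhds (by norm_num))
  have ev3 : ∀ᶠ v in 𝓝 (0 : ℝ), 1 / 2 < Real.exp (-v) :=
    hexp.eventually (lt_mem_nhds (by norm_num))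
  filter_upwards [ev1, ev2, ev3] with v hv1 hv2 hv3 z
  -- The increment of G in s splits into the change of the prefactor e^s and the scaled mean of g.
  -- For small v the function g is uniformly small and still vanishes near 0 (e^{-v} < 2) and
  -- outside a ball (e^{-v} > 1/2), so the tail bound applies to it; `D v` collects both errors.
  set g : (Fin d → ℝ) → ℝ := fun x => f (dilation α (Real.exp (-v)) x) - f x with hg
  have hqp : 0 ≤ alphaNorm α (q v) ^ p := Real.rpow_nonneg alphaNorm_nonneg _
  have hgM : ∀ x, |g x| ≤ L * (alphaNorm α (q v) ^ p * (2 * R) ^ p) := by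
    intro x
    by_cases hx : alphaNorm α x ≤ 2 * R
    · refine (hf.lipschitz _ _).trans ?_
      have h1 : alphaNorm α (dilation α (Real.exp (-v)) x - x)
          ≤ alphaNorm α (q v) * alphaNorm α x := by
        refine alphaNorm_le (mul_nonneg alphaNorm_nonneg alphaNorm_nonneg) fun j => ?_
        have e : (dilation α (Real.exp (-v)) x - x) j = q v j * x j := by
          simp only [dilation, Pi.sub_apply, hq]; ring
        rw [e, abs_mul, Real.mul_rpow (abs_nonneg _) (abs_nonneg _)]
        exact mul_le_mul (le_alphaNorm j) (le_alphaNorm j) (by positivity) alphaNorm_nonneg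
      gcongr
      rw [← Real.mul_rpow alphaNorm_nonneg (by positivity)]
      refine Real.rpow_le_rpow alphaNorm_nonneg (h1.trans ?_) hp0.le
      exact mul_le_mul_of_nonneg_left hx alphaNorm_nonneg
    · push Not at hx
      have h1 : R < alphaNorm α (dilation α (Real.exp (-v)) x) := by
        rw [alphaNorm_dilation h.α_pos (Real.exp_pos _).le]
        nlinarith
      simp only [hg, hR _ h1, hR x (by linarith), sub_self, abs_zero]
      positivity
  have hg0 : ∀ x, alphaNorm α x < r / 2 → g x = 0 := by
    intro x hx
    have h1 : alphaNorm α (dilation α (Real.exp (-v)) x) < r := by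
      rw [alphaNorm_dilation h.α_pos (Real.exp_pos _).le]
      nlinarith [alphaNorm_nonneg (α := α) (x := x), Real.exp_pos (-v)]
    simp only [hg, hf.vanish _ h1, hf.vanish x (by linarith), sub_self]
  have b1 := h.abs_scaledMean_le hC (by positivity) (by positivity) hgM hg0 z
  have b2 := h.abs_scaledMean_le hC hM hr hf.bounded hf.vanish (z.1 + v, z.2)
  have hi : ∀ z : ℝ × (Fin d → ZMod 2), Integrable (fun ω =>
      f (dilation α (Real.exp (-z.1)) (flipSigns z.2 (X ω)))) P := fun z =>
    Integrable.of_bound (hfm.comp (measurable_scaledArg_right h.measurable_X z)).aestronglyMeasurable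
      M (ae_of_all _ fun ω => hf.bounded _)
  have e : scaledMean P X α f (z.1 + v, z.2) - scaledMean P X α f z
      = (1 - Real.exp (-v)) * scaledMean P X α f (z.1 + v, z.2) + scaledMean P X α g z := by
    have e1 : ∀ ω, dilation α (Real.exp (-v)) (dilation α (Real.exp (-z.1)) (flipSigns z.2 (X ω)))
        = dilation α (Real.exp (-(z.1 + v))) (flipSigns z.2 (X ω)) := fun ω => by
      rw [dilation_dilation (Real.exp_pos _).le (Real.exp_pos _).le, ← Real.exp_add]
      ring_nf
    have e2 : scaledMean P X α g z = Real.exp z.1 *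
        (∫ ω, f (dilation α (Real.exp (-(z.1 + v))) (flipSigns z.2 (X ω))) ∂P
          - ∫ ω, f (dilation α (Real.exp (-z.1)) (flipSigns z.2 (X ω))) ∂P) := by
      rw [← integral_sub (hi (z.1 + v, z.2)) (hi z)]
      simp only [scaledMean, hg, e1]
    rw [e2]
    simp only [scaledMean]
    have e3 : Real.exp (-v) * Real.exp (z.1 + v) = Real.exp z.1 := by
      rw [← Real.exp_add]; ring_nf
    rw [← e3]
    ring
  rw [e]
  refine (abs_add_le _ _).trans (le_trans (add_le_add ?_ b1) hv1.le)
  rw [abs_mul]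
  gcongr

/-- Convergence of scaled means for compactly supported test functions. -/
theorem exists_tendsto_of_isTestFunction (h : HomogeneousSRE P A B X α W p)
    (hf : IsTestFunction α p f L M r) {R : ℝ} (hR0 : 0 < R)
    (hR : ∀ x, R < alphaNorm α x → f x = 0) :
    ∃ l, Tendsto (fun u : ℝ => u * ∫ ω, f (dilation α u⁻¹ (X ω)) ∂P) atTop (𝓝 l) := by
  obtain ⟨C, hC0, hC⟩ := h.exists_tail_bound
  have hfm : Measurable f := (hf.continuous h.α_pos h.p_pos).measurable
  have := h.isProbabilityMeasure_tilted
  have hlog := integrable_mul_log_and_integral_pos h.measurable_W h.W_nonneg h.integrable_W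
    h.integral_W h.not_ae_eq_one h.integrable_log
  obtain ⟨b, hb, hbd⟩ := h.exists_defect_le hf
  have hbd' : ∀ z, |defect P A B X α f z| ≤ (b ⌊z.1⌋).toReal := fun z => by
    have := ENNReal.toReal_mono (ENNReal.ne_top_of_tsum_ne_top hb _) (hbd z)
    simpa using this
  have hmdef : Measurable (defect P A B X α f) := by
    have hAX : Measurable fun ω => A ω * X ω := h.measurable_A.mul h.measurable_X
    have hAXB : Measurable fun ω => A ω * X ω + B ω := hAX.add h.measurable_B
    exact (measurable_scaledMean hAXB hfm).sub (measurable_scaledMean hAX hfm)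
  -- The drift of the tilted law is E[W log W] > 0, and the step function dominating the defect
  -- yields both its decay and its integrability. The limit is read off at the trivial sign with s =
  -- log u.
  obtain ⟨l, hl⟩ := exists_tendsto_of_renewal (tiltedLaw P A W)
    ((integrable_tiltedLaw h.measurable_A h.measurable_W h.W_nonneg measurable_fst).2 hlog.1)
    (by
      rw [integral_tiltedLaw h.measurable_A h.measurable_W h.W_nonneg measurable_fst]
      exact hlog.2.ne')
    h.tilted_nonarithmetic (h.abs_scaledMean_le hC hf.M_nonneg hf.r_pos hf.bounded hf.vanish)
    (fun ε hε => h.scaledMean_uniformContinuous hf hR0 hR hε)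
    (ψ := defect P A B X α f)
    (h.renewal_equation hfm hf.bounded (hf.map_zero h.α_pos))
    (by
      have h1 : Tendsto (fun i : ℤ => (b i).toReal) atTop (𝓝 0) := by
        have := (ENNReal.summable_toReal hb).tendsto_cofinite_zero
        exact this.mono_left (by rw [Int.cofinite_eq]; exact le_sup_right)
      have h2 : Tendsto (fun z : ℝ × (Fin d → ZMod 2) => (b ⌊z.1⌋).toReal) (comap Prod.fst atTop)
          (𝓝 0) := h1.comp (tendsto_floor_atTop.comp tendsto_comap)
      exact squeeze_zero_norm hbd' h2)
    (fun e => by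
      have hm : Measurable fun s : ℝ => defect P A B X α f (s, e) := hmdef.comp (by fun_prop)
      refine Integrable.integrableOn ⟨hm.aestronglyMeasurable, ?_⟩
      refine lt_of_le_of_lt (lintegral_mono fun s => hbd (s, e)) ?_
      rw [lintegral_apply_floor]
      exact lt_top_iff_ne_top.2 hb) 0
  refine ⟨l, (hl.comp Real.tendsto_log_atTop).congr' ?_⟩
  filter_upwards [eventually_gt_atTop 0] with u hu
  simp only [Function.comp_apply, scaledMean, flipSigns_zero, Real.exp_neg, Real.exp_log hu]

end HomogeneousSRE

end DiagonalSRE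
end

noncomputable section
namespace DiagonalSRE

/-! ### From test functions to continuous functions supported in an annulus. -/

section Approximation

theorem tendsto_of_approx {F : ℝ → ℝ} {l : ℝ}
    (h : ∀ ε > 0, ∃ (G : ℝ → ℝ) (m : ℝ), Tendsto G atTop (𝓝 m) ∧ |m - l| ≤ ε ∧
      ∀ᶠ u in atTop, |F u - G u| ≤ ε) : Tendsto F atTop (𝓝 l) := by
  rw [Metric.tendsto_nhds]
  intro ε hε
  obtain ⟨G, m, hG, hm, hFG⟩ := h (ε / 4) (by positivity)
  filter_upwards [hFG, (Metric.tendsto_nhds.1 hG) (ε / 4) (by positivity)] with u h1 h2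
  rw [Real.dist_eq] at h2 ⊢
  have := abs_le.1 h1; have := abs_lt.1 h2; have := abs_le.1 hm
  exact abs_lt.2 ⟨by linarith, by linarith⟩

theorem exists_tendsto_of_approx {F : ℝ → ℝ}
    (h : ∀ ε > 0, ∃ (G : ℝ → ℝ) (m : ℝ), Tendsto G atTop (𝓝 m) ∧
      ∀ᶠ u in atTop, |F u - G u| ≤ ε) : ∃ l, Tendsto F atTop (𝓝 l) := by
  rw [← cauchy_map_iff_exists_tendsto, Metric.cauchy_iff]
  refine ⟨inferInstance, fun ε hε => ?_⟩
  obtain ⟨G, m, hG, hFG⟩ := h (ε / 5) (by positivity)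
  refine ⟨F '' {u | |F u - G u| ≤ ε / 5 ∧ dist (G u) m < ε / 5}, image_mem_map
    (hFG.and ((Metric.tendsto_nhds.1 hG) (ε / 5) (by positivity))), ?_⟩
  rintro _ ⟨u, ⟨hu1, hu2⟩, rfl⟩ _ ⟨v, ⟨hv1, hv2⟩, rfl⟩
  rw [Real.dist_eq] at hu2 hv2 ⊢
  have := abs_le.1 hu1; have := abs_lt.1 hu2; have := abs_le.1 hv1; have := abs_lt.1 hv2
  exact abs_lt.2 ⟨by linarith, by linarith⟩

variable {d : ℕ} {α : Fin d → ℝ} {p : ℝ}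

/-- Approximation of continuous functions supported in an annulus by test functions. -/
theorem exists_isTestFunction_approx (hα : ∀ j, 0 < α j) (hp : 0 < p) (hαp : ∀ j, α j * p ≤ 1)
    {f : (Fin d → ℝ) → ℝ} (hf : Continuous f) {r R : ℝ} (hr : 0 < r) (hrR : r ≤ R)
    (hfr : ∀ x, f x ≠ 0 → r ≤ alphaNorm α x ∧ alphaNorm α x ≤ R) {ε : ℝ} (hε : 0 < ε) :
    ∃ (g : (Fin d → ℝ) → ℝ) (L M : ℝ), IsTestFunction α p g L M (r / 2) ∧
      (∀ x, 2 * R < alphaNorm α x → g x = 0) ∧ ∀ x, |f x - g x| ≤ ε := by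
  have hNc := continuous_alphaNorm hα
  have hK : IsCompact {x : Fin d → ℝ | r ≤ alphaNorm α x ∧ alphaNorm α x ≤ R} :=
    (isCompact_alphaNorm_le hα R).inter_left (isClosed_le continuous_const hNc)
  have hO : IsOpen {x : Fin d → ℝ | r / 2 < alphaNorm α x ∧ alphaNorm α x < 2 * R} :=
    (isOpen_lt continuous_const hNc).inter (isOpen_lt hNc continuous_const)
  obtain ⟨δ₁, hδ₁, hthick⟩ := hK.exists_thickening_subset_open hO
    (fun x hx => ⟨by linarith [hx.1], by linarith [hx.2]⟩)
  have hfs : HasCompactSupport f := HasCompactSupport.of_support_subset_isCompact hK hfr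
  obtain ⟨δ₂, hδ₂, hunif⟩ := Metric.uniformContinuous_iff.1
    (hfs.uniformContinuous_of_continuous hf) ε hε
  obtain ⟨M₀, hM₀⟩ := hfs.exists_bound_of_continuous hf
  set δ := min δ₁ δ₂ with hδ
  have hδ0 : 0 < δ := lt_min hδ₁ hδ₂
  -- Mollification at a scale below the modulus of continuity of f and below the distance needed to
  -- keep the support in the enlarged annulus.
  let φ : ContDiffBump (0 : Fin d → ℝ) := ⟨δ / 2, δ, by positivity, by linarith⟩
  set g : (Fin d → ℝ) → ℝ := convolution (φ.normed volume) f (ContinuousLinearMap.lsmul ℝ ℝ) volume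
    with hg
  have hclose : ∀ x, |f x - g x| ≤ ε := by
    intro x
    rw [abs_sub_comm]
    refine φ.dist_normed_convolution_le hf.aestronglyMeasurable fun y hy => ?_
    exact (hunif (lt_of_lt_of_le hy (min_le_right _ _))).le
  have hzero : ∀ x, ¬ (r / 2 < alphaNorm α x ∧ alphaNorm α x < 2 * R) → g x = 0 := by
    intro x hx
    have hball : ∀ y ∈ Metric.ball x δ, f y = 0 := by
      intro y hy
      by_contra hne
      refine hx (hthick (Metric.mem_thickening_iff.2 ⟨y, hfr y hne, ?_⟩))
      rw [dist_comm]
      exact lt_of_lt_of_le hy (min_le_left _ _)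
    have hfx := hball x (Metric.mem_ball_self hδ0)
    have h1 : dist (g x) (f x) ≤ 0 :=
      φ.dist_normed_convolution_le hf.aestronglyMeasurable fun y hy => by
        rw [hball y hy, hfx, dist_self]
    rw [dist_le_zero.1 h1, hfx]
  have hgC : ContDiff ℝ 1 g :=
    φ.hasCompactSupport_normed.contDiff_convolution_left _ φ.contDiff_normed
      (hf.locallyIntegrable)
  have hgs : HasCompactSupport g :=
    HasCompactSupport.of_support_subset_isCompact (isCompact_alphaNorm_le hα (2 * R)) fun x hx => by
      by_contra hcon
      exact hx (hzero x fun h => hcon h.2.le)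
  obtain ⟨K, hKl⟩ := hgC.lipschitzWith_of_hasCompactSupport hgs (by simp)
  have hgM : ∀ x, |g x| ≤ M₀ + ε := fun x => by
    have h1 := abs_le.1 (hclose x); have h2 := abs_le.1 (hM₀ x)
    exact abs_le.2 ⟨by linarith, by linarith⟩
  have hM : 0 ≤ M₀ + ε := (abs_nonneg _).trans (hgM 0)
  refine ⟨g, K + 2 * (M₀ + ε), M₀ + ε, ⟨by positivity, by positivity, fun x y => ?_, hgM,
    fun x hx => hzero x fun h => by linarith [h.1]⟩, fun x hx => hzero x fun h => by linarith [h.2],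
    hclose⟩
  -- The increment of g is at most K‖x - y‖ and at most 2(M₀ + ε), hence at most (K + 2(M₀ + ε))
  -- min(1, ‖x - y‖).
  have h1 := min_norm_le_alphaNorm_rpow (x := x - y) hα hp hαp
  have h2 : |g x - g y| ≤ K * ‖x - y‖ := by
    have := hKl.dist_le_mul x y
    rwa [Real.dist_eq, dist_eq_norm] at this
  have h3 : |g x - g y| ≤ 2 * (M₀ + ε) := by
    have h1 := abs_le.1 (hgM x); have h2 := abs_le.1 (hgM y)
    exact abs_le.2 ⟨by linarith, by linarith⟩
  have hK0 : (0 : ℝ) ≤ K := K.2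
  refine le_trans ?_ (mul_le_mul_of_nonneg_left h1 (by positivity))
  rcases le_total 1 ‖x - y‖ with h4 | h4
  · rw [min_eq_left h4]; linarith
  · rw [min_eq_right h4]
    have := norm_nonneg (x - y)
    nlinarith

end Approximation

section ScaledLimits

variable {d : ℕ} {Ω : Type*} [MeasurableSpace Ω] {P : Measure Ω} {X : Ω → Fin d → ℝ}
  {α : Fin d → ℝ}

/-- The scaled expectation `u E f(δ_{1/u} X)`. -/
def scaledExp (P : Measure Ω) (X : Ω → Fin d → ℝ) (α : Fin d → ℝ) (f : (Fin d → ℝ) → ℝ)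
    (u : ℝ) : ℝ := u * ∫ ω, f (dilation α u⁻¹ (X ω)) ∂P

variable [IsProbabilityMeasure P]

theorem integrable_comp_dilation (hX : Measurable X) {f : (Fin d → ℝ) → ℝ} (hf : Measurable f)
    {M : ℝ} (hM : ∀ x, |f x| ≤ M) (t : ℝ) : Integrable (fun ω => f (dilation α t (X ω))) P :=
  Integrable.of_bound (hf.comp ((continuous_dilation t).measurable.comp hX)).aestronglyMeasurable M
    (ae_of_all _ fun _ => hM _)

theorem scaledExp_add (hX : Measurable X) {f g : (Fin d → ℝ) → ℝ} (hf : Measurable f)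
    (hg : Measurable g) {M N : ℝ} (hM : ∀ x, |f x| ≤ M) (hN : ∀ x, |g x| ≤ N) (u : ℝ) :
    scaledExp P X α (fun x => f x + g x) u = scaledExp P X α f u + scaledExp P X α g u := by
  rw [scaledExp, integral_add (integrable_comp_dilation hX hf hM _)
    (integrable_comp_dilation hX hg hN _), mul_add]; rfl

theorem scaledExp_sub (hX : Measurable X) {f g : (Fin d → ℝ) → ℝ} (hf : Measurable f)
    (hg : Measurable g) {M N : ℝ} (hM : ∀ x, |f x| ≤ M) (hN : ∀ x, |g x| ≤ N) (u : ℝ) :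
    scaledExp P X α (fun x => f x - g x) u = scaledExp P X α f u - scaledExp P X α g u := by
  rw [scaledExp, integral_sub (integrable_comp_dilation hX hf hM _)
    (integrable_comp_dilation hX hg hN _), mul_sub]; rfl

theorem abs_scaledExp_le (hX : Measurable X) (hα : ∀ j, 0 < α j) {C : ℝ}
    (hC : ∀ u : ℝ, 0 < u → u * P.real {ω | u ≤ alphaNorm α (X ω)} ≤ C) {g : (Fin d → ℝ) → ℝ}
    {M r : ℝ} (hr : 0 < r) (hg : ∀ x, |g x| ≤ M)
    (hg0 : ∀ x, alphaNorm α x < r → g x = 0) {u : ℝ} (hu : 0 < u) :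
    |scaledExp P X α g u| ≤ M * (C / r) := by
  have hM : 0 ≤ M := (abs_nonneg _).trans (hg 0)
  have hset : MeasurableSet {ω | r * u ≤ alphaNorm α (X ω)} :=
    measurableSet_le measurable_const ((measurable_alphaNorm hα).comp hX)
  have h1 : |∫ ω, g (dilation α u⁻¹ (X ω)) ∂P| ≤ M * P.real {ω | r * u ≤ alphaNorm α (X ω)} := by
    rw [← integral_indicator_one hset, ← integral_const_mul, ← Real.norm_eq_abs]
    have hind : Integrable (fun ω => M *
        {ω | r * u ≤ alphaNorm α (X ω)}.indicator (1 : Ω → ℝ) ω) P :=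
      ((integrable_const (1 : ℝ)).indicator hset).const_mul M
    refine norm_integral_le_of_norm_le hind (ae_of_all _ fun ω => ?_)
    by_cases hω : ω ∈ {ω | r * u ≤ alphaNorm α (X ω)}
    · rw [indicator_of_mem hω, Pi.one_apply, mul_one]; exact hg _
    · rw [indicator_of_notMem hω, mul_zero, hg0, norm_zero]
      rw [alphaNorm_dilation hα (by positivity), inv_mul_eq_div, div_lt_iff₀ hu]
      exact not_le.1 hω
  have h2 := hC (r * u) (by positivity)
  rw [scaledExp, abs_mul, abs_of_pos hu]
  calc _ ≤ u * (M * P.real {ω | r * u ≤ alphaNorm α (X ω)}) := by gcongr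
    _ = M * (r * u * P.real {ω | r * u ≤ alphaNorm α (X ω)} / r) := by field_simp
    _ ≤ _ := by gcongr

end ScaledLimits

/-- Convergence of scaled means of continuous functions supported in an annulus. -/
theorem HomogeneousSRE.exists_tendsto_scaledExp {d : ℕ} {Ω : Type*} [MeasurableSpace Ω]
    {P : Measure Ω} [IsProbabilityMeasure P] {A B X : Ω → Fin d → ℝ} {α : Fin d → ℝ} {W : Ω → ℝ}
    {p : ℝ} (h : HomogeneousSRE P A B X α W p) {f : (Fin d → ℝ) → ℝ} (hf : Continuous f)
    {r R : ℝ} (hr : 0 < r) (hrR : r ≤ R)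
    (hfr : ∀ x, f x ≠ 0 → r ≤ alphaNorm α x ∧ alphaNorm α x ≤ R) :
    ∃ l, Tendsto (scaledExp P X α f) atTop (𝓝 l) := by
  obtain ⟨C, hC0, hC⟩ := h.exists_tail_bound
  refine exists_tendsto_of_approx fun ε hε => ?_
  set η : ℝ := ε / (C / (r / 2) + 1) with hη
  have hη0 : 0 < η := by positivity
  obtain ⟨g, L, M, hg, hgR, hfg⟩ := exists_isTestFunction_approx h.α_pos h.p_pos h.α_mul_p_le hf hr
    hrR hfr hη0
  obtain ⟨l, hl⟩ := h.exists_tendsto_of_isTestFunction hg (R := 2 * R) (by linarith) hgR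
  refine ⟨_, l, hl, ?_⟩
  filter_upwards [eventually_gt_atTop 0] with u hu
  change |scaledExp P X α f u - scaledExp P X α g u| ≤ ε
  have hfM : ∀ x, |f x| ≤ M + η := fun x => by
    have h1 := abs_le.1 (hfg x); have h2 := abs_le.1 (hg.bounded x)
    exact abs_le.2 ⟨by linarith, by linarith⟩
  rw [← scaledExp_sub h.measurable_X hf.measurable
    (hg.continuous h.α_pos h.p_pos).measurable hfM hg.bounded]
  refine (abs_scaledExp_le h.measurable_X h.α_pos hC (half_pos hr) hfg (fun x hx => ?_) hu).trans ?_
  · rw [hg.vanish x hx, sub_zero]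
    by_contra hne
    linarith [(hfr x hne).1]
  · rw [hη, div_mul_eq_mul_div, div_le_iff₀ (by positivity)]
    nlinarith

end DiagonalSRE
end

/-! ### Construction and homogeneity of the limit measure. -/

noncomputable section
namespace DiagonalSRE

section Ramp

/-- The piecewise linear function which is `0` on `(-∞, a]` and `1` on `[b, ∞)`. -/
def ramp (a b t : ℝ) : ℝ := max 0 (min 1 ((t - a) / (b - a)))

variable {a b t : ℝ}

theorem continuous_ramp : Continuous (ramp a b) := by unfold ramp; fun_prop

theorem ramp_nonneg : 0 ≤ ramp a b t := le_max_left _ _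

theorem ramp_le_one : ramp a b t ≤ 1 := max_le zero_le_one (min_le_left _ _)

theorem ramp_of_le (hab : a < b) (h : t ≤ a) : ramp a b t = 0 := by
  rw [ramp, max_eq_left]
  exact (min_le_right _ _).trans (div_nonpos_of_nonpos_of_nonneg (by linarith) (by linarith))

theorem ramp_of_ge (hab : a < b) (h : b ≤ t) : ramp a b t = 1 := by
  rw [ramp, min_eq_left, max_eq_right zero_le_one]
  rw [one_le_div (by linarith)]
  linarith

end Ramp

open scoped CompactlySupported

section ExtendZero

variable {d : ℕ}

/-- Extension by zero of a function on `ℝ^d ∖ {0}`. -/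
def extendZero (f : Punctured d → ℝ) (x : Fin d → ℝ) : ℝ :=
  open scoped Classical in if h : x ≠ 0 then f ⟨x, h⟩ else 0

theorem extendZero_coe (f : Punctured d → ℝ) (x : Punctured d) : extendZero f x.1 = f x := by
  rw [extendZero, dif_pos x.2]

theorem extendZero_zero (f : Punctured d → ℝ) : extendZero f 0 = 0 := by
  simp [extendZero]

theorem extendZero_restrict {f : (Fin d → ℝ) → ℝ} (hf : f 0 = 0) :
    extendZero (fun x : Punctured d => f x.1) = f := by
  ext x
  by_cases h : x = 0
  · rw [h, extendZero_zero, hf]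
  · exact extendZero_coe (fun x : Punctured d => f x.1) ⟨x, h⟩

theorem continuous_extendZero {f : Punctured d → ℝ} (hf : Continuous f)
    (hs : HasCompactSupport f) : Continuous (extendZero f) := by
  have h1 : extendZero f = Function.extend Subtype.val f 0 := by
    ext x
    by_cases h : x = 0
    · rw [h, extendZero_zero, Function.extend_apply', Pi.zero_apply]
      rintro ⟨y, hy⟩
      exact y.2 hy
    · rw [extendZero, dif_pos h]
      exact (Subtype.val_injective.extend_apply f 0 ⟨x, h⟩).symm
  rw [h1]
  exact hs.continuous_extend_zero (U := {x : Fin d → ℝ | x ≠ 0}) isOpen_ne hf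

instance : LocallyCompactSpace (Punctured d) :=
  (isOpen_ne (x := (0 : Fin d → ℝ))).locallyCompactSpace

/-- The support of a compactly supported function on `ℝ^d ∖ {0}` lies in an annulus. -/
theorem exists_annulus {α : Fin d → ℝ} (hα : ∀ j, 0 < α j) {f : Punctured d → ℝ}
    (hs : HasCompactSupport f) : ∃ r R : ℝ, 0 < r ∧ r ≤ R ∧
      ∀ x, extendZero f x ≠ 0 → r ≤ alphaNorm α x ∧ alphaNorm α x ≤ R := by
  have hmem : ∀ x, extendZero f x ≠ 0 → ∃ y ∈ tsupport f, y.1 = x := fun x hx => by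
    have h0 : x ≠ 0 := fun h => hx (by rw [h, extendZero_zero])
    refine ⟨⟨x, h0⟩, subset_tsupport f ?_, rfl⟩
    rwa [Function.mem_support, ← extendZero_coe f ⟨x, h0⟩]
  have hc : Continuous fun y : Punctured d => alphaNorm α y.1 :=
    (continuous_alphaNorm hα).comp continuous_subtype_val
  rcases (tsupport f).eq_empty_or_nonempty with he | hne
  · refine ⟨1, 1, one_pos, le_rfl, fun x hx => ?_⟩
    obtain ⟨y, hy, -⟩ := hmem x hx
    simp [he] at hy
  · obtain ⟨a, ha, hamin⟩ := hs.isCompact.exists_isMinOn hne hc.continuousOn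
    obtain ⟨b, hb, hbmax⟩ := hs.isCompact.exists_isMaxOn hne hc.continuousOn
    refine ⟨_, _, (alphaNorm_pos hα).2 a.2, hamin hb, fun x hx => ?_⟩
    obtain ⟨y, hy, rfl⟩ := hmem x hx
    exact ⟨hamin hy, hbmax hy⟩

theorem hasCompactSupport_restrict {α : Fin d → ℝ} (hα : ∀ j, 0 < α j) {f : (Fin d → ℝ) → ℝ}
    {r R : ℝ} (hr : 0 < r) (hf : ∀ x, f x ≠ 0 → r ≤ alphaNorm α x ∧ alphaNorm α x ≤ R) :
    HasCompactSupport fun x : Punctured d => f x.1 := by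
  have hK : IsCompact {x : Fin d → ℝ | r ≤ alphaNorm α x ∧ alphaNorm α x ≤ R} :=
    (isCompact_alphaNorm_le hα R).inter_left (isClosed_le continuous_const (continuous_alphaNorm hα))
  have hK' : IsCompact {x : Punctured d | r ≤ alphaNorm α x.1 ∧ alphaNorm α x.1 ≤ R} := by
    rw [Subtype.isCompact_iff]
    convert hK using 1
    ext x
    constructor
    · rintro ⟨y, hy, rfl⟩; exact hy
    · exact fun hx => ⟨⟨x, (alphaNorm_pos hα).1 (hr.trans_le hx.1)⟩, hx, rfl⟩
  exact HasCompactSupport.of_support_subset_isCompact hK' fun x hx => hf x.1 hx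

end ExtendZero

/-- The scaled laws of `X` have bounded tails and converge on continuous functions supported in
annuli. -/
structure HasScaledLimits {d : ℕ} {Ω : Type*} [MeasurableSpace Ω] (P : Measure Ω)
    (X : Ω → Fin d → ℝ) (α : Fin d → ℝ) (C : ℝ) : Prop where
  measurable_X : Measurable X
  α_pos : ∀ j, 0 < α j
  C_nonneg : 0 ≤ C
  tail : ∀ u : ℝ, 0 < u → u * P.real {ω | u ≤ alphaNorm α (X ω)} ≤ C
  exists_tendsto : ∀ f : (Fin d → ℝ) → ℝ, Continuous f → ∀ r R : ℝ, 0 < r → r ≤ R →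
    (∀ x, f x ≠ 0 → r ≤ alphaNorm α x ∧ alphaNorm α x ≤ R) →
    ∃ l, Tendsto (scaledExp P X α f) atTop (𝓝 l)

namespace HasScaledLimits

variable {d : ℕ} {Ω : Type*} [MeasurableSpace Ω] {P : Measure Ω} {X : Ω → Fin d → ℝ}
  {α : Fin d → ℝ} {C : ℝ}

theorem tendsto_limUnder (h : HasScaledLimits P X α C) (f : C_c(Punctured d, ℝ)) :
    Tendsto (scaledExp P X α (extendZero f)) atTop
      (𝓝 (limUnder atTop (scaledExp P X α (extendZero f)))) := by
  obtain ⟨r, R, hr, hrR, hfr⟩ := exists_annulus h.α_pos f.hasCompactSupport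
  exact tendsto_nhds_limUnder (h.exists_tendsto _
    (continuous_extendZero f.continuous f.hasCompactSupport) r R hr hrR hfr)

theorem exists_bound_extendZero (f : C_c(Punctured d, ℝ)) : ∃ M, ∀ x, |extendZero f x| ≤ M := by
  obtain ⟨M, hM⟩ := f.hasCompactSupport.exists_bound_of_continuous f.continuous
  refine ⟨max M 0, fun x => ?_⟩
  by_cases hx : x = 0
  · simp [hx, extendZero_zero]
  · rw [extendZero, dif_pos hx]
    exact le_max_of_le_left (hM _)

theorem measurable_alphaNorm_val (h : HasScaledLimits P X α C) :
    Measurable fun x : Punctured d => alphaNorm α x.1 :=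
  (measurable_alphaNorm h.α_pos).comp measurable_subtype_coe

variable [IsProbabilityMeasure P]

/-- The limit functional on compactly supported functions. -/
def limitFunctional (h : HasScaledLimits P X α C) : C_c(Punctured d, ℝ) →ₚ[ℝ] ℝ :=
  PositiveLinearMap.mk₀
    { toFun := fun f => limUnder atTop (scaledExp P X α (extendZero f))
      map_add' := fun f g => by
        refine Tendsto.limUnder_eq (((h.tendsto_limUnder f).add (h.tendsto_limUnder g)).congr
          fun u => ?_)
        obtain ⟨M, hM⟩ := exists_bound_extendZero f
        obtain ⟨N, hN⟩ := exists_bound_extendZero g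
        have hf : Measurable (extendZero ⇑f) :=
          (continuous_extendZero (f := ⇑f) f.continuous f.hasCompactSupport).measurable
        have hg : Measurable (extendZero ⇑g) :=
          (continuous_extendZero (f := ⇑g) g.continuous g.hasCompactSupport).measurable
        rw [← scaledExp_add h.measurable_X hf hg hM hN]
        congr 1
        ext x
        by_cases hx : x = 0
        · simp [hx, extendZero_zero]
        · simp [extendZero, hx]
      map_smul' := fun c f => by
        refine Tendsto.limUnder_eq (((h.tendsto_limUnder f).const_mul c).congr fun u => ?_)
        rw [scaledExp, scaledExp, mul_left_comm, ← integral_const_mul]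
        congr 2
        ext ω
        by_cases hx : dilation α u⁻¹ (X ω) = 0
        · simp [hx, extendZero_zero]
        · simp [extendZero, hx] }
    (fun f hf => by
      refine ge_of_tendsto (h.tendsto_limUnder f) ?_
      filter_upwards [eventually_gt_atTop 0] with u hu
      refine mul_nonneg hu.le (integral_nonneg fun ω => ?_)
      by_cases hx : dilation α u⁻¹ (X ω) = 0
      · simp [hx, extendZero_zero]
      · simp only [extendZero, dif_pos hx]
        exact hf _)

/-- The limit measure on `ℝ^d ∖ {0}`. -/
def limitMeasure (h : HasScaledLimits P X α C) : Measure (Punctured d) :=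
  RealRMK.rieszMeasure h.limitFunctional

instance (h : HasScaledLimits P X α C) : h.limitMeasure.Regular := by
  unfold limitMeasure; infer_instance

theorem tendsto_extendZero (h : HasScaledLimits P X α C) (f : C_c(Punctured d, ℝ)) :
    Tendsto (scaledExp P X α (extendZero f)) atTop (𝓝 (∫ x, f x ∂h.limitMeasure)) := by
  rw [limitMeasure, RealRMK.integral_rieszMeasure]
  exact h.tendsto_limUnder f

theorem tendsto_annulus (h : HasScaledLimits P X α C) {f : (Fin d → ℝ) → ℝ} (hf : Continuous f)
    {r R : ℝ} (hr : 0 < r) (hfr : ∀ x, f x ≠ 0 → r ≤ alphaNorm α x ∧ alphaNorm α x ≤ R) :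
    Integrable (fun x : Punctured d => f x.1) h.limitMeasure ∧
    Tendsto (scaledExp P X α f) atTop (𝓝 (∫ x : Punctured d, f x.1 ∂h.limitMeasure)) := by
  have hs := hasCompactSupport_restrict h.α_pos hr hfr
  have hc : Continuous fun x : Punctured d => f x.1 := hf.comp continuous_subtype_val
  refine ⟨hc.integrable_of_hasCompactSupport hs, ?_⟩
  have h1 := h.tendsto_extendZero ⟨⟨fun x : Punctured d => f x.1, hc⟩, hs⟩
  have h0 : f 0 = 0 := by
    by_contra hne
    have := (hfr 0 hne).1
    rw [alphaNorm_zero h.α_pos] at this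
    linarith
  have h2 : extendZero (⟨⟨fun x : Punctured d => f x.1, hc⟩, hs⟩ : C_c(Punctured d, ℝ)) = f :=
    extendZero_restrict h0
  rw [h2] at h1
  exact h1

/-- The tail bound passes to the limit through a continuous cutoff; the factor 2 arises because the
cutoff reaches down to r/2. The bound is free of R and so gives finiteness off balls. -/
theorem limitMeasure_annulus_le (h : HasScaledLimits P X α C) {r R : ℝ} (hr : 0 < r)
    (hrR : r ≤ R) :
    h.limitMeasure {x | r ≤ alphaNorm α x.1 ∧ alphaNorm α x.1 ≤ R}
      ≤ ENNReal.ofReal (2 * C / r) := by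
  have hR : 0 < R := hr.trans_le hrR
  set g : (Fin d → ℝ) → ℝ := fun x =>
    ramp (r / 2) r (alphaNorm α x) * (1 - ramp R (2 * R) (alphaNorm α x)) with hg
  have hgc : Continuous g := by
    have h1 := continuous_ramp (a := r / 2) (b := r)
    have h2 := continuous_ramp (a := R) (b := 2 * R)
    have h3 := continuous_alphaNorm h.α_pos
    fun_prop
  have hg0 : ∀ x, 0 ≤ g x := fun x => mul_nonneg ramp_nonneg (sub_nonneg.2 ramp_le_one)
  have hg1 : ∀ x, |g x| ≤ 1 := fun x => by
    rw [abs_of_nonneg (hg0 x)]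
    exact mul_le_one₀ ramp_le_one (sub_nonneg.2 ramp_le_one) (sub_le_self _ ramp_nonneg)
  have hgz : ∀ x, alphaNorm α x < r / 2 → g x = 0 := fun x hx => by
    simp only [hg, ramp_of_le (by linarith : r / 2 < r) hx.le, zero_mul]
  have hgs : ∀ x, g x ≠ 0 → r / 2 ≤ alphaNorm α x ∧ alphaNorm α x ≤ 2 * R := fun x hx => by
    refine ⟨not_lt.1 fun hlt => hx (hgz x hlt), not_lt.1 fun hlt => hx ?_⟩
    simp only [hg, ramp_of_ge (by linarith : R < 2 * R) hlt.le, sub_self, mul_zero]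
  obtain ⟨hi, ht⟩ := h.tendsto_annulus hgc (half_pos hr) hgs
  have hI : ∫ x : Punctured d, g x.1 ∂h.limitMeasure ≤ 2 * C / r := by
    refine le_of_tendsto ht ?_
    filter_upwards [eventually_gt_atTop 0] with u hu
    have := abs_scaledExp_le h.measurable_X h.α_pos h.tail (half_pos hr) hg1 hgz hu
    refine (le_abs_self _).trans (this.trans (le_of_eq ?_))
    field_simp
  have hset : MeasurableSet {x : Punctured d | r ≤ alphaNorm α x.1 ∧ alphaNorm α x.1 ≤ R} :=
    (measurableSet_le measurable_const h.measurable_alphaNorm_val).inter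
      (measurableSet_le h.measurable_alphaNorm_val measurable_const)
  calc h.limitMeasure {x | r ≤ alphaNorm α x.1 ∧ alphaNorm α x.1 ≤ R}
      = ∫⁻ x in {x | r ≤ alphaNorm α x.1 ∧ alphaNorm α x.1 ≤ R}, 1 ∂h.limitMeasure := by simp
    _ ≤ ∫⁻ x in {x | r ≤ alphaNorm α x.1 ∧ alphaNorm α x.1 ≤ R},
          ENNReal.ofReal (g x.1) ∂h.limitMeasure := by
        refine setLIntegral_mono' hset fun x hx => ?_
        simp only [hg, ramp_of_ge (by linarith : r / 2 < r) hx.1,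
          ramp_of_le (by linarith : R < 2 * R) hx.2]
        simp
    _ ≤ ∫⁻ x, ENNReal.ofReal (g x.1) ∂h.limitMeasure := setLIntegral_le_lintegral _ _
    _ = ENNReal.ofReal (∫ x : Punctured d, g x.1 ∂h.limitMeasure) :=
        (ofReal_integral_eq_lintegral_ofReal hi (ae_of_all _ fun x => hg0 _)).symm
    _ ≤ _ := ENNReal.ofReal_le_ofReal hI

theorem limitMeasure_ge_le (h : HasScaledLimits P X α C) {r : ℝ} (hr : 0 < r) :
    h.limitMeasure {x | r ≤ alphaNorm α x.1} ≤ ENNReal.ofReal (2 * C / r) := by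
  have hU : {x : Punctured d | r ≤ alphaNorm α x.1}
      = ⋃ n : ℕ, {x | r ≤ alphaNorm α x.1 ∧ alphaNorm α x.1 ≤ r + n} := by
    ext x
    simp only [mem_ofPred_eq, mem_iUnion]
    refine ⟨fun hx => ?_, fun ⟨n, hn⟩ => hn.1⟩
    obtain ⟨n, hn⟩ := exists_nat_ge (alphaNorm α x.1)
    exact ⟨n, hx, by linarith⟩
  have hmono : Monotone fun n : ℕ =>
      {x : Punctured d | r ≤ alphaNorm α x.1 ∧ alphaNorm α x.1 ≤ r + n} := by
    intro m n hmn x hx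
    have : (m : ℝ) ≤ n := by exact_mod_cast hmn
    exact ⟨hx.1, by linarith [hx.2]⟩
  rw [hU, hmono.measure_iUnion]
  exact iSup_le fun n => h.limitMeasure_annulus_le hr (by simp)

/-- Integrability of bounded measurable functions vanishing near the origin. -/
theorem integrable_of_vanish (h : HasScaledLimits P X α C) {f : Punctured d → ℝ}
    (hf : Measurable f) {M r : ℝ} (hM : ∀ x, |f x| ≤ M) (hr : 0 < r)
    (hf0 : ∀ x, alphaNorm α x.1 < r → f x = 0) : Integrable f h.limitMeasure := by
  have hfin : h.limitMeasure {x | r ≤ alphaNorm α x.1} < ⊤ :=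
    (h.limitMeasure_ge_le hr).trans_lt ENNReal.ofReal_lt_top
  have hset : MeasurableSet {x : Punctured d | r ≤ alphaNorm α x.1} :=
    measurableSet_le measurable_const h.measurable_alphaNorm_val
  have h1 : IntegrableOn f {x | r ≤ alphaNorm α x.1} h.limitMeasure :=
    Measure.integrableOn_of_bounded hfin.ne hf.aestronglyMeasurable (M := M)
      (ae_of_all _ fun x => hM x)
  rw [← integrable_indicator_iff hset] at h1
  have e : f = {x : Punctured d | r ≤ alphaNorm α x.1}.indicator f := by
    ext x
    by_cases hx : r ≤ alphaNorm α x.1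
    · rw [indicator_of_mem (by exact hx)]
    · rw [indicator_of_notMem (by exact hx), hf0 x (not_le.1 hx)]
  rw [e]
  exact h1

theorem abs_integral_le (h : HasScaledLimits P X α C) {f : Punctured d → ℝ}
    {M r : ℝ} (hM : ∀ x, |f x| ≤ M) (hM0 : 0 ≤ M) (hr : 0 < r)
    (hf0 : ∀ x, alphaNorm α x.1 < r → f x = 0) :
    |∫ x, f x ∂h.limitMeasure| ≤ M * (2 * C / r) := by
  have hle := h.limitMeasure_ge_le hr
  have hset : MeasurableSet {x : Punctured d | r ≤ alphaNorm α x.1} :=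
    measurableSet_le measurable_const h.measurable_alphaNorm_val
  have h1 : ∫ x, f x ∂h.limitMeasure
      = ∫ x in {x | r ≤ alphaNorm α x.1}, f x ∂h.limitMeasure := by
    rw [setIntegral_eq_integral_of_forall_compl_eq_zero]
    exact fun x hx => hf0 x (not_le.1 hx)
  rw [h1, ← Real.norm_eq_abs]
  refine (norm_setIntegral_le_of_norm_le_const (hle.trans_lt ENNReal.ofReal_lt_top)
    (fun x _ => hM x)).trans ?_
  gcongr
  rw [Measure.real]
  have := h.C_nonneg
  exact ENNReal.toReal_le_of_le_ofReal (by positivity) hle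

/-- Convergence of scaled means for bounded continuous functions vanishing near the origin. -/
theorem tendsto_scaledExp (h : HasScaledLimits P X α C) {f : (Fin d → ℝ) → ℝ} (hf : Continuous f)
    {M r : ℝ} (hM : ∀ x, |f x| ≤ M) (hr : 0 < r) (hf0 : ∀ x, alphaNorm α x < r → f x = 0) :
    Tendsto (scaledExp P X α f) atTop (𝓝 (∫ x : Punctured d, f x.1 ∂h.limitMeasure)) := by
  have hM0 : 0 ≤ M := (abs_nonneg _).trans (hM 0)
  have hC := h.C_nonneg
  refine tendsto_of_approx fun ε hε => ?_
  -- Mass beyond level R is O(1/R) both for the limit measure and, uniformly in u, for the scaled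
  -- laws; this permits cutting off at infinity.
  obtain ⟨R, hR1, hR2⟩ : ∃ R : ℝ, 0 < R ∧ M * (2 * C / R) ≤ ε := by
    refine ⟨2 * M * C / ε + 1, by positivity, ?_⟩
    rw [← mul_div_assoc, div_le_iff₀ (by positivity), mul_add, mul_div_cancel₀ _ hε.ne']
    linarith
  set g : (Fin d → ℝ) → ℝ := fun x => f x * (1 - ramp R (2 * R) (alphaNorm α x)) with hg
  have hgc : Continuous g := by
    have h2 := continuous_ramp (a := R) (b := 2 * R)
    have h3 := continuous_alphaNorm h.α_pos
    fun_prop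
  have hr01 : ∀ x, 0 ≤ 1 - ramp R (2 * R) (alphaNorm α x) := fun x => sub_nonneg.2 ramp_le_one
  have hr11 : ∀ x, 1 - ramp R (2 * R) (alphaNorm α x) ≤ 1 := fun x => by
    linarith [ramp_nonneg (a := R) (b := 2 * R) (t := alphaNorm α x)]
  have hgM : ∀ x, |g x| ≤ M := fun x => by
    simp only [hg]
    rw [abs_mul, abs_of_nonneg (hr01 x)]
    calc _ ≤ M * 1 := mul_le_mul (hM x) (hr11 x) (hr01 x) hM0
      _ = M := mul_one M
  have hgs : ∀ x, g x ≠ 0 → r ≤ alphaNorm α x ∧ alphaNorm α x ≤ 2 * R := fun x hx => by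
    refine ⟨not_lt.1 fun hlt => hx ?_, not_lt.1 fun hlt => hx ?_⟩
    · simp only [hg, hf0 x hlt, zero_mul]
    · simp only [hg, ramp_of_ge (by linarith : R < 2 * R) hlt.le, sub_self, mul_zero]
  have hdM : ∀ x, |f x - g x| ≤ M := fun x => by
    have e : f x - g x = f x * ramp R (2 * R) (alphaNorm α x) := by simp only [hg]; ring
    rw [e, abs_mul, abs_of_nonneg ramp_nonneg]
    calc _ ≤ M * 1 := mul_le_mul (hM x) ramp_le_one ramp_nonneg hM0
      _ = M := mul_one M
  have hd0 : ∀ x, alphaNorm α x < R → f x - g x = 0 := fun x hx => by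
    simp only [hg, ramp_of_le (by linarith : R < 2 * R) hx.le]; ring
  obtain ⟨hi, ht⟩ := h.tendsto_annulus hgc hr hgs
  refine ⟨_, _, ht, ?_, ?_⟩
  · have hfi : Integrable (fun x : Punctured d => f x.1) h.limitMeasure :=
      h.integrable_of_vanish (hf.comp continuous_subtype_val).measurable (fun x => hM x.1) hr
        fun x hx => hf0 x.1 hx
    rw [abs_sub_comm, ← integral_sub hfi hi]
    exact (h.abs_integral_le (fun x => hdM x.1) hM0 hR1 fun x hx => hd0 x.1 hx).trans hR2
  · filter_upwards [eventually_gt_atTop 0] with u hu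
    rw [← scaledExp_sub h.measurable_X hf.measurable hgc.measurable hM hgM]
    refine (abs_scaledExp_le h.measurable_X h.α_pos h.tail hR1 hdM hd0 hu).trans (le_trans ?_ hR2)
    gcongr
    linarith

/-- Homogeneity of the limit measure, tested on functions. -/
theorem integral_comp_dilation (h : HasScaledLimits P X α C) {f : (Fin d → ℝ) → ℝ}
    (hf : Continuous f) {M r : ℝ} (hM : ∀ x, |f x| ≤ M) (hr : 0 < r)
    (hf0 : ∀ x, alphaNorm α x < r → f x = 0) {t : ℝ} (ht : 0 < t) :
    ∫ x : Punctured d, f (dilation α t x.1) ∂h.limitMeasure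
      = t * ∫ x : Punctured d, f x.1 ∂h.limitMeasure := by
  have h1 := h.tendsto_scaledExp (f := fun x => f (dilation α t x))
    (hf.comp (continuous_dilation t)) (fun x => hM _) (r := r / t) (by positivity) fun x hx => by
      refine hf0 _ ?_
      rw [alphaNorm_dilation h.α_pos ht.le, mul_comm]
      exact (lt_div_iff₀ ht).1 hx
  -- Dilating the argument of f by t amounts to replacing u by u/t, and the prefactor u equals t ·
  -- (u/t).
  have h2 := ((h.tendsto_scaledExp hf hM hr hf0).comp (tendsto_id.atTop_div_const ht)).const_mul t
  refine tendsto_nhds_unique h1 (h2.congr' ?_)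
  filter_upwards [eventually_gt_atTop 0] with u hu
  simp only [Function.comp_apply, scaledExp, id]
  rw [← mul_assoc, mul_div_cancel₀ _ ht.ne']
  congr 2
  ext ω
  rw [dilation_dilation ht.le (by positivity), inv_div, div_eq_mul_inv]

end HasScaledLimits

end DiagonalSRE
end

/-! ### Polar coordinates, the spectral measure and angular limits. -/

noncomputable section
namespace DiagonalSRE

section Polar

variable {d : ℕ} {α : Fin d → ℝ}

theorem dilation_ne_zero (hα : ∀ j, 0 < α j) {t : ℝ} (ht : 0 < t) {x : Fin d → ℝ} (hx : x ≠ 0) :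
    dilation α t x ≠ 0 := by
  rw [← alphaNorm_pos hα, alphaNorm_dilation hα ht.le]
  exact mul_pos ht ((alphaNorm_pos hα).2 hx)

/-- Dilations are homeomorphisms of `ℝ^d ∖ {0}`. -/
def dilationHomeomorph (hα : ∀ j, 0 < α j) {t : ℝ} (ht : 0 < t) : Punctured d ≃ₜ Punctured d where
  toFun x := ⟨dilation α t x.1, dilation_ne_zero hα ht x.2⟩
  invFun x := ⟨dilation α t⁻¹ x.1, dilation_ne_zero hα (inv_pos.2 ht) x.2⟩
  left_inv x := Subtype.ext <| by
    dsimp only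
    rw [dilation_dilation (inv_pos.2 ht).le ht.le, inv_mul_cancel₀ ht.ne', dilation_one]
  right_inv x := Subtype.ext <| by
    dsimp only
    rw [dilation_dilation ht.le (inv_pos.2 ht).le, mul_inv_cancel₀ ht.ne', dilation_one]
  continuous_toFun := ((continuous_dilation t).comp continuous_subtype_val).subtype_mk _
  continuous_invFun := ((continuous_dilation t⁻¹).comp continuous_subtype_val).subtype_mk _

theorem alphaNorm_dilation_inv (hα : ∀ j, 0 < α j) {x : Fin d → ℝ} (hx : x ≠ 0) :
    alphaNorm α (dilation α (alphaNorm α x)⁻¹ x) = 1 := by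
  rw [alphaNorm_dilation hα (inv_nonneg.2 alphaNorm_nonneg),
    inv_mul_cancel₀ ((alphaNorm_pos hα).2 hx).ne']

/-- The projection `x ↦ δ_{|x|_α⁻¹} x` of `ℝ^d ∖ {0}` onto the unit sphere. -/
def angle (hα : ∀ j, 0 < α j) (x : Punctured d) : alphaSphere α 1 :=
  ⟨dilation α (alphaNorm α x.1)⁻¹ x.1, alphaNorm_dilation_inv hα x.2⟩

theorem continuous_angle (hα : ∀ j, 0 < α j) : Continuous (angle hα) := by
  refine Continuous.subtype_mk ?_ _
  have hc : Continuous fun x : Punctured d => alphaNorm α x.1 :=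
    (continuous_alphaNorm hα).comp continuous_subtype_val
  exact continuousOn_dilation.comp_continuous
    ((hc.inv₀ fun x => ((alphaNorm_pos hα).2 x.2).ne').prodMk continuous_subtype_val)
    fun x => ⟨inv_pos.2 ((alphaNorm_pos hα).2 x.2), mem_univ _⟩

theorem angle_dilation (hα : ∀ j, 0 < α j) {t : ℝ} (ht : 0 < t) (x : Punctured d) :
    angle hα (dilationHomeomorph hα ht x) = angle hα x := by
  have hx := (alphaNorm_pos hα).2 x.2
  refine Subtype.ext ?_
  change dilation α (alphaNorm α (dilation α t x.1))⁻¹ (dilation α t x.1)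
    = dilation α (alphaNorm α x.1)⁻¹ x.1
  rw [alphaNorm_dilation hα ht.le, dilation_dilation (by positivity) ht.le]
  congr 1
  field_simp

theorem dilation_angle (hα : ∀ j, 0 < α j) (x : Punctured d) :
    dilation α (alphaNorm α x.1) (angle hα x).1 = x.1 := by
  have hx := (alphaNorm_pos hα).2 x.2
  rw [angle, dilation_dilation hx.le (inv_pos.2 hx).le, mul_inv_cancel₀ hx.ne', dilation_one]

theorem continuousOn_extendZero {f : Punctured d → ℝ} (hf : Continuous f) :
    ContinuousOn (extendZero f) {0}ᶜ := by
  rw [continuousOn_iff_continuous_domRestrict]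
  convert hf.comp (continuous_id (X := ({0}ᶜ : Set (Fin d → ℝ)))) using 1
  ext x
  exact extendZero_coe f ⟨x.1, x.2⟩

end Polar

namespace HasScaledLimits

variable {d : ℕ} {Ω : Type*} [MeasurableSpace Ω] {P : Measure Ω} {X : Ω → Fin d → ℝ}
  {α : Fin d → ℝ} {C : ℝ}

theorem measurableSet_gt (h : HasScaledLimits P X α C) (r : ℝ) :
    MeasurableSet {x : Punctured d | r < alphaNorm α x.1} :=
  measurableSet_lt measurable_const h.measurable_alphaNorm_val

theorem measurable_polar (h : HasScaledLimits P X α C) :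
    Measurable fun x : Punctured d => (angle h.α_pos x, (alphaNorm α x.1)⁻¹) :=
  (continuous_angle h.α_pos).measurable.prodMk h.measurable_alphaNorm_val.inv

/-- Rewriting the mean of a function cut off along the unit sphere. -/
theorem scaledExp_indicator (h : HasScaledLimits P X α C) (g : (Fin d → ℝ) → ℝ) {u : ℝ}
    (hu : 0 < u) : scaledExp P X α ({x | 1 < alphaNorm α x}.indicator g) u
      = u * ∫ ω in {ω | u < alphaNorm α (X ω)}, g (dilation α u⁻¹ (X ω)) ∂P := by
  have hS : MeasurableSet {ω | u < alphaNorm α (X ω)} :=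
    measurableSet_lt measurable_const ((measurable_alphaNorm h.α_pos).comp h.measurable_X)
  rw [scaledExp, ← integral_indicator hS]
  congr 2
  ext ω
  have hiff : 1 < alphaNorm α (dilation α u⁻¹ (X ω)) ↔ u < alphaNorm α (X ω) := by
    rw [alphaNorm_dilation h.α_pos (inv_pos.2 hu).le, ← div_eq_inv_mul, one_lt_div hu]
  by_cases hω : u < alphaNorm α (X ω)
  · rw [indicator_of_mem (by exact hiff.2 hω), indicator_of_mem (by exact hω)]
  · rw [indicator_of_notMem (by exact fun hc => hω (hiff.1 hc)),
      indicator_of_notMem (by exact hω)]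

theorem measurable_angle_comp (h : HasScaledLimits P X α C) :
    Measurable fun ω => dilation α (alphaNorm α (X ω))⁻¹ (X ω) :=
  measurable_dilation.comp
    (((measurable_alphaNorm h.α_pos).comp h.measurable_X).inv.prodMk h.measurable_X)

theorem ae_mem_alphaSphere (h : HasScaledLimits P X α C) {t : ℝ} (ht : 0 < t) :
    ∀ᵐ x ∂((cond P {ω | t < alphaNorm α (X ω)}).map
      fun ω => dilation α (alphaNorm α (X ω))⁻¹ (X ω)), x ∈ alphaSphere α 1 := by
  have hS : MeasurableSet {ω | t < alphaNorm α (X ω)} :=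
    measurableSet_lt measurable_const ((measurable_alphaNorm h.α_pos).comp h.measurable_X)
  have hsph : MeasurableSet (alphaSphere α 1) :=
    measurableSet_eq_fun (measurable_alphaNorm h.α_pos) measurable_const
  refine (ae_map_iff h.measurable_angle_comp.aemeasurable hsph).2 ?_
  filter_upwards [ae_cond_mem hS] with ω hω
  exact alphaNorm_dilation_inv h.α_pos ((alphaNorm_pos h.α_pos).1 (ht.trans hω))

/-- The angle is invariant under dilations, so X may be replaced by its rescaling; the integral then
becomes a scaled mean cut off at the unit sphere. -/
theorem integral_angularLaw (h : HasScaledLimits P X α C) (φ : alphaSphere α 1 →ᵇ ℝ) {t : ℝ}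
    (ht : 0 < t) : ∫ ω, φ ω ∂(angularLaw P α X t) = (P.real {ω | t < alphaNorm α (X ω)})⁻¹ *
      ∫ ω in {ω | t < alphaNorm α (X ω)},
        extendZero (fun x => φ (angle h.α_pos x)) (dilation α t⁻¹ (X ω)) ∂P := by
  have hsph : MeasurableSet (alphaSphere α 1) :=
    measurableSet_eq_fun (measurable_alphaNorm h.α_pos) measurable_const
  have hS : MeasurableSet {ω | t < alphaNorm α (X ω)} :=
    measurableSet_lt measurable_const ((measurable_alphaNorm h.α_pos).comp h.measurable_X)
  set g := extendZero fun x => φ (angle h.α_pos x) with hg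
  have hgm : Measurable g := measurable_of_continuousOn_compl_singleton 0
    (continuousOn_extendZero (φ.continuous.comp (continuous_angle h.α_pos)))
  have hφ : ∀ ω : alphaSphere α 1, φ ω = g ω.1 := fun ω => by
    have h1 : alphaNorm α ω.1 = 1 := ω.2
    have h0 : ω.1 ≠ 0 := (alphaNorm_pos h.α_pos).1 (by rw [h1]; exact one_pos)
    rw [hg, extendZero_coe _ (⟨ω.1, h0⟩ : Punctured d)]
    congr 1
    refine Subtype.ext ?_
    simp only [angle, h1, inv_one, dilation_one]
  have hgY : ∀ (s : ℝ) (hs : 0 < s) (x : Fin d → ℝ), x ≠ 0 → g (dilation α s x) = g x :=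
    fun s hs x hx => by
      rw [hg, extendZero_coe _ (⟨x, hx⟩ : Punctured d), ← angle_dilation h.α_pos hs]
      exact extendZero_coe _ (dilationHomeomorph h.α_pos hs ⟨x, hx⟩)
  simp only [hφ]
  rw [angularLaw, integral_subtype_comap hsph, setIntegral_eq_integral_of_ae_compl_eq_zero
    ((h.ae_mem_alphaSphere ht).mono fun x hx hn => absurd hx hn),
    integral_map h.measurable_angle_comp.aemeasurable hgm.aestronglyMeasurable, ProbabilityTheory.cond,
    integral_smul_measure, ENNReal.toReal_inv, smul_eq_mul, Measure.real]
  congr 1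
  refine setIntegral_congr_fun hS fun ω hω => ?_
  have hpos : 0 < alphaNorm α (X ω) := ht.trans hω
  have hne := (alphaNorm_pos h.α_pos).1 hpos
  rw [hgY _ (inv_pos.2 hpos) _ hne, hgY _ (inv_pos.2 ht) _ hne]

variable [IsProbabilityMeasure P]

open scoped CompactlySupported

/-- Homogeneity of the limit measure. -/
theorem map_dilation (h : HasScaledLimits P X α C) {t : ℝ} (ht : 0 < t) :
    h.limitMeasure.map (dilationHomeomorph h.α_pos ht) = ENNReal.ofReal t • h.limitMeasure := by
  -- Regularity of both sides reduces their equality to integrals of compactly supported functions.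
  have := Measure.Regular.map (μ := h.limitMeasure) (dilationHomeomorph h.α_pos ht)
  have := Measure.Regular.smul (μ := h.limitMeasure) (x := ENNReal.ofReal t) ENNReal.ofReal_ne_top
  refine Measure.ext_of_integral_eq_on_compactlySupported fun f => ?_
  obtain ⟨r, R, hr, -, hfr⟩ := exists_annulus h.α_pos f.hasCompactSupport
  obtain ⟨M, hM⟩ := exists_bound_extendZero f
  have h1 := h.integral_comp_dilation (f := extendZero f)
    (continuous_extendZero (f := ⇑f) f.continuous f.hasCompactSupport) hM hr
    (fun x hx => by_contra fun hne => not_lt.2 (hfr x hne).1 hx) ht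
  rw [integral_map (dilationHomeomorph h.α_pos ht).continuous.aemeasurable
    (f := ⇑f) f.continuous.aestronglyMeasurable, integral_smul_measure, ENNReal.toReal_ofReal ht.le,
    smul_eq_mul]
  simp only [extendZero_coe] at h1
  rw [← h1]
  congr 1
  ext x
  exact (extendZero_coe f (dilationHomeomorph h.α_pos ht x)).symm

/-- The spectral measure on the unit sphere. -/
def spectralMeasure (h : HasScaledLimits P X α C) : Measure (alphaSphere α 1) :=
  (h.limitMeasure.restrict {x | 1 < alphaNorm α x.1}).map (angle h.α_pos)

theorem spectralMeasure_apply (h : HasScaledLimits P X α C) {s : Set (alphaSphere α 1)}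
    (hs : MeasurableSet s) : h.spectralMeasure s
      = h.limitMeasure {x | angle h.α_pos x ∈ s ∧ 1 < alphaNorm α x.1} := by
  have hm := (continuous_angle h.α_pos).measurable
  rw [spectralMeasure, Measure.map_apply hm hs, Measure.restrict_apply (hm hs)]
  rfl

instance (h : HasScaledLimits P X α C) : IsFiniteMeasure h.spectralMeasure := by
  refine ⟨?_⟩
  rw [h.spectralMeasure_apply MeasurableSet.univ]
  exact (measure_mono fun x hx => hx.2.le).trans_lt
    ((h.limitMeasure_ge_le one_pos).trans_lt ENNReal.ofReal_lt_top)

/-- In the coordinates `(angle x, |x|_α⁻¹)` the limit measure is a product measure. -/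
theorem map_polar (h : HasScaledLimits P X α C) :
    h.limitMeasure.map (fun x => (angle h.α_pos x, (alphaNorm α x.1)⁻¹))
      = h.spectralMeasure.prod (volume.restrict (Ioi 0)) := by
  have hm := (continuous_angle h.α_pos).measurable
  symm
  -- The inverse radius turns the radial density s^{-2} into Lebesgue measure. For b > 0, the points
  -- with angle in s and 1/|x|_α < b form the preimage under δ_b of those with angle in s and |x|_α
  -- > 1, so homogeneity gives them mass b times the spectral mass of s.
  refine Measure.prod_eq_generateFrom (C := {s | MeasurableSet s}) (D := range Iio)
    (by simp) ?_ MeasurableSpace.isPiSystem_measurableSet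
    isPiSystem_Iio h.spectralMeasure.toFiniteSpanningSetsIn
    ⟨fun n => Iio (n : ℝ), fun n => ⟨_, rfl⟩, fun n => ?_, ?_⟩ ?_
  · rw [BorelSpace.measurable_eq (α := ℝ), borel_eq_generateFrom_Iio]
  · rw [Measure.restrict_apply measurableSet_Iio, inter_comm, Ioi_inter_Iio, Real.volume_Ioo]
    exact ENNReal.ofReal_lt_top
  · refine eq_univ_of_forall fun x => ?_
    obtain ⟨n, hn⟩ := exists_nat_gt x
    exact mem_iUnion.2 ⟨n, hn⟩
  rintro s hs _ ⟨b, rfl⟩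
  have hs : MeasurableSet s := hs
  rw [Measure.map_apply h.measurable_polar (hs.prod measurableSet_Iio),
    Measure.restrict_apply measurableSet_Iio, inter_comm, Ioi_inter_Iio, Real.volume_Ioo, sub_zero]
  rcases le_or_gt b 0 with hb | hb
  · rw [ENNReal.ofReal_of_nonpos hb, mul_zero]
    refine measure_mono_null (t := ∅) (fun x hx => ?_) measure_empty
    have h1 : (alphaNorm α x.1)⁻¹ < b := hx.2
    exact absurd (h1.trans_le hb) (not_lt.2 (inv_nonneg.2 alphaNorm_nonneg))
  · have hset : (fun x : Punctured d => (angle h.α_pos x, (alphaNorm α x.1)⁻¹)) ⁻¹' (s ×ˢ Iio b)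
        = dilationHomeomorph h.α_pos hb ⁻¹' {x | angle h.α_pos x ∈ s ∧ 1 < alphaNorm α x.1} := by
      ext x
      have hx := (alphaNorm_pos h.α_pos).2 x.2
      simp only [mem_preimage, mem_prod, mem_Iio, mem_ofPred_eq, angle_dilation]
      refine and_congr_right fun _ => ?_
      have : alphaNorm α (dilationHomeomorph h.α_pos hb x).1 = b * alphaNorm α x.1 :=
        alphaNorm_dilation h.α_pos hb.le
      rw [this, inv_lt_iff_one_lt_mul₀ hx, mul_comm]
    have hset' : MeasurableSet {x | angle h.α_pos x ∈ s ∧ 1 < alphaNorm α x.1} :=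
      (hm hs).inter (h.measurableSet_gt 1)
    rw [hset, ← Measure.map_apply (dilationHomeomorph h.α_pos hb).continuous.measurable hset', h.map_dilation hb, Measure.smul_apply, smul_eq_mul,
      h.spectralMeasure_apply hs, mul_comm]

/-- In polar coordinates a sphere fixes the radial coordinate, and Lebesgue measure has no atoms. -/
theorem limitMeasure_sphere (h : HasScaledLimits P X α C) (r : ℝ) :
    h.limitMeasure {x | alphaNorm α x.1 = r} = 0 := by
  have hm := h.measurable_polar
  have h1 : h.limitMeasure.map (fun x => (angle h.α_pos x, (alphaNorm α x.1)⁻¹))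
      (univ ×ˢ {r⁻¹}) = 0 := by
    rw [h.map_polar, Measure.prod_prod]
    simp
  rw [Measure.map_apply hm (MeasurableSet.univ.prod (measurableSet_singleton _))] at h1
  refine measure_mono_null (fun x hx => ?_) h1
  exact ⟨mem_univ _, congrArg (·⁻¹) hx⟩

/-- Fubini for the product form, followed by the substitution s ↦ 1/s. -/
theorem integral_polar (h : HasScaledLimits P X α C) {f : (Fin d → ℝ) → ℝ} (hf : Measurable f)
    (hfi : Integrable (fun x : Punctured d => f x.1) h.limitMeasure) :
    ∫ x : Punctured d, f x.1 ∂h.limitMeasure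
      = ∫ s in Ioi (0 : ℝ), (∫ ω, f (dilation α s ω.1) ∂h.spectralMeasure) / s ^ 2 := by
  have hm := h.measurable_polar
  set F : alphaSphere α 1 × ℝ → ℝ := fun z => f (dilation α z.2⁻¹ z.1.1) with hF
  have hFm : Measurable F :=
    hf.comp (measurable_dilation.comp
      (measurable_snd.inv.prodMk (measurable_subtype_coe.comp measurable_fst)))
  have hcomp : ∀ x : Punctured d, F (angle h.α_pos x, (alphaNorm α x.1)⁻¹) = f x.1 := fun x => by
    simp only [hF, inv_inv, dilation_angle]
  have hFi : Integrable F (h.spectralMeasure.prod (volume.restrict (Ioi 0))) := by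
    rw [← h.map_polar, integrable_map_measure hFm.aestronglyMeasurable hm.aemeasurable]
    exact hfi.congr (ae_of_all _ fun x => (hcomp x).symm)
  have h1 : ∫ x : Punctured d, f x.1 ∂h.limitMeasure
      = ∫ s in Ioi (0 : ℝ), ∫ ω, f (dilation α s⁻¹ ω.1) ∂h.spectralMeasure := by
    rw [← integral_prod_symm F hFi, ← h.map_polar,
      integral_map hm.aemeasurable hFm.aestronglyMeasurable]
    exact integral_congr_ae (ae_of_all _ fun x => (hcomp x).symm)
  rw [h1, ← integral_comp_rpow_Ioi _ (p := -1) (by norm_num)]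
  refine setIntegral_congr_fun measurableSet_Ioi fun s hs => ?_
  have hs : 0 < s := hs
  simp only [Real.rpow_neg_one, inv_inv, smul_eq_mul, abs_neg, abs_one, one_mul]
  rw [div_eq_mul_inv, mul_comm]
  congr 1
  rw [show (-1 - 1 : ℝ) = -(2 : ℕ) by norm_num, Real.rpow_neg hs.le, Real.rpow_natCast]

/-- Continuous functions close to the indicator of a sphere have small limit. -/
theorem exists_hat (h : HasScaledLimits P X α C) {ε : ℝ} (hε : 0 < ε) :
    ∃ η : ℝ, 0 < η ∧ η ≤ 1 / 2 ∧ ∫ x : Punctured d, ramp (1 - η) 1 (alphaNorm α x.1) *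
      (1 - ramp (1 + η) (1 + 2 * η) (alphaNorm α x.1)) ∂h.limitMeasure < ε := by
  have hhalf : ∀ᶠ η : ℝ in 𝓝[>] 0, η ∈ Ioc (0 : ℝ) (1 / 2) := Ioc_mem_nhdsGT (by norm_num)
  have hnorm : ∀ η : ℝ, ∀ t : ℝ, ‖ramp (1 - η) 1 t * (1 - ramp (1 + η) (1 + 2 * η) t)‖ ≤ 1 :=
    fun η t => by
      rw [Real.norm_of_nonneg (mul_nonneg ramp_nonneg (sub_nonneg.2 ramp_le_one))]
      exact mul_le_one₀ ramp_le_one (sub_nonneg.2 ramp_le_one) (sub_le_self _ ramp_nonneg)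
  have hset : MeasurableSet {x : Punctured d | 1 / 2 ≤ alphaNorm α x.1} :=
    measurableSet_le measurable_const h.measurable_alphaNorm_val
  have hlim : Tendsto (fun η : ℝ => ∫ x : Punctured d, ramp (1 - η) 1 (alphaNorm α x.1) *
      (1 - ramp (1 + η) (1 + 2 * η) (alphaNorm α x.1)) ∂h.limitMeasure) (𝓝[>] 0)
      (𝓝 (∫ _ : Punctured d, (0 : ℝ) ∂h.limitMeasure)) := by
    refine tendsto_integral_filter_of_dominated_convergence
      ({x | 1 / 2 ≤ alphaNorm α x.1}.indicator fun _ => 1) ?_ ?_ ?_ ?_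
    · refine Eventually.of_forall fun η => Measurable.aestronglyMeasurable ?_
      exact (continuous_ramp.measurable.comp h.measurable_alphaNorm_val).mul
        ((continuous_ramp.measurable.comp h.measurable_alphaNorm_val).const_sub _)
    · filter_upwards [hhalf] with η hη
      refine ae_of_all _ fun x => ?_
      by_cases hx : 1 / 2 ≤ alphaNorm α x.1
      · rw [indicator_of_mem (by exact hx)]
        exact hnorm _ _
      · rw [indicator_of_notMem (by exact hx),
          ramp_of_le (by linarith [hη.1]) (by linarith [hη.2, not_le.1 hx])]
        simp
    · rw [integrable_indicator_iff hset]
      exact integrableOn_const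
        ((h.limitMeasure_ge_le (by norm_num)).trans_lt ENNReal.ofReal_lt_top).ne
    · have hae : ∀ᵐ x : Punctured d ∂h.limitMeasure, alphaNorm α x.1 ≠ 1 :=
        measure_eq_zero_iff_ae_notMem.1 (h.limitMeasure_sphere 1)
      -- Off the unit sphere, which is null, the hat function vanishes at x once η is small.
      filter_upwards [hae] with x hx
      refine tendsto_const_nhds.congr' ?_
      rcases lt_or_gt_of_ne hx with hlt | hgt
      · filter_upwards [Ioc_mem_nhdsGT (sub_pos.2 hlt)] with η hη
        rw [ramp_of_le (by linarith [hη.1]) (by linarith [hη.2]), zero_mul]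
      · filter_upwards [Ioc_mem_nhdsGT (half_pos (sub_pos.2 hgt))] with η hη
        rw [ramp_of_ge (a := 1 + η) (by linarith [hη.1]) (by linarith [hη.2]), sub_self, mul_zero]
  rw [integral_zero] at hlim
  obtain ⟨η, hη1, hη2⟩ := ((hlim.eventually_lt_const hε).and hhalf).exists
  exact ⟨η, hη2.1, hη2.2, hη1⟩

/-- Convergence of scaled means for functions cut off along the unit sphere. -/
theorem tendsto_scaledExp_indicator (h : HasScaledLimits P X α C) {g : (Fin d → ℝ) → ℝ}
    (hg : ContinuousOn g {0}ᶜ) {M : ℝ} (hM : ∀ x, |g x| ≤ M) :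
    Tendsto (scaledExp P X α ({x | 1 < alphaNorm α x}.indicator g)) atTop
      (𝓝 (∫ x : Punctured d in {x | 1 < alphaNorm α x.1}, g x.1 ∂h.limitMeasure)) := by
  have hM0 : 0 ≤ M := (abs_nonneg _).trans (hM 0)
  have hnc := continuous_alphaNorm h.α_pos
  set G : (Fin d → ℝ) → ℝ := {x | 1 < alphaNorm α x}.indicator g with hG
  have hGm : Measurable G := (measurable_of_continuousOn_compl_singleton 0 hg).indicator
    (measurableSet_lt measurable_const hnc.measurable)
  have hGM : ∀ x, |G x| ≤ M := fun x => by
    by_cases hx : 1 < alphaNorm α x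
    · rw [hG, indicator_of_mem (by exact hx)]; exact hM x
    · rw [hG, indicator_of_notMem (by exact hx), abs_zero]; exact hM0
  have hG0 : ∀ x, alphaNorm α x < 1 → G x = 0 := fun x hx => by
    rw [hG, indicator_of_notMem (by exact not_lt.2 hx.le)]
  have hGint : ∫ x : Punctured d in {x | 1 < alphaNorm α x.1}, g x.1 ∂h.limitMeasure
      = ∫ x : Punctured d, G x.1 ∂h.limitMeasure := by
    rw [← integral_indicator (h.measurableSet_gt 1)]
    rfl
  rw [hGint]
  refine tendsto_of_approx fun ε hε => ?_
  obtain ⟨η, hη0, hη1, hη⟩ := h.exists_hat (ε := ε / (M + 1)) (by positivity)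
  set k : (Fin d → ℝ) → ℝ := fun x => ramp (1 - η) 1 (alphaNorm α x) *
      (1 - ramp (1 + η) (1 + 2 * η) (alphaNorm α x)) with hk
  -- The sharp cutoff is replaced by a ramp; the error is at most M times the hat function k around
  -- the unit sphere, whose scaled means have small limit. The ramp also removes the possible
  -- discontinuity of g at 0.
  set f : (Fin d → ℝ) → ℝ := fun x => g x * ramp 1 (1 + η) (alphaNorm α x) with hf
  have hkc : Continuous k := by
    have h1 := continuous_ramp (a := 1 - η) (b := 1)
    have h2 := continuous_ramp (a := 1 + η) (b := 1 + 2 * η)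
    fun_prop
  have hk0 : ∀ x, 0 ≤ k x := fun x => mul_nonneg ramp_nonneg (sub_nonneg.2 ramp_le_one)
  have hk1 : ∀ x, |k x| ≤ 1 := fun x => by
    rw [abs_of_nonneg (hk0 x)]
    exact mul_le_one₀ ramp_le_one (sub_nonneg.2 ramp_le_one) (sub_le_self _ ramp_nonneg)
  have hkz : ∀ x, alphaNorm α x < 1 / 2 → k x = 0 := fun x hx => by
    simp only [hk]
    rw [ramp_of_le (by linarith) (by linarith), zero_mul]
  have hf0 : ∀ x, alphaNorm α x ≤ 1 → f x = 0 := fun x hx => by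
    simp only [hf, ramp_of_le (by linarith : (1 : ℝ) < 1 + η) hx, mul_zero]
  have hfc : Continuous f := by
    rw [continuous_iff_continuousAt]
    intro x
    by_cases hx : x = 0
    · have : f =ᶠ[𝓝 x] fun _ => 0 := by
        have hop : IsOpen {y | alphaNorm α y < 1} := isOpen_lt hnc continuous_const
        filter_upwards [hop.mem_nhds (by
          show alphaNorm α x < 1
          rw [hx, alphaNorm_zero h.α_pos]; exact one_pos)] with y hy
        exact hf0 y (le_of_lt hy)
      exact continuousAt_const.congr this.symm
    · exact (hg.continuousAt (isOpen_compl_singleton.mem_nhds hx)).mul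
        (continuous_ramp.comp hnc).continuousAt
  have hfM : ∀ x, |f x| ≤ M := fun x => by
    simp only [hf]
    rw [abs_mul, abs_of_nonneg ramp_nonneg]
    calc _ ≤ M * 1 := mul_le_mul (hM x) ramp_le_one ramp_nonneg hM0
      _ = M := mul_one M
  have hdiff : ∀ x, |G x - f x| ≤ M * k x := fun x => by
    rcases le_or_gt (alphaNorm α x) 1 with hx | hx
    · rw [hf0 x hx, hG, indicator_of_notMem (by exact not_lt.2 hx), sub_self, abs_zero]
      exact mul_nonneg hM0 (hk0 x)
    rw [hG, indicator_of_mem (by exact hx)]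
    have e : g x - f x = g x * (1 - ramp 1 (1 + η) (alphaNorm α x)) := by simp only [hf]; ring
    rw [e, abs_mul, abs_of_nonneg (sub_nonneg.2 ramp_le_one)]
    refine mul_le_mul (hM x) ?_ (sub_nonneg.2 ramp_le_one) hM0
    simp only [hk]
    rw [ramp_of_ge (a := 1 - η) (by linarith) hx.le, one_mul]
    rcases le_total (alphaNorm α x) (1 + η) with hx2 | hx2
    · rw [ramp_of_le (a := 1 + η) (by linarith) hx2]
      linarith [ramp_nonneg (a := 1) (b := 1 + η) (t := alphaNorm α x)]
    · rw [ramp_of_ge (a := 1) (by linarith) hx2, sub_self]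
      exact sub_nonneg.2 ramp_le_one
  have hki : Integrable (fun x : Punctured d => k x.1) h.limitMeasure :=
    h.integrable_of_vanish (hkc.comp continuous_subtype_val).measurable (fun x => hk1 x.1)
      (by norm_num) fun x hx => hkz x.1 hx
  have hGi : Integrable (fun x : Punctured d => G x.1) h.limitMeasure :=
    h.integrable_of_vanish (hGm.comp measurable_subtype_coe) (fun x => hGM x.1)
      one_pos fun x hx => hG0 x.1 hx
  have hfi : Integrable (fun x : Punctured d => f x.1) h.limitMeasure :=
    h.integrable_of_vanish (hfc.comp continuous_subtype_val).measurable (fun x => hfM x.1)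
      one_pos fun x hx => hf0 x.1 (le_of_lt hx)
  have hsmall : M * ∫ x : Punctured d, k x.1 ∂h.limitMeasure < ε := by
    have h1 : 0 ≤ ∫ x : Punctured d, k x.1 ∂h.limitMeasure := integral_nonneg fun x => hk0 x.1
    rw [lt_div_iff₀ (by positivity)] at hη
    linarith
  refine ⟨_, _, h.tendsto_scaledExp hfc hfM one_pos fun x hx => hf0 x hx.le, ?_, ?_⟩
  · rw [abs_sub_comm, ← integral_sub hGi hfi, ← Real.norm_eq_abs]
    refine (norm_integral_le_of_norm_le (hki.const_mul M) (ae_of_all _ fun x => hdiff x.1)).trans ?_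
    rw [integral_const_mul]
    exact hsmall.le
  · have hkt := (h.tendsto_scaledExp hkc hk1 (by norm_num : (0 : ℝ) < 1 / 2) hkz).const_mul M
    filter_upwards [hkt.eventually_lt_const hsmall, eventually_gt_atTop 0] with u hu hu0
    rw [← scaledExp_sub h.measurable_X hGm hfc.measurable hGM hfM]
    refine le_trans ?_ hu.le
    rw [scaledExp, abs_mul, abs_of_pos hu0, scaledExp, mul_left_comm, ← integral_const_mul,
      ← Real.norm_eq_abs]
    refine mul_le_mul_of_nonneg_left (norm_integral_le_of_norm_le
      ((integrable_comp_dilation h.measurable_X hkc.measurable hk1 _).const_mul M)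
      (ae_of_all _ fun ω => hdiff _)) hu0.le

theorem tendsto_tail (h : HasScaledLimits P X α C) :
    Tendsto (fun u : ℝ => u * P.real {ω | u < alphaNorm α (X ω)}) atTop
      (𝓝 (h.spectralMeasure.real univ)) := by
  have h1 := h.tendsto_scaledExp_indicator (g := fun _ => 1) continuousOn_const (M := 1) (by simp)
  have h2 : h.spectralMeasure.real univ
      = ∫ x : Punctured d in {x | 1 < alphaNorm α x.1}, (1 : ℝ) ∂h.limitMeasure := by
    rw [Measure.real, h.spectralMeasure_apply MeasurableSet.univ]
    simp [Measure.real]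
  rw [h2]
  refine h1.congr' ?_
  filter_upwards [eventually_gt_atTop 0] with u hu
  rw [h.scaledExp_indicator _ hu]
  simp

/-- A null tail at level t would annihilate all later tails and contradict the positive limit;
conditioning is therefore meaningful at every t. -/
theorem measure_gt_ne_zero (h : HasScaledLimits P X α C) (hc : 0 < h.spectralMeasure.real univ)
    (t : ℝ) : P {ω | t < alphaNorm α (X ω)} ≠ 0 := by
  intro h0
  obtain ⟨u, hu1, hu2⟩ := ((h.tendsto_tail.eventually_const_lt hc).and
    (eventually_ge_atTop t)).exists
  have : P {ω | u < alphaNorm α (X ω)} = 0 :=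
    measure_mono_null (fun ω (hω : u < _) => lt_of_le_of_lt hu2 hω) h0
  simp [Measure.real, this] at hu1

theorem isProbabilityMeasure_angularLaw (h : HasScaledLimits P X α C)
    (hc : 0 < h.spectralMeasure.real univ) {t : ℝ} (ht : 0 < t) :
    IsProbabilityMeasure (angularLaw P α X t) := by
  have hsph : MeasurableSet (alphaSphere α 1) :=
    measurableSet_eq_fun (measurable_alphaNorm h.α_pos) measurable_const
  have := cond_isProbabilityMeasure (h.measure_gt_ne_zero hc t)
  have := Measure.isProbabilityMeasure_map (μ := cond P {ω | t < alphaNorm α (X ω)})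
    h.measurable_angle_comp.aemeasurable
  refine ⟨?_⟩
  rw [angularLaw, (MeasurableEmbedding.subtype_coe hsph).comap_apply, image_univ,
    Subtype.range_coe]
  exact prob_compl_eq_zero_iff hsph |>.1 (h.ae_mem_alphaSphere ht)

/-- The conditional mean is the quotient of two scaled means cut off at the unit sphere, for φ ∘
angle and for 1, and both converge. -/
theorem tendsto_angularLaw (h : HasScaledLimits P X α C)
    (hc : 0 < h.spectralMeasure.real univ) (φ : alphaSphere α 1 →ᵇ ℝ) :
    Tendsto (fun t : ℝ => ∫ ω, φ ω ∂(angularLaw P α X t)) atTop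
      (𝓝 (∫ ω, φ ω ∂((h.spectralMeasure univ)⁻¹ • h.spectralMeasure))) := by
  have hcont : Continuous fun x => φ (angle h.α_pos x) :=
    φ.continuous.comp (continuous_angle h.α_pos)
  have h1 := h.tendsto_scaledExp_indicator (continuousOn_extendZero hcont) (M := ‖φ‖) fun x => by
    by_cases hx : x = 0
    · simp [hx, extendZero_zero]
    · rw [extendZero, dif_pos hx]
      exact φ.norm_coe_le_norm _
  have h2 : ∫ ω, φ ω ∂h.spectralMeasure = ∫ x : Punctured d in {x | 1 < alphaNorm α x.1},
      extendZero (fun x => φ (angle h.α_pos x)) x.1 ∂h.limitMeasure := by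
    rw [spectralMeasure, integral_map (continuous_angle h.α_pos).measurable.aemeasurable
      φ.continuous.aestronglyMeasurable]
    simp only [extendZero_coe]
  rw [← h2] at h1
  rw [integral_smul_measure, ENNReal.toReal_inv, smul_eq_mul]
  refine ((h.tendsto_tail.inv₀ hc.ne').mul h1).congr' ?_
  filter_upwards [eventually_gt_atTop 0] with t ht
  rw [h.integral_angularLaw φ ht, h.scaledExp_indicator _ ht, mul_inv]
  field_simp

end HasScaledLimits

end DiagonalSRE
end

/-! ### Reduction of the theorem to the scalar weight W. -/

noncomputable section
namespace DiagonalSRE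

theorem rpow_mul_posLog_rpow {a y : ℝ} (ha : 0 ≤ a) (hy : 0 < y) :
    a ^ y * Real.posLog (a ^ y) = y * (a ^ y * Real.posLog a) := by
  rcases ha.eq_or_lt with h0 | h0
  · rw [← h0, Real.zero_rpow hy.ne']; simp
  · rw [Real.posLog, Real.posLog, Real.log_rpow h0, mul_left_comm, mul_max_of_nonneg _ _ hy.le,
      mul_zero]

theorem isArithmetic_condLogLaw {Ω : Type*} [MeasurableSpace Ω] {P : Measure Ω}
    {Y : Ω → ℝ} (hY : Measurable Y) {y a : ℝ} (hy : 0 < y)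
    (h : ∀ᵐ ω ∂P, |Y ω| ^ y ≠ 0 → Real.log (|Y ω| ^ y) ∈ AddSubgroup.zmultiples a) :
    IsArithmetic (condLogLaw P Y) := by
  -- The logarithm of |Y|^y is y log |Y|, so the lattice shrinks by the factor y. A degenerate
  -- lattice a = 0 forces log |Y| = 0, which any positive b accommodates.
  obtain ⟨b, hb, hab⟩ : ∃ b : ℝ, 0 < b ∧ ∀ x : ℝ, y * x ∈ AddSubgroup.zmultiples a →
      x ∈ AddSubgroup.zmultiples b := by
    by_cases ha : a = 0
    · refine ⟨1, one_pos, fun x hx => ?_⟩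
      rw [ha, AddSubgroup.zmultiples_zero_eq_bot, AddSubgroup.mem_bot] at hx
      rw [(mul_eq_zero.1 hx).resolve_left hy.ne']
      exact zero_mem _
    · refine ⟨|a| / y, by positivity, fun x hx => ?_⟩
      obtain ⟨n, hn⟩ := AddSubgroup.mem_zmultiples_iff.1 hx
      have hx' : x = n * a / y := by
        rw [zsmul_eq_mul] at hn
        rw [hn]; field_simp
      rcases abs_choice a with h1 | h1
      · exact AddSubgroup.mem_zmultiples_iff.2 ⟨n, by rw [h1, zsmul_eq_mul, hx']; ring⟩
      · exact AddSubgroup.mem_zmultiples_iff.2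
          ⟨-n, by rw [h1, zsmul_eq_mul, hx']; push_cast; ring⟩
  have hS : MeasurableSet {ω | Y ω ≠ 0} := (measurableSet_eq_fun hY measurable_const).compl
  have hZ : MeasurableSet (AddSubgroup.zmultiples b : Set ℝ) := by
    rw [AddSubgroup.coe_zmultiples]
    exact (countable_range _).measurableSet
  refine ⟨b, hb, ?_⟩
  change ∀ᵐ x ∂(condLogLaw P Y), x ∈ (AddSubgroup.zmultiples b : Set ℝ)
  refine (ae_map_iff (Real.measurable_log.comp hY.norm).aemeasurable hZ).2 ?_
  filter_upwards [ae_cond_mem hS, cond_absolutelyContinuous.ae_le h] with ω hω h1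
  have hpos : 0 < |Y ω| := abs_pos.2 hω
  refine hab _ ?_
  change y * Real.log |Y ω| ∈ _
  rw [← Real.log_rpow hpos]
  exact h1 (Real.rpow_pos_of_pos hpos _).ne'

theorem HomogeneousSRE.exists_hasScaledLimits {d : ℕ} {Ω : Type*} [MeasurableSpace Ω]
    {P : Measure Ω} [IsProbabilityMeasure P] {A B X : Ω → Fin d → ℝ} {α : Fin d → ℝ} {W : Ω → ℝ}
    {p : ℝ} (h : HomogeneousSRE P A B X α W p) : ∃ C, HasScaledLimits P X α C := by
  obtain ⟨C, hC0, hC⟩ := h.exists_tail_bound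
  exact ⟨C, h.measurable_X, h.α_pos, hC0, hC, fun f hf r R hr hrR hfr =>
    h.exists_tendsto_scaledExp hf hr hrR hfr⟩

theorem SupportedAwayFromZero.exists_vanish {d : ℕ} {α : Fin d → ℝ} {f : (Fin d → ℝ) →ᵇ ℝ}
    (hf : SupportedAwayFromZero α f) :
    ∃ r : ℝ, 0 < r ∧ ∀ x, alphaNorm α x < r → f x = 0 := by
  obtain ⟨r, hr, hs⟩ := hf
  exact ⟨r, hr, fun x hx => image_eq_zero_of_notMem_tsupport fun hx' => hs hx' hx⟩

end DiagonalSRE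
end

open DiagonalSRE

theorem mainTheorem3 {d : ℕ} [NeZero d] {Ω : Type*} [MeasurableSpace Ω]
    (P : Measure Ω) [IsProbabilityMeasure P]
    (A B X : Ω → Fin d → ℝ) (hA : Measurable A) (hB : Measurable B) (hX : Measurable X)
    -- `X` has the same law as `diag(A) X + B`, and `A`, `X` are independent
    (h_affine : IdentDistrib X
      (fun ω => Matrix.mulVec (Matrix.diagonal (A ω)) (X ω) + B ω) P P)
    (h_indep : IndepFun A X P)
    -- non-arithmeticity
    (h_nonarith : ∀ j, ¬ DiagonalSRE.IsArithmetic
      (DiagonalSRE.condLogLaw P (fun ω => A ω j)))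
    -- Cramér exponents
    (α : Fin d → ℝ) (hα : ∀ j, 0 < α j)
    (h_cramer : ∀ j, ∫ ω, |A ω j| ^ α j ∂P = 1)
    -- moment conditions; `σ = 0` is allowed when `X` and `B` are independent
    (h_log : ∀ j, Integrable (fun ω => |A ω j| ^ α j * Real.posLog |A ω j|) P)
    (h_moment :
      (∀ j, ∃ σ : ℝ, 0 < σ ∧ Integrable (fun ω => |B ω j| ^ (α j + σ)) P) ∨
      (IndepFun X B P ∧ ∀ j, Integrable (fun ω => |B ω j| ^ α j) P))
    -- the homogeneous case
    (h_hom : ∀ j, ∀ᵐ ω ∂P, |A ω j| ^ α j = |A ω 0| ^ α 0) :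
    ∃ (Λ : Measure (DiagonalSRE.Punctured d)) (c : ℝ)
      (ν' : Measure (DiagonalSRE.alphaSphere α 1)),
      -- `Λ` is a Radon measure, `ν'` is a finite measure
      Λ.Regular ∧ IsFiniteMeasure ν' ∧
      -- weak convergence to `Λ`
      (∀ f : (Fin d → ℝ) →ᵇ ℝ, DiagonalSRE.SupportedAwayFromZero α f →
        Integrable (fun x : DiagonalSRE.Punctured d => f x.1) Λ ∧
        Tendsto (fun t : ℝ => t * ∫ ω, f (DiagonalSRE.dilation α t⁻¹ (X ω)) ∂P) atTop
          (𝓝 (∫ x : DiagonalSRE.Punctured d, f x.1 ∂Λ))) ∧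
      -- existence of `c_∞`
      Tendsto (fun t : ℝ => t * P.real {ω | t < DiagonalSRE.alphaNorm α (X ω)}) atTop (𝓝 c) ∧
      -- homogeneity of `Λ`
      (∀ f : (Fin d → ℝ) →ᵇ ℝ, DiagonalSRE.SupportedAwayFromZero α f → ∀ t : ℝ, 0 < t →
        ∫ x : DiagonalSRE.Punctured d, f (DiagonalSRE.dilation α t x.1) ∂Λ
          = t * ∫ x : DiagonalSRE.Punctured d, f x.1 ∂Λ) ∧
      -- `Λ` is finite off balls and does not charge spheres
      (∀ r : ℝ, 0 < r → Λ (Subtype.val ⁻¹' (DiagonalSRE.alphaBall α r)ᶜ) < ⊤) ∧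
      (∀ r : ℝ, 0 < r → Λ (Subtype.val ⁻¹' DiagonalSRE.alphaSphere α r) = 0) ∧
      -- polar decomposition
      (∀ f : (Fin d → ℝ) →ᵇ ℝ, DiagonalSRE.SupportedAwayFromZero α f →
        ∫ x : DiagonalSRE.Punctured d, f x.1 ∂Λ
          = ∫ s in Ioi (0 : ℝ), (∫ ω, f (DiagonalSRE.dilation α s ω.1) ∂ν') / s ^ 2) ∧
      ν' univ = ENNReal.ofReal c ∧
      -- convergence of the conditional angular laws
      (0 < c →
        (∀ t : ℝ, 0 < t → IsProbabilityMeasure (DiagonalSRE.angularLaw P α X t)) ∧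
        IsProbabilityMeasure ((ENNReal.ofReal c)⁻¹ • ν') ∧
        (∀ φ : DiagonalSRE.alphaSphere α 1 →ᵇ ℝ,
          Tendsto (fun t : ℝ => ∫ ω, φ ω ∂(DiagonalSRE.angularLaw P α X t)) atTop
            (𝓝 (∫ ω, φ ω ∂((ENNReal.ofReal c)⁻¹ • ν')))) ∧
        (∀ f : (Fin d → ℝ) →ᵇ ℝ, DiagonalSRE.SupportedAwayFromZero α f →
          ∫ x : DiagonalSRE.Punctured d, f x.1 ∂Λ
            = c * ∫ s in Ioi (0 : ℝ),
                (∫ ω, f (DiagonalSRE.dilation α s ω.1) ∂((ENNReal.ofReal c)⁻¹ • ν')) / s ^ 2)) := by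
  obtain ⟨p, hp0, hp1, hαp⟩ := exists_exponent hα
  have hWm : Measurable fun ω => |A ω 0| ^ α 0 :=
    ((measurable_pi_apply 0).comp hA).norm.pow_const _
  have hW : HomogeneousSRE P A B X α (fun ω => |A ω 0| ^ α 0) p :=
    { measurable_A := hA
      measurable_B := hB
      measurable_X := hX
      α_pos := hα
      p_pos := hp0
      p_lt_one := hp1
      α_mul_p_le := hαp
      indep := h_indep
      ident := by
        convert h_affine using 1
        ext ω j
        simp [Matrix.mulVec_diagonal]
      measurable_W := hWm
      W_nonneg := fun ω => Real.rpow_nonneg (abs_nonneg _) _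
      W_eq := ae_all_iff.2 h_hom
      indep_W := h_indep.comp (φ := fun a : Fin d → ℝ => |a 0| ^ α 0)
        ((measurable_pi_apply 0).norm.pow_const _) measurable_id
      integrable_W := by
        -- The integral of a non-integrable function is 0 by convention, so the value 1 already
        -- forces integrability.
        by_contra hn
        have h0 := h_cramer 0
        rw [integral_undef hn] at h0
        exact zero_ne_one h0
      integral_W := h_cramer 0
      integrable_log := by
        simp only [rpow_mul_posLog_rpow (abs_nonneg _) (hα 0)]
        exact (h_log 0).const_mul _
      nonarithmetic := fun a ha => h_nonarith 0
        (isArithmetic_condLogLaw ((measurable_pi_apply 0).comp hA) (hα 0) ha)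
      moment := h_moment }
  obtain ⟨C, h⟩ := hW.exists_hasScaledLimits
  have hinteg : ∀ f : (Fin d → ℝ) →ᵇ ℝ, SupportedAwayFromZero α f →
      Integrable (fun x : Punctured d => f x.1) h.limitMeasure := fun f hf => by
    obtain ⟨r, hr, hf0⟩ := hf.exists_vanish
    exact h.integrable_of_vanish (f.continuous.comp continuous_subtype_val).measurable
      (fun x => f.norm_coe_le_norm x.1) hr fun x hx => hf0 x.1 hx
  have hpolar : ∀ f : (Fin d → ℝ) →ᵇ ℝ, SupportedAwayFromZero α f →
      ∫ x : Punctured d, f x.1 ∂h.limitMeasure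
        = ∫ s in Ioi (0 : ℝ), (∫ ω, f (dilation α s ω.1) ∂h.spectralMeasure) / s ^ 2 :=
    fun f hf => h.integral_polar f.continuous.measurable (hinteg f hf)
  have hmass : h.spectralMeasure univ = ENNReal.ofReal (h.spectralMeasure.real univ) :=
    (ENNReal.ofReal_toReal (measure_ne_top _ _)).symm
  refine ⟨h.limitMeasure, h.spectralMeasure.real univ, h.spectralMeasure, inferInstance,
    inferInstance, fun f hf => ⟨hinteg f hf, ?_⟩, h.tendsto_tail, fun f hf t ht => ?_,
    fun r hr => ?_, fun r _ => h.limitMeasure_sphere r, hpolar, hmass, fun hc => ?_⟩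
  · obtain ⟨r, hr, hf0⟩ := hf.exists_vanish
    exact h.tendsto_scaledExp f.continuous f.norm_coe_le_norm hr hf0
  · obtain ⟨r, hr, hf0⟩ := hf.exists_vanish
    exact h.integral_comp_dilation f.continuous f.norm_coe_le_norm hr hf0 ht
  · refine (measure_mono fun x hx => ?_).trans_lt
      ((h.limitMeasure_ge_le hr).trans_lt ENNReal.ofReal_lt_top)
    exact not_lt.1 (show ¬ alphaNorm α x.1 < r from hx)
  · rw [← hmass]
    have hne : h.spectralMeasure univ ≠ 0 := fun h0 => by simp [Measure.real, h0] at hc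
    refine ⟨fun t ht => h.isProbabilityMeasure_angularLaw hc ht, ⟨?_⟩, h.tendsto_angularLaw hc,
      fun f hf => ?_⟩
    · rw [Measure.smul_apply, smul_eq_mul, ENNReal.inv_mul_cancel hne (measure_ne_top _ _)]
    · rw [hpolar f hf, ← integral_const_mul]
      refine integral_congr_ae (ae_of_all _ fun s => ?_)
      simp only [integral_smul_measure, ENNReal.toReal_inv, smul_eq_mul]
      rw [← mul_div_assoc, ← mul_assoc, ← Measure.real, mul_inv_cancel₀ hc.ne', one_mul]
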